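/- **Setting.** Let $1\le k$, $d_2<d_1$, and let $W^*\in\mathbb R^{d_1\times d_2}$ have rank $k$ and columns of unit Euclidean norm, with singular values $\sigma_1^*\ge\dots\ge\sigma_k^*>0$. Write $\|\cdot\|_2$ for the spectral norm and $\operatorname{sign}(a)=1$ if $a\ge 0$, $\operatorname{sign}(a)=-1$ if $a<0$. For each batch $t=0,1,2,\dots$ one draws $m$ instances $(\mathbf x_i^{(t)},\bar{\mathbf e}_i^{(t)})$, $1\le i\le m$; all pairs (over all $t,i$) are i.i.d., where $\mathbf x$ is standard Gaussian in $\mathbb R^{d_1}$ and, independently of it, $\bar{\mathbf e}=\sqrt{d_2}\,\mathbf e_j$ with $j$ uniform on $\{1,\dots,d_2\}$. Put $\mathcal A_t(W)=(\mathbf x_i^{(t)\top}W\bar{\mathbf e}_i^{(t)})_{i\le m}$, $\mathcal A_t'(z)=\sum_i z_i\,\mathbf x_i^{(t)}\bar{\mathbf e}_i^{(t)\top}$; the observed labels are $\mathbf y^{(t)}=\operatorname{sign}(\mathcal A_t(W^*))$. For $W\in\mathbb R^{d_1\times d_2}$ let $\mathcal D(W)=\begin{bmatrix}0&W\\W^\top&0\end{bmatrix}$.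 **Algorithm ($T$ iterations).** Given a current estimate $W^{(t)}$ let $$H^{(t)}=\frac{\sqrt{d_2}}{m\sqrt{2/\pi}}\;\mathcal A_t'\big(\mathbf y^{(t)}-\operatorname{sign}(\mathcal A_t(W^{(t)}))\big).$$ Start with $\mathcal V^{(0)}=0$, $W^{(0)}=0$, and $\mathcal U^{(0)}\in\mathbb R^{(d_1+d_2)\times 2k}$ the top-$2k$ left singular vectors of $\mathcal D(H^{(0)})$. For $t=0,\dots,T-1$ let $\mathcal M^{(t)}=\mathcal D(H^{(t)})+\mathcal D(W^{(t)})$, let $\mathcal U^{(t+1)}$ be the orthonormal factor in a QR decomposition of $\mathcal M^{(t)}\mathcal U^{(t)}$, let $\mathcal V^{(t+1)}=\mathcal M^{(t)}\mathcal U^{(t+1)}$, and let $W^{(t+1)}$ be the upper right $d_1\times d_2$ block of $\mathcal U^{(t+1)}\mathcal V^{(t+1)\top}$ with each column divided by its Euclidean norm (zero columns stay zero). Any valid choice of singular vectors and of QR factors is allowed. In total $mT$ one-bit labels are used. **Theorem.** There is an absolute exponent $p\in\mathbb N$, and for every $\eta\in(0,1)$ a constant $C>0$ depending only on $\eta$,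 such that for all $d_1,d_2,k,T,m$ and $W^*$ as above the following hold, with $C_T=C\,T^p$. 1. Let $0<\delta_1\le 1$ and $$m\ \ge\ C_T\Big(12\sqrt5\,\frac{\sigma_1^*}{\sigma_k^*}+4\Big)^2\frac{d_1d_2k^{1.5}}{\delta_1^2}.$$ Then with probability at least $1-\eta$, for every run of the algorithm, if $t_0$ denotes the smallest integer $t_0>0$ with $\|W^*-W^{(t_0)}\|_2\le 1$ (with $t_0>T$ if there is none among $1,\dots,T$), then for all $0\le t<T$ $$\|W^*-W^{(t+1)}\|_2\le\delta_1^{\,t}\,\|W^*\|_2\quad\text{if }t<t_0,$$ $$\|W^*-W^{(t+1)}\|_2\le\delta_1^{\,2-2^{t_0-t}}\,\|W^{(t_0)}-W^*\|_2^{\,2^{t_0-1-t}}\quad\text{if }t\ge t_0 .$$ 2. Let $0<\varepsilon\le1$, $T\ge\log_2 d_2+\log_2\!\big(1+\log_2(1/\varepsilon)\big)+3$ and $$m\ \ge\ C_T\Big(12\sqrt5\,\frac{\sigma_1^*}{\sigma_k^*}+4\Big)^2\frac{d_1d_2k^{1.5}}{\varepsilon}.$$ Then with probability at least $1-\eta$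 every run of the algorithm ends with $\|W^*-W^{(T)}\|_2\le\varepsilon$. Thus the final error is $O(d_1d_2k^{1.5}/m)$, and error $\varepsilon$ is reached from a total of $mT=O(d_1d_2k^{1.5}/\varepsilon)$ labels, where $O$ hides $\eta$, the condition number $\sigma_1^*/\sigma_k^*$ and powers of $T$ (that is, of logarithms). -/

import Mathlib

open MeasureTheory ProbabilityTheory

namespace OneBit

noncomputable section

/-- The signum function with the convention `sgn 0 = 1`. -/
def sgn (a : ℝ) : ℝ := if 0 ≤ a then 1 else -1

/-- The spectral norm `‖M‖₂`: the operator norm between Euclidean spaces. -/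
def specNorm {d₁ d₂ : ℕ} (M : Matrix (Fin d₁) (Fin d₂) ℝ) : ℝ :=
  ‖(Matrix.toEuclideanLin M).toContinuousLinearMap‖

/-- The `i`-th largest singular value of `M`, counted from `i = 1`. -/
def singVal {d₁ d₂ : ℕ} (M : Matrix (Fin d₁) (Fin d₂) ℝ) (i : ℕ) : ℝ :=
  (Matrix.toEuclideanLin M).singularValues (i - 1)

/-- A mini-batch of `m` instances: feature vectors `xᵢ` and indices of the selected labels. -/
abbrev Batch (m d₁ d₂ : ℕ) : Type := Fin m → (Fin d₁ → ℝ) × Fin d₂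

/-- The scaled one-hot vector `√d₂ · e_j`. -/
def oneHot {d₂ : ℕ} (j : Fin d₂) : Fin d₂ → ℝ := Pi.single j (Real.sqrt d₂)

/-- The sensing operator `𝒜(W) = (xᵢᵀ W ēᵢ)ᵢ`. -/
def sensing {m d₁ d₂ : ℕ} (b : Batch m d₁ d₂) (W : Matrix (Fin d₁) (Fin d₂) ℝ) : Fin m → ℝ :=
  fun i => (b i).1 ⬝ᵥ Matrix.mulVec W (oneHot (b i).2)

/-- The adjoint `𝒜'(z) = ∑ᵢ zᵢ xᵢ ēᵢᵀ` of the sensing operator. -/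
def sensingAdj {m d₁ d₂ : ℕ} (b : Batch m d₁ d₂) (z : Fin m → ℝ) :
    Matrix (Fin d₁) (Fin d₂) ℝ :=
  ∑ i, z i • Matrix.vecMulVec (b i).1 (oneHot (b i).2)

/-- The one-bit labels `sign(𝒜(W))`. -/
def labels {m d₁ d₂ : ℕ} (b : Batch m d₁ d₂) (W : Matrix (Fin d₁) (Fin d₂) ℝ) : Fin m → ℝ :=
  fun i => sgn (sensing b W i)

/-- `H = √d₂ / (m λ) · 𝒜'(y - sign(𝒜(W)))` with `λ = √(2/π)`. -/
def correction {m d₁ d₂ : ℕ} (b : Batch m d₁ d₂) (y : Fin m → ℝ)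
    (W : Matrix (Fin d₁) (Fin d₂) ℝ) : Matrix (Fin d₁) (Fin d₂) ℝ :=
  (Real.sqrt d₂ / (m * Real.sqrt (2 / Real.pi))) • sensingAdj b (y - labels b W)

/-- The Hermitian dilation `[[0, W], [Wᵀ, 0]]`. -/
def dilation {d₁ d₂ : ℕ} (W : Matrix (Fin d₁) (Fin d₂) ℝ) :
    Matrix (Fin d₁ ⊕ Fin d₂) (Fin d₁ ⊕ Fin d₂) ℝ :=
  Matrix.fromBlocks 0 W W.transpose 0

/-- Column normalization; a zero column is left equal to zero. -/
def colNormalize {d₁ d₂ : ℕ} (A : Matrix (Fin d₁) (Fin d₂) ℝ) : Matrix (Fin d₁) (Fin d₂) ℝ :=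
  Matrix.of fun i j => A i j / Real.sqrt (∑ l, A l j ^ 2)

/-- The estimate read off from the factors `U, V`: the off-diagonal `d₁ × d₂` block of `U Vᵀ`,
with normalized columns. -/
def estimate {d₁ d₂ r : ℕ} (U V : Matrix (Fin d₁ ⊕ Fin d₂) (Fin r) ℝ) :
    Matrix (Fin d₁) (Fin d₂) ℝ :=
  colNormalize (U * V.transpose).toBlocks₁₂

/-- The columns of `U` are top-`r` left singular vectors of the square matrix `A`: they are the
first `r` columns of the left factor of some singular value decomposition of `A` with singular
values in decreasing order. -/
def IsTopLeftSingular {n : Type} [Fintype n] {r : ℕ} (A : Matrix n n ℝ)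
    (U : Matrix n (Fin r) ℝ) : Prop :=
  ∃ (h : r ≤ Fintype.card n) (P Q : Matrix n (Fin (Fintype.card n)) ℝ)
    (s : Fin (Fintype.card n) → ℝ),
    P.transpose * P = 1 ∧ Q.transpose * Q = 1 ∧ Antitone s ∧ (∀ i, 0 ≤ s i) ∧
    A = P * Matrix.diagonal s * Q.transpose ∧
    ∀ a i, U a i = P a (Fin.castLE h i)

/-- `Q` is the orthonormal factor of a (thin) QR decomposition of `A`. -/
def IsQRFactor {n : Type} [Fintype n] {r : ℕ} (A Q : Matrix n (Fin r) ℝ) : Prop :=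
  Q.transpose * Q = 1 ∧
    ∃ R : Matrix (Fin r) (Fin r) ℝ, (∀ i j, j < i → R i j = 0) ∧ A = Q * R

/-- `U, V` are the factors produced by the alternating power iteration in `T` steps with target
rank `k`, on the mini-batches `b 0, …, b (T - 1)` with label vectors `y 0, …, y (T - 1)`; any
valid choice in the singular value decomposition and in the QR decompositions is allowed. -/
structure IsRun {m d₁ d₂ : ℕ} (k T : ℕ) (b : ℕ → Batch m d₁ d₂) (y : ℕ → Fin m → ℝ)
    (U V : ℕ → Matrix (Fin d₁ ⊕ Fin d₂) (Fin (2 * k)) ℝ) : Prop where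
  init_V : V 0 = 0
  init_U : IsTopLeftSingular (dilation (correction (b 0) (y 0) 0)) (U 0)
  step_U : ∀ t < T, IsQRFactor
    ((dilation (correction (b t) (y t) (estimate (U t) (V t))) +
      dilation (estimate (U t) (V t))) * U t) (U (t + 1))
  step_V : ∀ t < T, V (t + 1) =
    (dilation (correction (b t) (y t) (estimate (U t) (V t))) +
      dilation (estimate (U t) (V t))) * U (t + 1)

/-- The stream of mini-batches: batch `t` consists of the instances `Z (t, i)`. -/
def stream {Ω : Type*} {m d₁ d₂ : ℕ} (Z : ℕ × Fin m → Ω → (Fin d₁ → ℝ) × Fin d₂) (ω : Ω) :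
    ℕ → Batch m d₁ d₂ :=
  fun t i => Z (t, i) ω

/-- The law of one instance: a standard Gaussian feature vector and, independently of it, a
uniformly distributed label index. -/
def instanceLaw (d₁ d₂ : ℕ) : Measure ((Fin d₁ → ℝ) × Fin d₂) :=
  (Measure.pi fun _ : Fin d₁ => gaussianReal 0 1).prod (uniformOn (Set.univ : Set (Fin d₂)))

/-- The scale `(12√5 σ₁/σ_k + 4)² d₁ d₂ k^{3/2}` of the batch size. -/
def sampleScale {d₁ d₂ : ℕ} (k : ℕ) (W : Matrix (Fin d₁) (Fin d₂) ℝ) : ℝ :=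
  (12 * Real.sqrt 5 * (singVal W 1 / singVal W k) + 4) ^ 2 * d₁ * d₂ * (k : ℝ) ^ (3 / 2 : ℝ)

/-- The two-phase error bound for the errors `err t = ‖W* - W⁽ᵗ⁾‖₂`, `t ≤ T`, with `nrm = ‖W*‖₂`.
Here `t₀` is the smallest positive integer with `err t₀ ≤ 1` (or exceeds `T` if no such integer
is reached within the `T` iterations). -/
def TwoPhase (T : ℕ) (δ nrm : ℝ) (err : ℕ → ℝ) : Prop :=
  ∃ t₀ : ℕ, 0 < t₀ ∧ (∀ s, 0 < s → s < t₀ → s ≤ T → 1 < err s) ∧ (t₀ ≤ T → err t₀ ≤ 1) ∧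
    (∀ t < T, t < t₀ → err (t + 1) ≤ δ ^ t * nrm) ∧
    (∀ t < T, t₀ ≤ t → err (t + 1) ≤
      δ ^ (2 - (2 : ℝ) ^ ((t₀ : ℝ) - t)) * err t₀ ^ ((2 : ℝ) ^ ((t₀ : ℝ) - 1 - t)))

end

end OneBit

namespace OneBit

open scoped Matrix Matrix.Norms.Frobenius

/-!
Write `H = (W* - W) + N`. One iteration multiplies by `𝒟(H) + 𝒟(W) = 𝒟(W*) + 𝒟(N)`, so it is a
perturbed power iteration for the matrix `𝒟(W*)`, which has rank `2k` and spectral gap `σ_k`. As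
long as `‖𝒟(N)‖_F ≤ σ_k / 8`, the column space of `U` stays close to the range of `𝒟(W*)`, and the
next estimate has error at most `2 (2 ‖𝒟(N) P‖_F + ‖𝒟(N) Q‖_F)`, where `P` and `Q` are the
projections onto the column space of `U` and onto the range of `𝒟(W*)`.

For a fixed `W` with unit columns the noise `N` is centered, since `𝔼[sign⟨u, x⟩ x] = √(2/π) u` for
a unit vector `u`. The labels of `W*` and `W` differ only with probability of order `‖W* - W‖₂`, so
that `𝔼 ‖𝒟(N) X‖_F² ≲ (d₁ d₂ / m) ‖W* - W‖₂ ‖X‖_F²`. The pair `(W, P)` before step `t ≥ 1` is a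
function of the earlier batches, hence independent of batch `t`, and Markov's inequality applies.
As `P` and `Q` have rank `2k`, this yields `err (t + 1) ≤ δ √(err t)` with high probability, and
both bounds follow from this recursion. The pair `(W, P)` does not depend on the choices made in the
algorithm; expressing `P` by functional calculus shows that it is moreover measurable.
-/

section Frobenius

variable {l m n : Type*} [Fintype l] [Fintype m] [Fintype n]

lemma frobenius_norm_sq (A : Matrix m n ℝ) : ‖A‖ ^ 2 = ∑ i, ∑ j, A i j ^ 2 := by
  rw [Matrix.frobenius_norm_def, ← Real.sqrt_eq_rpow, Real.sq_sqrt (by positivity)]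
  simp

lemma frobenius_norm_eq_sqrt (A : Matrix m n ℝ) : ‖A‖ = Real.sqrt (∑ i, ∑ j, A i j ^ 2) := by
  rw [← frobenius_norm_sq, Real.sqrt_sq (norm_nonneg _)]

lemma frobenius_norm_sq_eq_trace_mul_transpose (A : Matrix m n ℝ) : ‖A‖ ^ 2 = (A * Aᵀ).trace := by
  rw [frobenius_norm_sq]
  simp [Matrix.trace, Matrix.mul_apply, sq]

lemma frobenius_norm_sq_eq_trace_transpose_mul (A : Matrix m n ℝ) : ‖A‖ ^ 2 = (Aᵀ * A).trace := by
  rw [frobenius_norm_sq_eq_trace_mul_transpose, Matrix.trace_mul_comm]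

lemma norm_isometry_mul [DecidableEq m] {Z : Matrix n m ℝ} (hZ : Zᵀ * Z = 1)
    (Y : Matrix m l ℝ) : ‖Z * Y‖ = ‖Y‖ := by
  refine (sq_eq_sq₀ (norm_nonneg _) (norm_nonneg _)).1 ?_
  rw [frobenius_norm_sq_eq_trace_transpose_mul, frobenius_norm_sq_eq_trace_transpose_mul,
    Matrix.transpose_mul, Matrix.mul_assoc, ← Matrix.mul_assoc _ Z, hZ, Matrix.one_mul]

lemma norm_mul_transpose_isometry [DecidableEq m] {Z : Matrix n m ℝ} (hZ : Zᵀ * Z = 1)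
    (Y : Matrix l m ℝ) : ‖Y * Zᵀ‖ = ‖Y‖ := by
  rw [← Matrix.frobenius_norm_transpose, Matrix.transpose_mul, Matrix.transpose_transpose,
    norm_isometry_mul hZ, Matrix.frobenius_norm_transpose]

end Frobenius

section StarProjection

variable {m n : Type*} [Fintype m] [Fintype n] {P Q : Matrix n n ℝ}

omit [Fintype m] in
lemma transpose_eq_of_isStarProjection (hP : IsStarProjection P) : Pᵀ = P := by
  simpa only [Matrix.star_eq_conjTranspose, Matrix.conjTranspose_eq_transpose_of_trivial]
    using hP.isSelfAdjoint.star_eq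

lemma isStarProjection_mul_transpose [DecidableEq m] {U : Matrix n m ℝ} (hU : Uᵀ * U = 1) :
    IsStarProjection (U * Uᵀ) where
  isIdempotentElem := by
    rw [IsIdempotentElem, Matrix.mul_assoc, ← Matrix.mul_assoc Uᵀ, hU, Matrix.one_mul]
  isSelfAdjoint := by
    simp [IsSelfAdjoint, Matrix.star_eq_conjTranspose, Matrix.conjTranspose_eq_transpose_of_trivial]

lemma norm_sq_eq_trace_of_isStarProjection (hP : IsStarProjection P) : ‖P‖ ^ 2 = P.trace := by
  rw [frobenius_norm_sq_eq_trace_mul_transpose, transpose_eq_of_isStarProjection hP,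
    hP.isIdempotentElem.eq]

lemma norm_projection_mul_sq (hP : IsStarProjection P) (A : Matrix n m ℝ) :
    ‖P * A‖ ^ 2 = (P * (A * Aᵀ)).trace := by
  rw [frobenius_norm_sq_eq_trace_mul_transpose, Matrix.transpose_mul,
    transpose_eq_of_isStarProjection hP, ← Matrix.mul_assoc, Matrix.trace_mul_comm,
    ← Matrix.mul_assoc, ← Matrix.mul_assoc, hP.isIdempotentElem.eq, Matrix.mul_assoc]

lemma norm_projection_mul_sq_add [DecidableEq n] (hP : IsStarProjection P) (A : Matrix n m ℝ) :
    ‖P * A‖ ^ 2 + ‖(1 - P) * A‖ ^ 2 = ‖A‖ ^ 2 := by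
  rw [norm_projection_mul_sq hP, norm_projection_mul_sq hP.one_sub,
    frobenius_norm_sq_eq_trace_mul_transpose, ← Matrix.trace_add, ← add_mul, add_sub_cancel,
    Matrix.one_mul]

lemma norm_projection_mul_le (hP : IsStarProjection P) (A : Matrix n m ℝ) : ‖P * A‖ ≤ ‖A‖ := by
  classical
  refine (sq_le_sq₀ (norm_nonneg _) (norm_nonneg _)).1 ?_
  rw [← norm_projection_mul_sq_add hP A]
  exact le_add_of_nonneg_right (sq_nonneg _)

lemma norm_mul_projection_le (hP : IsStarProjection P) (A : Matrix m n ℝ) : ‖A * P‖ ≤ ‖A‖ := by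
  rw [← Matrix.frobenius_norm_transpose, Matrix.transpose_mul,
    transpose_eq_of_isStarProjection hP, ← Matrix.frobenius_norm_transpose A]
  exact norm_projection_mul_le hP _

lemma norm_one_sub_mul_comm_of_trace_eq [DecidableEq n] (hP : IsStarProjection P)
    (hQ : IsStarProjection Q) (h : P.trace = Q.trace) : ‖(1 - Q) * P‖ = ‖(1 - P) * Q‖ := by
  refine (sq_eq_sq₀ (norm_nonneg _) (norm_nonneg _)).1 ?_
  rw [norm_projection_mul_sq hQ.one_sub, norm_projection_mul_sq hP.one_sub,
    transpose_eq_of_isStarProjection hP, transpose_eq_of_isStarProjection hQ,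
    hP.isIdempotentElem.eq, hQ.isIdempotentElem.eq, sub_mul, sub_mul, Matrix.one_mul,
    Matrix.one_mul, Matrix.trace_sub, Matrix.trace_sub, Matrix.trace_mul_comm Q P, h]

end StarProjection

section Perturbation

variable {n : Type} [Fintype n]

/-- `D` is a symmetric matrix, `Q` is the orthogonal projection onto its range, and the nonzero
eigenvalues of `D` have absolute value at least `σ`. The latter is encoded by testing `D` against
rectangular matrices in the Frobenius norm. -/
structure IsRangeProj (D Q : Matrix n n ℝ) (σ : ℝ) : Prop where
  gap_pos : 0 < σ
  transpose_eq : Dᵀ = D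
  isStarProjection : IsStarProjection Q
  mul_proj : D * Q = D
  gap_mul_norm_le : ∀ {l : Type} [Fintype l] (X : Matrix n l ℝ), σ * ‖Q * X‖ ≤ ‖D * X‖

namespace IsRangeProj

variable {D Q P P' E : Matrix n n ℝ} {σ : ℝ}

lemma proj_mul (h : IsRangeProj D Q σ) : Q * D = D := by
  have := congrArg Matrix.transpose h.mul_proj
  rwa [Matrix.transpose_mul, h.transpose_eq,
    transpose_eq_of_isStarProjection h.isStarProjection] at this

lemma gap_mul_norm_mul_proj_le (h : IsRangeProj D Q σ) {l : Type} [Fintype l]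
    (X : Matrix l n ℝ) : σ * ‖X * Q‖ ≤ ‖X * D‖ := by
  have := h.gap_mul_norm_le Xᵀ
  rwa [← Matrix.frobenius_norm_transpose, ← Matrix.frobenius_norm_transpose (D * _),
    Matrix.transpose_mul, Matrix.transpose_mul, Matrix.transpose_transpose, h.transpose_eq,
    transpose_eq_of_isStarProjection h.isStarProjection] at this

variable [DecidableEq n]

-- Since `X = (1 - P') D` satisfies `X = X Q`, one has `X = X P Q + X Qᵀ (1 - P) Q`. The first
-- summand is controlled by `E P`, and the second one has norm at most `‖X‖ / 4`.
lemma norm_one_sub_mul_le (h : IsRangeProj D Q σ) (hP : IsStarProjection P)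
    (hP' : IsStarProjection P') (hzero : (1 - P') * ((D + E) * P) = 0)
    (hPQ : ‖(1 - P) * Q‖ ≤ 1 / 2) : ‖(1 - P') * D‖ ≤ 4 / 3 * ‖E * P‖ := by
  set X := (1 - P') * D with hX
  have hXP : X * P = -((1 - P') * (E * P)) := by
    rw [add_mul, mul_add] at hzero
    rw [hX, Matrix.mul_assoc]
    exact eq_neg_of_add_eq_zero_left hzero
  have hXQ : X * Q = X := by rw [hX, Matrix.mul_assoc, h.mul_proj]
  have hdec : X = X * P * Q + X * (((1 - P) * Q)ᵀ * ((1 - P) * Q)) := by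
    rw [Matrix.transpose_mul, transpose_eq_of_isStarProjection hP.one_sub,
      transpose_eq_of_isStarProjection h.isStarProjection, Matrix.mul_assoc Q,
      ← Matrix.mul_assoc (1 - P), hP.one_sub.isIdempotentElem.eq, ← Matrix.mul_assoc X, hXQ,
      ← Matrix.mul_assoc, ← add_mul, ← mul_add, add_sub_cancel, Matrix.mul_one, hXQ]
  have hfirst : ‖X * P * Q‖ ≤ ‖E * P‖ := by
    refine (norm_mul_projection_le h.isStarProjection _).trans ?_
    rw [hXP, norm_neg]
    exact norm_projection_mul_le hP'.one_sub _
  have hsecond : ‖X * (((1 - P) * Q)ᵀ * ((1 - P) * Q))‖ ≤ ‖X‖ * (1 / 2 * (1 / 2)) := by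
    refine (Matrix.frobenius_norm_mul _ _).trans ?_
    gcongr
    refine (Matrix.frobenius_norm_mul _ _).trans ?_
    rw [Matrix.frobenius_norm_transpose]
    gcongr
  have hX_le : ‖X‖ ≤ ‖X * P * Q‖ + ‖X * (((1 - P) * Q)ᵀ * ((1 - P) * Q))‖ := by
    conv_lhs => rw [hdec]
    exact norm_add_le _ _
  linarith

lemma norm_one_sub_mul_proj_le_half (h : IsRangeProj D Q σ) (hP : IsStarProjection P)
    (hP' : IsStarProjection P') (hzero : (1 - P') * ((D + E) * P) = 0)
    (hPQ : ‖(1 - P) * Q‖ ≤ 1 / 2) (hE : ‖E‖ ≤ σ / 8) : ‖(1 - P') * Q‖ ≤ 1 / 2 := by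
  have hgap := h.gap_mul_norm_mul_proj_le (1 - P')
  have hD := h.norm_one_sub_mul_le hP hP' hzero hPQ
  have hEP := norm_mul_projection_le hP E
  by_contra! hc
  nlinarith [h.gap_pos]

lemma norm_projection_mul_noise_le (hQ : IsStarProjection Q) (hP' : IsStarProjection P')
    (htr : P'.trace = Q.trace) (hE : Eᵀ = E) :
    ‖P' * E‖ ≤ ‖E * Q‖ + ‖E‖ * ‖(1 - P') * Q‖ := by
  have hdec : E * P' = E * Q * P' + E * ((1 - Q) * P') := by
    rw [← Matrix.mul_assoc, ← add_mul, mul_sub, Matrix.mul_one, add_sub_cancel]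
  rw [← Matrix.frobenius_norm_transpose, Matrix.transpose_mul, hE,
    transpose_eq_of_isStarProjection hP', hdec, ← norm_one_sub_mul_comm_of_trace_eq hP' hQ htr]
  exact (norm_add_le _ _).trans
    (add_le_add (norm_mul_projection_le hP' _) (Matrix.frobenius_norm_mul _ _))

lemma norm_sub_projection_mul_le (h : IsRangeProj D Q σ) (hP : IsStarProjection P)
    (hP' : IsStarProjection P') (htr : P'.trace = Q.trace) (hE : Eᵀ = E)
    (hzero : (1 - P') * ((D + E) * P) = 0) (hPQ : ‖(1 - P) * Q‖ ≤ 1 / 2) (hEσ : ‖E‖ ≤ σ / 8) :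
    ‖D - P' * (D + E)‖ ≤ 2 * ‖E * P‖ + ‖E * Q‖ := by
  have hD := h.norm_one_sub_mul_le hP hP' hzero hPQ
  have hgap := h.gap_mul_norm_mul_proj_le (1 - P')
  have hnoise := norm_projection_mul_noise_le h.isStarProjection hP' htr hE
  have hEσ' := mul_le_mul_of_nonneg_right hEσ (norm_nonneg ((1 - P') * Q))
  have hdec : D - P' * (D + E) = (1 - P') * D - P' * E := by
    rw [sub_mul, mul_add, Matrix.one_mul]; abel
  rw [hdec]
  refine (norm_sub_le _ _).trans ?_
  linarith [norm_nonneg (E * P)]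

end IsRangeProj

end Perturbation

section LeftSingularProj

variable {l m n : Type*} [Fintype l] [Fintype m] [Fintype n]

lemma trace_transpose_mul_le (A B : Matrix m n ℝ) : (Aᵀ * B).trace ≤ ‖A‖ * ‖B‖ := by
  have hCS := Finset.sum_mul_sq_le_sq_mul_sq Finset.univ
    (fun p : n × m => A p.2 p.1) (fun p => B p.2 p.1)
  have hsq : ∀ C : Matrix m n ℝ, ∑ p : n × m, C p.2 p.1 ^ 2 = ‖C‖ ^ 2 := fun C => by
    rw [frobenius_norm_sq, Finset.sum_comm, Fintype.sum_prod_type]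
  rw [hsq, hsq, ← mul_pow] at hCS
  simpa [Matrix.trace, Matrix.mul_apply, Fintype.sum_prod_type]
    using abs_le_of_sq_le_sq' hCS (by positivity) |>.2

variable [DecidableEq n]

/-- The orthogonal projection onto the span of the left singular vectors of `A` whose singular
value exceeds `τ`, for `τ ≥ 0`. It is defined as a spectral projection of `A Aᵀ`. -/
noncomputable def leftSingularProj (τ : ℝ) (A : Matrix n m ℝ) : Matrix n n ℝ :=
  cfc ((Set.Ioi (τ ^ 2)).indicator 1) (A * Aᵀ)

omit [Fintype n] [DecidableEq n] in
lemma isSelfAdjoint_mul_transpose (A : Matrix n m ℝ) : IsSelfAdjoint (A * Aᵀ) := by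
  simp [IsSelfAdjoint, Matrix.star_eq_conjTranspose, Matrix.conjTranspose_eq_transpose_of_trivial]

lemma continuousOn_real_spectrum (f : ℝ → ℝ) (S : Matrix n n ℝ) :
    ContinuousOn f (spectrum ℝ S) :=
  Matrix.finite_real_spectrum.continuousOn f

open scoped MatrixOrder in
lemma trace_transpose_mul_cfc_mul_le {f g : ℝ → ℝ} (hfg : ∀ x, f x ≤ g x) {S : Matrix n n ℝ}
    (Y : Matrix n l ℝ) : (Yᵀ * (cfc f S * Y)).trace ≤ (Yᵀ * (cfc g S * Y)).trace := by
  have hle : cfc f S ≤ cfc g S := cfc_mono (fun x _ => hfg x) (continuousOn_real_spectrum _ _)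
    (continuousOn_real_spectrum _ _)
  have := ((Matrix.le_iff.1 hle).conjTranspose_mul_mul_same Y).trace_nonneg
  simpa [Matrix.mul_assoc, Matrix.mul_sub, Matrix.sub_mul] using this

lemma norm_cfc_mul_sq (f : ℝ → ℝ) (S : Matrix n n ℝ) (Y : Matrix n l ℝ) :
    ‖cfc f S * Y‖ ^ 2 = (Yᵀ * (cfc (fun x => f x * f x) S * Y)).trace := by
  have hsymm : (cfc f S)ᵀ = cfc f S := cfc_predicate (p := IsSelfAdjoint) f S
  rw [frobenius_norm_sq_eq_trace_transpose_mul, Matrix.transpose_mul, hsymm,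
    cfc_mul _ _ _ (continuousOn_real_spectrum _ _) (continuousOn_real_spectrum _ _)]
  simp only [Matrix.mul_assoc]

lemma norm_transpose_mul_cfc_mul_sq (f : ℝ → ℝ) (A : Matrix n m ℝ) (Y : Matrix n l ℝ) :
    ‖Aᵀ * (cfc f (A * Aᵀ) * Y)‖ ^ 2 =
      (Yᵀ * (cfc (fun x => f x * (x * f x)) (A * Aᵀ) * Y)).trace := by
  have hsymm : (cfc f (A * Aᵀ))ᵀ = cfc f (A * Aᵀ) := cfc_predicate (p := IsSelfAdjoint) f _
  rw [frobenius_norm_sq_eq_trace_transpose_mul, Matrix.transpose_mul, Matrix.transpose_mul, hsymm,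
    Matrix.transpose_transpose,
    cfc_mul _ _ _ (continuousOn_real_spectrum _ _) (continuousOn_real_spectrum _ _),
    cfc_mul _ _ _ (continuousOn_real_spectrum _ _) (continuousOn_real_spectrum _ _),
    cfc_id' ℝ (A * Aᵀ) (isSelfAdjoint_mul_transpose A)]
  simp only [Matrix.mul_assoc]

lemma mul_norm_leftSingularProj_mul_le {τ : ℝ} (hτ : 0 ≤ τ) (A : Matrix n m ℝ)
    (Y : Matrix n l ℝ) :
    τ * ‖leftSingularProj τ A * Y‖ ≤ ‖Aᵀ * (leftSingularProj τ A * Y)‖ := by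
  refine (sq_le_sq₀ (mul_nonneg hτ (norm_nonneg _)) (norm_nonneg _)).1 ?_
  rw [mul_pow, leftSingularProj, norm_cfc_mul_sq, norm_transpose_mul_cfc_mul_sq, ← smul_eq_mul,
    ← Matrix.trace_smul, ← Matrix.mul_smul, ← Matrix.smul_mul,
    ← cfc_smul _ _ _ (continuousOn_real_spectrum _ _)]
  refine trace_transpose_mul_cfc_mul_le (fun x => ?_) Y
  by_cases hx : x ∈ Set.Ioi (τ ^ 2)
  · simpa [hx] using (Set.mem_Ioi.1 hx).le
  · simp [hx]

lemma one_sub_leftSingularProj (τ : ℝ) (A : Matrix n m ℝ) :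
    1 - leftSingularProj τ A = cfc ((Set.Iic (τ ^ 2)).indicator 1) (A * Aᵀ) := by
  rw [leftSingularProj, ← cfc_one ℝ (A * Aᵀ) (isSelfAdjoint_mul_transpose A),
    ← cfc_sub _ _ _ (continuousOn_real_spectrum _ _) (continuousOn_real_spectrum _ _)]
  congr 1
  funext x
  by_cases hx : x ≤ τ ^ 2
  · simp [hx]
  · simp [hx, not_le.1 hx]

lemma norm_transpose_mul_one_sub_leftSingularProj_mul_le {τ : ℝ} (hτ : 0 ≤ τ) (A : Matrix n m ℝ)
    (Y : Matrix n l ℝ) :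
    ‖Aᵀ * ((1 - leftSingularProj τ A) * Y)‖ ≤ τ * ‖(1 - leftSingularProj τ A) * Y‖ := by
  refine (sq_le_sq₀ (norm_nonneg _) (mul_nonneg hτ (norm_nonneg _))).1 ?_
  rw [mul_pow, one_sub_leftSingularProj, norm_cfc_mul_sq, norm_transpose_mul_cfc_mul_sq,
    ← smul_eq_mul (τ ^ 2), ← Matrix.trace_smul, ← Matrix.mul_smul, ← Matrix.smul_mul,
    ← cfc_smul _ _ _ (continuousOn_real_spectrum _ _)]
  refine trace_transpose_mul_cfc_mul_le (fun x => ?_) Y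
  by_cases hx : x ≤ τ ^ 2 <;> simp [hx]

lemma leftSingularProj_eq_of_gap {A : Matrix n m ℝ} {P : Matrix n n ℝ} {τ c : ℝ}
    (hP : IsStarProjection P) (hcomm : Commute P (A * Aᵀ)) (hτ : 0 ≤ τ) (hτc : τ < c)
    (hlow : ∀ Y : Matrix n n ℝ, c * ‖P * Y‖ ≤ ‖Aᵀ * (P * Y)‖) (hupp : ‖(1 - P) * A‖ < τ) :
    leftSingularProj τ A = P := by
  set G := leftSingularProj τ A
  have hGP : Commute P G := (hcomm.symm.cfc_real _).symm
  have hone : (1 - G) * P = 0 := by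
    rw [← norm_le_zero_iff]
    have h1 := norm_transpose_mul_one_sub_leftSingularProj_mul_le hτ A P
    have h2 := hlow (1 - G)
    rw [mul_sub, hGP.eq, mul_one, ← one_sub_mul] at h2
    nlinarith
  have htwo : G * (1 - P) = 0 := by
    rw [← norm_le_zero_iff]
    have h1 := mul_norm_leftSingularProj_mul_le hτ A (1 - P)
    have h2 : ‖Aᵀ * (G * (1 - P))‖ ≤ ‖(1 - P) * A‖ * ‖G * (1 - P)‖ := by
      rw [← Matrix.frobenius_norm_transpose ((1 - P) * A), Matrix.transpose_mul,
        transpose_eq_of_isStarProjection hP.one_sub]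
      refine le_trans (le_of_eq ?_) (Matrix.frobenius_norm_mul _ _)
      rw [Matrix.mul_assoc, ← Matrix.mul_assoc (1 - P) G, ((Commute.one_left G).sub_left hGP).eq,
        Matrix.mul_assoc, hP.one_sub.isIdempotentElem.eq]
    nlinarith [norm_nonneg (G * (1 - P))]
  rw [sub_mul, one_mul, sub_eq_zero] at hone
  rw [mul_sub, mul_one, sub_eq_zero] at htwo
  rw [htwo, ← hone]

lemma mul_norm_le_norm_transpose_mul {d : Type} [Fintype d] {R : Matrix d d ℝ}
    {c : ℝ} (hc : 0 < c) (hR : ∀ {l : Type} [Fintype l] (Z : Matrix d l ℝ), c * ‖Z‖ ≤ ‖R * Z‖)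
    {l : Type} [Fintype l] (Y : Matrix d l ℝ) : c * ‖Y‖ ≤ ‖Rᵀ * Y‖ := by
  classical
  have hunit : IsUnit R.det := by
    rw [← Matrix.isUnit_iff_isUnit_det, ← Matrix.mulVec_injective_iff_isUnit]
    refine (injective_iff_map_eq_zero R.mulVecLin).2 fun x hx => ?_
    have hx' : R *ᵥ x = 0 := hx
    have := hR (Matrix.replicateCol Unit x)
    rw [← Matrix.replicateCol_mulVec, hx', Matrix.replicateCol_zero, norm_zero] at this
    rw [← Matrix.replicateCol_eq_zero (ι := Unit), ← norm_le_zero_iff]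
    nlinarith
  have hsurj : R * (R⁻¹ * Y) = Y := Matrix.mul_nonsing_inv_cancel_left R Y hunit
  have hCS := trace_transpose_mul_le (Rᵀ * Y) (R⁻¹ * Y)
  rw [Matrix.transpose_mul, Matrix.transpose_transpose, Matrix.mul_assoc, hsurj,
    ← frobenius_norm_sq_eq_trace_transpose_mul] at hCS
  have hinv := hR (R⁻¹ * Y)
  rw [hsurj] at hinv
  rcases (norm_nonneg Y).eq_or_lt with hY | hY
  · rw [← hY, mul_zero]
    exact norm_nonneg _
  · nlinarith [norm_nonneg (Rᵀ * Y)]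

end LeftSingularProj

section LeftSingularProjTendsto

variable {m n : Type*} [Fintype m] [Fintype n] [DecidableEq n]

lemma tendsto_pow_div_mul_pow_add_pow {a x : ℝ} (ha : 0 < a) (hx : 0 ≤ x) :
    Filter.Tendsto (fun p : ℕ => x ^ p / (p * a ^ p + x ^ p)) Filter.atTop
      (nhds ((Set.Ioi a).indicator 1 x)) := by
  by_cases hax : a < x
  · have hx0 : 0 < x := ha.trans hax
    have hlim := ((tendsto_self_mul_const_pow_of_lt_one (div_nonneg ha.le hx)
      ((div_lt_one hx0).2 hax)).add_const 1).inv₀ (by norm_num)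
    rw [zero_add, inv_one] at hlim
    simp only [Set.indicator, Set.mem_Ioi, hax, if_true, Pi.one_apply]
    refine hlim.congr fun p => ?_
    have : (p : ℝ) * a ^ p + x ^ p ≠ 0 := by positivity
    rw [div_pow]
    field_simp
  · have hxa : x ≤ a := not_lt.1 hax
    simp only [Set.indicator, Set.mem_Ioi, hax, if_false]
    refine squeeze_zero' (.of_forall fun p => by positivity) ?_ tendsto_one_div_atTop_nhds_zero_nat
    filter_upwards [Filter.eventually_gt_atTop 0] with p hp
    have hp' : (0 : ℝ) < p := by exact_mod_cast hp
    rw [div_le_div_iff₀ (by positivity) hp', one_mul]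
    have := mul_le_mul_of_nonneg_left (pow_le_pow_left₀ hx hxa p) hp'.le
    have := pow_nonneg hx p
    linarith

lemma tendsto_cfc_of_forall_tendsto {S : Matrix n n ℝ} {f : ℕ → ℝ → ℝ} {g : ℝ → ℝ}
    (h : ∀ x ∈ spectrum ℝ S, Filter.Tendsto (f · x) Filter.atTop (nhds (g x))) :
    Filter.Tendsto (fun p => cfc (f p) S) Filter.atTop (nhds (cfc g S)) := by
  refine tendsto_cfc_fun (Metric.tendstoUniformlyOn_iff.2 fun ε hε => ?_)
    (.of_forall fun p => continuousOn_real_spectrum _ _)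
  refine (Filter.eventually_all_finite Matrix.finite_real_spectrum).2 fun x hx => ?_
  simpa only [dist_comm] using Metric.tendsto_nhds.1 (h x hx) ε hε

open scoped MatrixOrder in
lemma nonneg_of_mem_spectrum_mul_transpose {A : Matrix n m ℝ} {x : ℝ}
    (hx : x ∈ spectrum ℝ (A * Aᵀ)) : 0 ≤ x :=
  spectrum_nonneg_of_nonneg
    (Matrix.nonneg_iff_posSemidef.2 (Matrix.posSemidef_self_mul_conjTranspose A)) hx

lemma pow_mul_inv_eq_cfc (A : Matrix n m ℝ) {b : ℝ} (hb : 0 < b) (p : ℕ) :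
    (A * Aᵀ) ^ p * (b • (1 : Matrix n n ℝ) + (A * Aᵀ) ^ p)⁻¹ =
      cfc (fun x : ℝ => x ^ p / (b + x ^ p)) (A * Aᵀ) := by
  have hsa := isSelfAdjoint_mul_transpose A
  have hcont := fun f => continuousOn_real_spectrum f (A * Aᵀ)
  have hden : b • (1 : Matrix n n ℝ) + (A * Aᵀ) ^ p = cfc (fun x : ℝ => b + x ^ p) (A * Aᵀ) := by
    rw [cfc_const_add _ _ _ (hcont _), cfc_pow_id _ _ hsa, Algebra.algebraMap_eq_smul_one]
  have hinv : (b • (1 : Matrix n n ℝ) + (A * Aᵀ) ^ p)⁻¹ =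
      cfc (fun x : ℝ => (b + x ^ p)⁻¹) (A * Aᵀ) := by
    refine Matrix.inv_eq_right_inv ?_
    rw [hden, ← cfc_mul _ _ _ (hcont _) (hcont _), ← cfc_one ℝ (A * Aᵀ) hsa]
    refine cfc_congr fun x hx => mul_inv_cancel₀ ?_
    have := nonneg_of_mem_spectrum_mul_transpose hx
    positivity
  rw [hinv, ← cfc_pow_id (R := ℝ) _ _ hsa, ← cfc_mul _ _ _ (hcont _) (hcont _)]
  simp only [div_eq_mul_inv]

-- The factor `p` makes the limit vanish at the eigenvalue `τ ^ 2`.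
lemma tendsto_leftSingularProj {τ : ℝ} (hτ : 0 < τ) (A : Matrix n m ℝ) :
    Filter.Tendsto (fun p : ℕ => (A * Aᵀ) ^ p *
      ((p * (τ ^ 2) ^ p : ℝ) • (1 : Matrix n n ℝ) + (A * Aᵀ) ^ p)⁻¹)
      Filter.atTop (nhds (leftSingularProj τ A)) := by
  refine (tendsto_cfc_of_forall_tendsto fun x hx => tendsto_pow_div_mul_pow_add_pow
    (by positivity) (nonneg_of_mem_spectrum_mul_transpose hx)).congr' ?_
  filter_upwards [Filter.eventually_gt_atTop 0] with p hp
  exact (pow_mul_inv_eq_cfc A (by positivity) p).symm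

end LeftSingularProjTendsto

section TopLeftSingular

variable {m n : Type} {N r : ℕ}

lemma submatrix_castLE_mul_transpose (h : r ≤ N) (A : Matrix m (Fin N) ℝ)
    (B : Matrix n (Fin N) ℝ) :
    A.submatrix id (Fin.castLE h) * (B.submatrix id (Fin.castLE h))ᵀ =
      A * Matrix.diagonal (fun i : Fin N => if (i : ℕ) < r then (1 : ℝ) else 0) * Bᵀ := by
  ext a b
  rw [Matrix.mul_apply, Matrix.mul_apply]
  simp only [Matrix.transpose_apply, Matrix.submatrix_apply, id, Matrix.mul_diagonal, mul_ite,
    mul_one, mul_zero, ite_mul, zero_mul]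
  rw [← Finset.sum_filter]
  refine Finset.sum_bij (fun i _ => Fin.castLE h i) (by simp) (by simp) (fun i hi => ?_) (by simp)
  exact ⟨⟨i, (Finset.mem_filter.1 hi).2⟩, Finset.mem_univ _, rfl⟩

variable [Fintype n]

lemma submatrix_castLE_isometry (h : r ≤ N) {P : Matrix n (Fin N) ℝ} (hP : Pᵀ * P = 1) :
    (P.submatrix id (Fin.castLE h))ᵀ * P.submatrix id (Fin.castLE h) = 1 := by
  rw [Matrix.transpose_submatrix, ← Matrix.submatrix_mul _ _ _ _ _ Function.bijective_id, hP,
    Matrix.submatrix_one _ (Fin.castLE_injective h)]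

lemma sum_mul_le_sum_mul_indicator_of_antitone (hr : r ≤ N) (hr0 : 0 < r) {a c : Fin N → ℝ}
    (ha : Antitone a) (hc0 : ∀ i, 0 ≤ c i) (hc1 : ∀ i, c i ≤ 1) (hsum : ∑ i, c i = r) :
    ∑ i, a i * c i ≤ ∑ i : Fin N, a i * (if (i : ℕ) < r then 1 else 0) := by
  set τ := a ⟨r - 1, by omega⟩
  have hcard : ∑ i : Fin N, (if (i : ℕ) < r then (1 : ℝ) else 0) = r := by
    rw [Finset.sum_boole, Fin.card_filter_val_lt, min_eq_right hr]
  have hnonneg : 0 ≤ ∑ i : Fin N, (a i - τ) * ((if (i : ℕ) < r then 1 else 0) - c i) := by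
    refine Finset.sum_nonneg fun i _ => ?_
    split_ifs with h
    · exact mul_nonneg (sub_nonneg.2 (ha (by simp only [Fin.le_def]; omega)))
        (sub_nonneg.2 (hc1 i))
    · exact mul_nonneg_of_nonpos_of_nonpos
        (sub_nonpos.2 (ha (by simp only [Fin.le_def]; omega))) (by linarith [hc0 i])
  simp only [sub_mul, mul_sub, Finset.sum_sub_distrib, ← Finset.mul_sum] at hnonneg
  rw [hcard, hsum] at hnonneg
  linarith

lemma transpose_mul_projection_mul_apply_nonneg {R : Matrix n n ℝ} (hR : IsStarProjection R)
    (P : Matrix n m ℝ) (i : m) : 0 ≤ (Pᵀ * R * P) i i := by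
  have hsq : Pᵀ * R * P = (R * P)ᵀ * (R * P) := by
    rw [Matrix.transpose_mul, transpose_eq_of_isStarProjection hR, Matrix.mul_assoc,
      Matrix.mul_assoc, ← Matrix.mul_assoc R, hR.isIdempotentElem.eq]
  rw [hsq, Matrix.mul_apply]
  exact Finset.sum_nonneg fun j _ => mul_self_nonneg _

lemma transpose_mul_projection_mul_apply_le_one [DecidableEq m] {R : Matrix n n ℝ}
    (hR : IsStarProjection R) {P : Matrix n m ℝ} (hP : Pᵀ * P = 1) (i : m) :
    (Pᵀ * R * P) i i ≤ 1 := by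
  classical
  have := transpose_mul_projection_mul_apply_nonneg hR.one_sub P i
  rwa [Matrix.mul_sub, Matrix.sub_mul, Matrix.mul_one, hP, Matrix.sub_apply, Matrix.one_apply_eq,
    sub_nonneg] at this

lemma trace_conj_diagonal_mul (P : Matrix n (Fin N) ℝ) (w : Fin N → ℝ) (R : Matrix n n ℝ) :
    (R * (P * Matrix.diagonal w * Pᵀ)).trace = ∑ i, w i * (Pᵀ * R * P) i i := by
  rw [← Matrix.mul_assoc, Matrix.trace_mul_comm, ← Matrix.mul_assoc, ← Matrix.mul_assoc]
  simp only [Matrix.trace, Matrix.diag, Matrix.mul_diagonal]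
  exact Finset.sum_congr rfl fun i _ => mul_comm _ _

lemma trace_mul_transpose_of_isometry {U : Matrix n (Fin r) ℝ} (hU : Uᵀ * U = 1) :
    (U * Uᵀ).trace = r := by
  rw [Matrix.trace_mul_comm, hU, Matrix.trace_one, Fintype.card_fin]

namespace IsTopLeftSingular

variable {A : Matrix n n ℝ} {U : Matrix n (Fin r) ℝ}

lemma exists_diagonalization [DecidableEq n] (h : IsTopLeftSingular A U) :
    ∃ (P : Matrix n (Fin (Fintype.card n)) ℝ) (w : Fin (Fintype.card n) → ℝ),
      Pᵀ * P = 1 ∧ P * Pᵀ = 1 ∧ Antitone w ∧ A * Aᵀ = P * Matrix.diagonal w * Pᵀ ∧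
      U * Uᵀ = P * Matrix.diagonal
        (fun i : Fin (Fintype.card n) => if (i : ℕ) < r then (1 : ℝ) else 0) * Pᵀ := by
  obtain ⟨hr, P, Q, s, hP, hQ, hs, hs0, hA, hU⟩ := h
  obtain rfl : U = P.submatrix id (Fin.castLE hr) := Matrix.ext hU
  refine ⟨P, fun i => s i * s i, hP, (Matrix.mul_eq_one_comm_of_card_eq _ _ _ (by simp)).1 hP,
    fun i j hij => mul_self_le_mul_self (hs0 j) (hs hij), ?_,
    submatrix_castLE_mul_transpose hr P P⟩
  calc A * Aᵀ = P * (Matrix.diagonal s * (Qᵀ * Q) * Matrix.diagonal s) * Pᵀ := by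
        rw [hA]
        simp only [Matrix.transpose_mul, Matrix.transpose_transpose, Matrix.diagonal_transpose,
          Matrix.mul_assoc]
    _ = P * Matrix.diagonal (fun i => s i * s i) * Pᵀ := by
        rw [hQ, Matrix.mul_one, Matrix.diagonal_mul_diagonal]

lemma transpose_mul_self (h : IsTopLeftSingular A U) : Uᵀ * U = 1 := by
  obtain ⟨hr, P, -, -, hP, -, -, -, -, hU⟩ := h
  obtain rfl : U = P.submatrix id (Fin.castLE hr) := Matrix.ext hU
  exact submatrix_castLE_isometry hr hP

lemma le_card (h : IsTopLeftSingular A U) : r ≤ Fintype.card n := h.choose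

lemma commute_mul_transpose (h : IsTopLeftSingular A U) : Commute (U * Uᵀ) (A * Aᵀ) := by
  classical
  obtain ⟨P, w, hP, -, -, hA, hU⟩ := h.exists_diagonalization
  have hmul : ∀ v v' : Fin (Fintype.card n) → ℝ,
      P * Matrix.diagonal v * Pᵀ * (P * Matrix.diagonal v' * Pᵀ) =
        P * Matrix.diagonal (fun i => v i * v' i) * Pᵀ := fun v v' => calc
    _ = P * (Matrix.diagonal v * (Pᵀ * P) * Matrix.diagonal v') * Pᵀ := by
      simp only [Matrix.mul_assoc]
    _ = P * Matrix.diagonal (fun i => v i * v' i) * Pᵀ := by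
      rw [hP, Matrix.mul_one, Matrix.diagonal_mul_diagonal]
  rw [Commute, SemiconjBy, hA, hU, hmul, hmul]
  simp only [mul_comm]

lemma norm_one_sub_mul_le [DecidableEq n] (h : IsTopLeftSingular A U) (hr0 : 0 < r)
    {R : Matrix n n ℝ} (hR : IsStarProjection R) (htr : R.trace = r) :
    ‖(1 - U * Uᵀ) * A‖ ≤ ‖(1 - R) * A‖ := by
  have hUproj := isStarProjection_mul_transpose h.transpose_mul_self
  obtain ⟨P, w, hP, hP', hw, hA, hU⟩ := h.exists_diagonalization
  have hsum : ∑ i, (Pᵀ * R * P) i i = r := by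
    change (Pᵀ * R * P).trace = r
    rw [Matrix.mul_assoc, Matrix.trace_mul_comm, Matrix.mul_assoc, hP', Matrix.mul_one, htr]
  have hUdiag : Pᵀ * (U * Uᵀ) * P =
      Matrix.diagonal (fun i : Fin (Fintype.card n) => if (i : ℕ) < r then (1 : ℝ) else 0) := by
    rw [hU, ← Matrix.mul_assoc, ← Matrix.mul_assoc, hP, Matrix.one_mul, Matrix.mul_assoc, hP,
      Matrix.mul_one]
  have hle : ‖R * A‖ ^ 2 ≤ ‖U * Uᵀ * A‖ ^ 2 := by
    rw [norm_projection_mul_sq hR, norm_projection_mul_sq hUproj, hA, trace_conj_diagonal_mul,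
      trace_conj_diagonal_mul, hUdiag]
    simpa only [Matrix.diagonal_apply_eq] using
      sum_mul_le_sum_mul_indicator_of_antitone h.le_card hr0 hw
        (transpose_mul_projection_mul_apply_nonneg hR P)
        (transpose_mul_projection_mul_apply_le_one hR hP) hsum
  refine (sq_le_sq₀ (norm_nonneg _) (norm_nonneg _)).1 ?_
  linarith [norm_projection_mul_sq_add hR A, norm_projection_mul_sq_add hUproj A]

end IsTopLeftSingular

namespace IsRangeProj

variable [DecidableEq n] {D Q P E : Matrix n n ℝ} {U : Matrix n (Fin r) ℝ} {σ : ℝ}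

lemma norm_one_sub_mul_add_le (h : IsRangeProj D Q σ) (hr0 : 0 < r) (htr : Q.trace = r)
    (hU : IsTopLeftSingular (D + E) U) : ‖(1 - U * Uᵀ) * (D + E)‖ ≤ ‖E‖ := by
  refine (hU.norm_one_sub_mul_le hr0 h.isStarProjection htr).trans ?_
  rw [mul_add, sub_mul, h.proj_mul, Matrix.one_mul, sub_self, zero_add]
  exact norm_projection_mul_le h.isStarProjection.one_sub _

lemma norm_one_sub_mul_proj_le_quarter (h : IsRangeProj D Q σ) (hr0 : 0 < r) (htr : Q.trace = r)
    (hU : IsTopLeftSingular (D + E) U) (hE : ‖E‖ ≤ σ / 8) : ‖(1 - U * Uᵀ) * Q‖ ≤ 1 / 4 := by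
  have hgap := h.gap_mul_norm_mul_proj_le (1 - U * Uᵀ)
  have hcompl := (isStarProjection_mul_transpose hU.transpose_mul_self).one_sub
  have hD : ‖(1 - U * Uᵀ) * D‖ ≤ ‖E‖ + ‖E‖ := by
    rw [← add_sub_cancel_right D E, mul_sub]
    exact (norm_sub_le _ _).trans (add_le_add (h.norm_one_sub_mul_add_le hr0 htr hU)
      (norm_projection_mul_le hcompl _))
  nlinarith [h.gap_pos]

lemma lower_bound_of_close (h : IsRangeProj D Q σ) (hP : IsStarProjection P)
    (htr : P.trace = Q.trace) (hPQ : ‖(1 - P) * Q‖ ≤ 1 / 2) (hE : ‖E‖ ≤ σ / 8)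
    {l : Type} [Fintype l] {Y : Matrix n l ℝ} (hY : P * Y = Y) :
    3 / 8 * σ * ‖Y‖ ≤ ‖(D + E) * Y‖ := by
  have hgap := h.gap_mul_norm_le Y
  have hD : ‖D * Y‖ ≤ ‖(D + E) * Y‖ + ‖E * Y‖ := by
    rw [← add_sub_cancel_right D E, Matrix.sub_mul, add_sub_cancel_right]
    exact norm_sub_le _ _
  have hEY : ‖E * Y‖ ≤ σ / 8 * ‖Y‖ := (Matrix.frobenius_norm_mul _ _).trans (by gcongr)
  have hQY : ‖(1 - Q) * Y‖ ≤ 1 / 2 * ‖Y‖ := by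
    rw [← norm_one_sub_mul_comm_of_trace_eq hP h.isStarProjection htr] at hPQ
    conv_lhs => rw [← hY, ← Matrix.mul_assoc]
    exact (Matrix.frobenius_norm_mul _ _).trans (by gcongr)
  have hYQ : ‖Y‖ ≤ ‖Q * Y‖ + ‖(1 - Q) * Y‖ := by
    conv_lhs => rw [← Matrix.one_mul Y, ← add_sub_cancel Q 1, Matrix.add_mul]
    exact norm_add_le _ _
  nlinarith [h.gap_pos, norm_nonneg Y]

lemma leftSingularProj_init (h : IsRangeProj D Q σ) (hr0 : 0 < r) (htr : Q.trace = r)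
    (hEsymm : Eᵀ = E) (hU : IsTopLeftSingular (D + E) U) (hE : ‖E‖ ≤ σ / 8) :
    leftSingularProj (σ / 4) (D + E) = U * Uᵀ := by
  have hσ := h.gap_pos
  have hproj := isStarProjection_mul_transpose hU.transpose_mul_self
  have hsymm : (D + E)ᵀ = D + E := by rw [Matrix.transpose_add, h.transpose_eq, hEsymm]
  refine leftSingularProj_eq_of_gap (c := 3 / 8 * σ) hproj hU.commute_mul_transpose
    (by linarith) (by linarith) (fun Y => ?_) ?_
  · rw [hsymm]
    refine h.lower_bound_of_close hproj
      ((trace_mul_transpose_of_isometry hU.transpose_mul_self).trans htr.symm)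
      ((h.norm_one_sub_mul_proj_le_quarter hr0 htr hU hE).trans (by norm_num)) hE ?_
    rw [← Matrix.mul_assoc, hproj.isIdempotentElem.eq]
  · exact ((h.norm_one_sub_mul_add_le hr0 htr hU).trans hE).trans_lt (by linarith)

lemma leftSingularProj_step (h : IsRangeProj D Q σ) (htr : Q.trace = r) (hUU : Uᵀ * U = 1)
    (hclose : ‖(1 - U * Uᵀ) * Q‖ ≤ 1 / 2) (hE : ‖E‖ ≤ σ / 8) {U' : Matrix n (Fin r) ℝ}
    (hU' : IsQRFactor ((D + E) * U) U') :
    leftSingularProj (σ / 4) ((D + E) * (U * Uᵀ)) = U' * U'ᵀ := by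
  have hσ := h.gap_pos
  obtain ⟨hUU', R, -, hR⟩ := hU'
  have hproj' := isStarProjection_mul_transpose hUU'
  have hfac : (D + E) * (U * Uᵀ) = U' * (R * Uᵀ) := by
    rw [← Matrix.mul_assoc, hR, Matrix.mul_assoc]
  have hrange : U' * U'ᵀ * (U' * (R * Uᵀ)) = U' * (R * Uᵀ) := by
    rw [← Matrix.mul_assoc, Matrix.mul_assoc U', hUU', Matrix.mul_one]
  have hRlow : ∀ {l : Type} [Fintype l] (Z : Matrix (Fin r) l ℝ), 3 / 8 * σ * ‖Z‖ ≤ ‖R * Z‖ := by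
    intro l _ Z
    have := h.lower_bound_of_close (isStarProjection_mul_transpose hUU)
      ((trace_mul_transpose_of_isometry hUU).trans htr.symm) hclose hE (Y := U * Z)
      (by rw [← Matrix.mul_assoc, Matrix.mul_assoc U, hUU, Matrix.mul_one])
    rwa [← Matrix.mul_assoc, hR, Matrix.mul_assoc, norm_isometry_mul hUU,
      norm_isometry_mul hUU'] at this
  rw [hfac]
  refine leftSingularProj_eq_of_gap (c := 3 / 8 * σ) hproj' ?_ (by linarith) (by linarith)
    (fun Y => ?_) ?_
  · have hleft : U' * U'ᵀ * (U' * (R * Uᵀ) * (U' * (R * Uᵀ))ᵀ) =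
        U' * (R * Uᵀ) * (U' * (R * Uᵀ))ᵀ := by rw [← Matrix.mul_assoc, hrange]
    have hright := congrArg Matrix.transpose hleft
    rw [Matrix.transpose_mul, transpose_eq_of_isStarProjection hproj', Matrix.transpose_mul,
      Matrix.transpose_transpose] at hright
    exact hleft.trans hright.symm
  · rw [Matrix.mul_assoc U', norm_isometry_mul hUU', Matrix.transpose_mul, Matrix.transpose_mul,
      Matrix.transpose_transpose, Matrix.mul_assoc (U * Rᵀ), ← Matrix.mul_assoc U'ᵀ, hUU',
      Matrix.one_mul, Matrix.mul_assoc U, norm_isometry_mul hUU]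
    exact mul_norm_le_norm_transpose_mul (by linarith) hRlow _
  · rw [Matrix.sub_mul, Matrix.one_mul, hrange, sub_self, norm_zero]
    linarith

end IsRangeProj

end TopLeftSingular

section SingularValues

variable {d₁ d₂ k : ℕ}

lemma finrank_range_toEuclideanLin (W : Matrix (Fin d₁) (Fin d₂) ℝ) :
    Module.finrank ℝ (Matrix.toEuclideanLin W).range = W.rank := by
  rw [Matrix.rank_eq_finrank_range_toLin W (EuclideanSpace.basisFun (Fin d₁) ℝ).toBasis
    (EuclideanSpace.basisFun (Fin d₂) ℝ).toBasis, ← Matrix.toEuclideanLin_eq_toLin_orthonormal]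

lemma singVal_nonneg (W : Matrix (Fin d₁) (Fin d₂) ℝ) (i : ℕ) : 0 ≤ singVal W i :=
  LinearMap.singularValues_nonneg _ _

lemma singVal_pos {W : Matrix (Fin d₁) (Fin d₂) ℝ} {i : ℕ} (hi0 : 1 ≤ i) (hi : i ≤ W.rank) :
    0 < singVal W i := by
  rw [singVal, LinearMap.singularValues_pos_iff_lt_finrank_range, finrank_range_toEuclideanLin]
  omega

lemma singVal_succ_eq_zero {W : Matrix (Fin d₁) (Fin d₂) ℝ} {i : ℕ} (hi : W.rank ≤ i) :
    singVal W (i + 1) = 0 := by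
  rwa [singVal, LinearMap.singularValues_eq_zero_iff_le_finrank_range,
    finrank_range_toEuclideanLin, Nat.add_sub_cancel]

lemma singVal_antitone (W : Matrix (Fin d₁) (Fin d₂) ℝ) : Antitone (singVal W) :=
  fun _ _ h => LinearMap.singularValues_antitone _ (Nat.sub_le_sub_right h 1)

lemma exists_orthogonal_gram_eq_diagonal (W : Matrix (Fin d₁) (Fin d₂) ℝ) :
    ∃ B : Matrix (Fin d₂) (Fin d₂) ℝ, Bᵀ * B = 1 ∧
      (W * B)ᵀ * (W * B) = Matrix.diagonal (fun i : Fin d₂ => singVal W (i + 1) ^ 2) := by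
  set T := Matrix.toEuclideanLin W
  have hn : Module.finrank ℝ (EuclideanSpace ℝ (Fin d₂)) = d₂ := by simp
  set b := T.isSymmetric_adjoint_comp_self.eigenvectorBasis hn
  have hinner (i j : Fin d₂) :
      inner ℝ (T (b i)) (T (b j)) = if i = j then singVal W (i + 1) ^ 2 else 0 := by
    rw [← LinearMap.adjoint_inner_left, ← LinearMap.comp_apply,
      T.isSymmetric_adjoint_comp_self.apply_eigenvectorBasis hn i, inner_smul_left,
      ← T.sq_singularValues_fin hn i, OrthonormalBasis.inner_eq_ite, singVal, Nat.add_sub_cancel]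
    simp [T]
  refine ⟨Matrix.of fun j i => (b i).ofLp j, ?_, ?_⟩
  · ext i j
    have := b.inner_eq_ite j i
    rw [PiLp.inner_apply] at this
    simpa [Matrix.mul_apply, Matrix.one_apply, eq_comm] using this
  · ext i j
    have := hinner i j
    rw [real_inner_comm] at this
    rw [PiLp.inner_apply] at this
    simpa [T, -Matrix.transpose_mul, Matrix.mul_apply, Matrix.diagonal_apply,
      Matrix.toLpLin_apply, Matrix.mulVec, dotProduct] using this

lemma exists_thin_svd (W : Matrix (Fin d₁) (Fin d₂) ℝ) (hW : W.rank = k) :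
    ∃ (L : Matrix (Fin d₁) (Fin k) ℝ) (V : Matrix (Fin d₂) (Fin k) ℝ), Lᵀ * L = 1 ∧ Vᵀ * V = 1 ∧
      W = L * Matrix.diagonal (fun i : Fin k => singVal W (i + 1)) * Vᵀ := by
  obtain ⟨B, hB, hgram⟩ := exists_orthogonal_gram_eq_diagonal W
  have hk : k ≤ d₂ := by simpa [hW] using W.rank_le_width
  set s : Fin k → ℝ := fun i => singVal W (i + 1)
  have hs (i : Fin k) : s i ≠ 0 := (singVal_pos (by omega) (by omega)).ne'
  set G := (W * B).submatrix id (Fin.castLE hk)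
  have hG : Gᵀ * G = Matrix.diagonal (fun i => s i ^ 2) := by
    rw [Matrix.transpose_submatrix, ← Matrix.submatrix_mul _ _ _ _ _ Function.bijective_id, hgram,
      Matrix.submatrix_diagonal _ _ (Fin.castLE_injective hk)]
    rfl
  have htail : W * B * Matrix.diagonal (fun i : Fin d₂ => if (i : ℕ) < k then (1 : ℝ) else 0) =
      W * B := by
    ext a i
    rw [Matrix.mul_diagonal]
    split_ifs with hi
    · rw [mul_one]
    · have hzero := congrFun₂ hgram i i
      rw [Matrix.diagonal_apply_eq, singVal_succ_eq_zero (by omega), Matrix.mul_apply] at hzero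
      have := (Finset.sum_eq_zero_iff_of_nonneg fun x _ => mul_self_nonneg ((W * B) x i)).1
        (by simpa using hzero) a (Finset.mem_univ a)
      rw [mul_self_eq_zero.1 this, zero_mul]
  refine ⟨G * Matrix.diagonal s⁻¹, B.submatrix id (Fin.castLE hk), ?_,
    submatrix_castLE_isometry hk hB, ?_⟩
  · rw [Matrix.transpose_mul, Matrix.diagonal_transpose, Matrix.mul_assoc, ← Matrix.mul_assoc Gᵀ,
      hG, Matrix.diagonal_mul_diagonal, Matrix.diagonal_mul_diagonal, ← Matrix.diagonal_one]
    congr 1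
    ext i
    have := hs i
    simp only [Pi.inv_apply]
    field_simp
  · have hdiag : Matrix.diagonal s⁻¹ * Matrix.diagonal s = 1 := by
      rw [Matrix.diagonal_mul_diagonal, ← Matrix.diagonal_one]
      exact congrArg _ (funext fun i => inv_mul_cancel₀ (hs i))
    rw [Matrix.mul_assoc G, hdiag, Matrix.mul_one, submatrix_castLE_mul_transpose, htail,
      Matrix.mul_assoc, mul_eq_one_comm.1 hB, Matrix.mul_one]

lemma norm_sq_le_rank_mul_singVal_sq (W : Matrix (Fin d₁) (Fin d₂) ℝ) :
    ‖W‖ ^ 2 ≤ W.rank * singVal W 1 ^ 2 := by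
  obtain ⟨L, V, hL, hV, hW⟩ := exists_thin_svd W rfl
  calc ‖W‖ ^ 2 = ∑ i : Fin W.rank, singVal W (i + 1) ^ 2 := by
        conv_lhs => rw [hW]
        rw [Matrix.mul_assoc, norm_isometry_mul hL, norm_mul_transpose_isometry hV,
          frobenius_norm_sq]
        simp [Matrix.diagonal_apply]
    _ ≤ ∑ _ : Fin W.rank, singVal W 1 ^ 2 := Finset.sum_le_sum fun i _ =>
        pow_le_pow_left₀ (singVal_nonneg _ _) (singVal_antitone W (by omega)) 2
    _ = W.rank * singVal W 1 ^ 2 := by simp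

end SingularValues

section SpectralNorm

variable {d₁ d₂ : ℕ}

lemma specNorm_nonneg (M : Matrix (Fin d₁) (Fin d₂) ℝ) : 0 ≤ specNorm M := norm_nonneg _

lemma norm_mulVec_le_specNorm (M : Matrix (Fin d₁) (Fin d₂) ℝ) (x : EuclideanSpace ℝ (Fin d₂)) :
    ‖WithLp.toLp 2 (M *ᵥ x.ofLp)‖ ≤ specNorm M * ‖x‖ :=
  (Matrix.toEuclideanLin M).toContinuousLinearMap.le_opNorm x

lemma sqrt_sum_col_sq_le_specNorm (M : Matrix (Fin d₁) (Fin d₂) ℝ) (j : Fin d₂) :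
    √(∑ i, M i j ^ 2) ≤ specNorm M := by
  have := norm_mulVec_le_specNorm M (EuclideanSpace.single j 1)
  rw [EuclideanSpace.norm_eq] at this
  simpa using this

lemma specNorm_le_frobenius_norm (M : Matrix (Fin d₁) (Fin d₂) ℝ) : specNorm M ≤ ‖M‖ := by
  refine ContinuousLinearMap.opNorm_le_bound _ (norm_nonneg _) fun x => ?_
  have h := Matrix.frobenius_norm_mul M (Matrix.replicateCol (Fin 1) x.ofLp)
  have hcol {d : ℕ} (v : Fin d → ℝ) : ‖Matrix.replicateCol (Fin 1) v‖ = ‖WithLp.toLp 2 v‖ :=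
    Matrix.frobenius_norm_replicateCol v
  rwa [← Matrix.replicateCol_mulVec, hcol, hcol] at h

lemma singVal_le_specNorm {W : Matrix (Fin d₁) (Fin d₂) ℝ} {i : ℕ} (hi0 : 1 ≤ i) (hi : i ≤ d₂) :
    singVal W i ≤ specNorm W := by
  obtain ⟨B, hB, hgram⟩ := exists_orthogonal_gram_eq_diagonal W
  set j : Fin d₂ := ⟨i - 1, by omega⟩
  have hnorm {d : ℕ} (A : Matrix (Fin d) (Fin d₂) ℝ) :
      ‖WithLp.toLp 2 (fun a => A a j)‖ = √((Aᵀ * A) j j) := by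
    rw [EuclideanSpace.norm_eq]
    simp [Matrix.mul_apply, sq]
  have h := norm_mulVec_le_specNorm W (WithLp.toLp 2 fun a => B a j)
  have hcol : W *ᵥ (fun a => B a j) = fun a => (W * B) a j := rfl
  rwa [hcol, hnorm, hnorm, hB, hgram, Matrix.one_apply_eq, Matrix.diagonal_apply_eq, Real.sqrt_one,
    mul_one, Nat.sub_add_cancel hi0, Real.sqrt_sq (singVal_nonneg W i)] at h

end SpectralNorm

section Dilation

variable {d₁ d₂ k : ℕ}

lemma dilation_transpose (W : Matrix (Fin d₁) (Fin d₂) ℝ) : (dilation W)ᵀ = dilation W := by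
  simp [dilation, Matrix.fromBlocks_transpose]

lemma dilation_add (A B : Matrix (Fin d₁) (Fin d₂) ℝ) :
    dilation (A + B) = dilation A + dilation B := by
  simp [dilation, Matrix.fromBlocks_add]

lemma norm_dilation_sq (A : Matrix (Fin d₁) (Fin d₂) ℝ) : ‖dilation A‖ ^ 2 = 2 * ‖A‖ ^ 2 := by
  have hcomm : ∑ j, ∑ i, A i j ^ 2 = ∑ i, ∑ j, A i j ^ 2 := Finset.sum_comm
  simp [frobenius_norm_sq, dilation, Fintype.sum_sum_type, hcomm, two_mul]

lemma norm_toBlocks₁₂_le {m n : Type} [Fintype m] [Fintype n] (A : Matrix (m ⊕ n) (m ⊕ n) ℝ) :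
    ‖A.toBlocks₁₂‖ ≤ ‖A‖ := by
  refine (sq_le_sq₀ (norm_nonneg _) (norm_nonneg _)).1 ?_
  simp only [frobenius_norm_sq, Fintype.sum_sum_type, Finset.sum_add_distrib]
  have hblock {p q : Type} [Fintype p] [Fintype q] (f : p → q → ℝ) : 0 ≤ ∑ i, ∑ j, f i j ^ 2 :=
    Finset.sum_nonneg fun _ _ => Finset.sum_nonneg fun _ _ => sq_nonneg _
  have h₁₁ := hblock fun i j => A (Sum.inl i) (Sum.inl j)
  have h₂₁ := hblock fun i j => A (Sum.inr i) (Sum.inl j)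
  have h₂₂ := hblock fun i j => A (Sum.inr i) (Sum.inr j)
  simp only [Matrix.toBlocks₁₂, Matrix.of_apply]
  linarith

lemma mul_norm_le_norm_dilation_diagonal_mul {l : Type} [Fintype l] {s : Fin k → ℝ} {σ : ℝ}
    (hσ : 0 ≤ σ) (hs : ∀ i, σ ≤ s i) (Y : Matrix (Fin k ⊕ Fin k) l ℝ) :
    σ * ‖Y‖ ≤ ‖dilation (Matrix.diagonal s) * Y‖ := by
  refine (sq_le_sq₀ (mul_nonneg hσ (norm_nonneg _)) (norm_nonneg _)).1 ?_
  have hinl (i c) : (dilation (Matrix.diagonal s) * Y) (Sum.inl i) c = s i * Y (Sum.inr i) c := by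
    simp [dilation, Matrix.mul_apply, Matrix.diagonal_apply]
  have hinr (i c) : (dilation (Matrix.diagonal s) * Y) (Sum.inr i) c = s i * Y (Sum.inl i) c := by
    simp [dilation, Matrix.mul_apply, Matrix.diagonal_apply]
  have hrow (i : Fin k) (y : ℝ) : σ ^ 2 * y ^ 2 ≤ (s i * y) ^ 2 := by
    rw [mul_pow]
    gcongr
    exact hs i
  rw [mul_pow, frobenius_norm_sq, frobenius_norm_sq]
  simp only [Fintype.sum_sum_type, hinl, hinr, mul_add, Finset.mul_sum]
  rw [add_comm]
  exact add_le_add (Finset.sum_le_sum fun i _ => Finset.sum_le_sum fun c _ => hrow i _)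
    (Finset.sum_le_sum fun i _ => Finset.sum_le_sum fun c _ => hrow i _)

lemma dilation_mul_mul_transpose (L : Matrix (Fin d₁) (Fin k) ℝ) (S : Matrix (Fin k) (Fin k) ℝ)
    (hS : Sᵀ = S) (V : Matrix (Fin d₂) (Fin k) ℝ) :
    dilation (L * S * Vᵀ) =
      Matrix.fromBlocks L 0 0 V * dilation S * (Matrix.fromBlocks L 0 0 V)ᵀ := by
  simp [dilation, Matrix.fromBlocks_transpose, Matrix.fromBlocks_multiply, Matrix.mul_assoc, hS]

lemma exists_isRangeProj_dilation (W : Matrix (Fin d₁) (Fin d₂) ℝ) (hk : 1 ≤ k)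
    (hW : W.rank = k) : ∃ Q, IsRangeProj (dilation W) Q (singVal W k) ∧ Q.trace = (2 * k : ℕ) := by
  obtain ⟨L, V, hL, hV, hsvd⟩ := exists_thin_svd W hW
  have hσ : 0 < singVal W k := singVal_pos hk hW.ge
  set S := Matrix.diagonal fun i : Fin k => singVal W (i + 1)
  set Z : Matrix (Fin d₁ ⊕ Fin d₂) (Fin k ⊕ Fin k) ℝ := Matrix.fromBlocks L 0 0 V with hZ_def
  have hZ : Zᵀ * Z = 1 := by
    simp [hZ_def, Matrix.fromBlocks_transpose, Matrix.fromBlocks_multiply, hL, hV]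
  have hD : dilation W = Z * dilation S * Zᵀ := by
    conv_lhs => rw [hsvd]
    exact dilation_mul_mul_transpose L S (Matrix.diagonal_transpose _) V
  refine ⟨Z * Zᵀ, ⟨hσ, dilation_transpose W, isStarProjection_mul_transpose hZ, ?_, ?_⟩, ?_⟩
  · rw [hD, ← Matrix.mul_assoc, Matrix.mul_assoc (Z * dilation S), hZ, Matrix.mul_one]
  · intro l _ X
    rw [hD, Matrix.mul_assoc, Matrix.mul_assoc, Matrix.mul_assoc, norm_isometry_mul hZ,
      norm_isometry_mul hZ]
    exact mul_norm_le_norm_dilation_diagonal_mul hσ.le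
      (fun i => singVal_antitone W (by omega)) _
  · rw [Matrix.trace_mul_comm, hZ, Matrix.trace_one, Fintype.card_sum, Fintype.card_fin, two_mul]

end Dilation

section ColNormalize

variable {d₁ d₂ : ℕ}

lemma norm_sub_normalize_le {E : Type*} [NormedAddCommGroup E] [NormedSpace ℝ E] {w : E}
    (hw : ‖w‖ = 1) (a : E) : ‖w - ‖a‖⁻¹ • a‖ ≤ 2 * ‖w - a‖ := by
  rcases eq_or_ne a 0 with rfl | ha
  · simp [hw]
  have hpos : 0 < ‖a‖ := norm_pos_iff.2 ha
  have hscale : ‖a - ‖a‖⁻¹ • a‖ = |‖a‖ - 1| := by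
    have : a - ‖a‖⁻¹ • a = (1 - ‖a‖⁻¹) • a := by rw [sub_smul, one_smul]
    rw [this, norm_smul, Real.norm_eq_abs, ← abs_norm a, ← abs_mul, abs_norm, sub_mul, one_mul,
      inv_mul_cancel₀ hpos.ne']
  have hlength : |‖a‖ - 1| ≤ ‖w - a‖ := by
    rw [← hw, ← norm_sub_rev a w]
    exact abs_norm_sub_norm_le a w
  calc ‖w - ‖a‖⁻¹ • a‖ ≤ ‖w - a‖ + ‖a - ‖a‖⁻¹ • a‖ := norm_sub_le_norm_sub_add_norm_sub _ _ _
    _ ≤ 2 * ‖w - a‖ := by rw [hscale]; linarith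

lemma norm_sub_colNormalize_le {W : Matrix (Fin d₁) (Fin d₂) ℝ} (hW : ∀ j, ∑ i, W i j ^ 2 = 1)
    (A : Matrix (Fin d₁) (Fin d₂) ℝ) : ‖W - colNormalize A‖ ≤ 2 * ‖W - A‖ := by
  refine (sq_le_sq₀ (norm_nonneg _) (mul_nonneg zero_le_two (norm_nonneg _))).1 ?_
  rw [mul_pow, frobenius_norm_sq, frobenius_norm_sq, Finset.sum_comm,
    Finset.sum_comm (γ := Fin d₁), Finset.mul_sum]
  refine Finset.sum_le_sum fun j _ => ?_
  have hw : ‖WithLp.toLp 2 (W.col j)‖ = 1 := by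
    rw [EuclideanSpace.norm_eq, Real.sqrt_eq_one]
    simpa using hW j
  have h := pow_le_pow_left₀ (norm_nonneg _)
    (norm_sub_normalize_le hw (WithLp.toLp 2 (A.col j))) 2
  rw [mul_pow, EuclideanSpace.norm_sq_eq, EuclideanSpace.norm_sq_eq, EuclideanSpace.norm_eq] at h
  simpa [colNormalize, div_eq_inv_mul] using h

lemma sum_colNormalize_sq_eq_one_or_eq_zero (A : Matrix (Fin d₁) (Fin d₂) ℝ) (j : Fin d₂) :
    (∑ i, colNormalize A i j ^ 2 = 1) ∨ ∀ i, colNormalize A i j = 0 := by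
  by_cases h : ∑ l, A l j ^ 2 = 0
  · exact Or.inr fun i => by simp [colNormalize, h]
  · have hnn : 0 ≤ ∑ l, A l j ^ 2 := Finset.sum_nonneg fun _ _ => sq_nonneg _
    left
    simp only [colNormalize, Matrix.of_apply, div_pow, ← Finset.sum_div, Real.sq_sqrt hnn]
    exact div_self h

lemma estimate_zero_right {r : ℕ} (U : Matrix (Fin d₁ ⊕ Fin d₂) (Fin r) ℝ) :
    estimate U 0 = 0 := by
  ext i j
  simp [estimate, colNormalize, Matrix.toBlocks₁₂]

lemma norm_sub_colNormalize_toBlocks₁₂_le {W : Matrix (Fin d₁) (Fin d₂) ℝ}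
    (hW : ∀ j, ∑ i, W i j ^ 2 = 1) (A : Matrix (Fin d₁ ⊕ Fin d₂) (Fin d₁ ⊕ Fin d₂) ℝ) :
    ‖W - colNormalize A.toBlocks₁₂‖ ≤ 2 * ‖dilation W - A‖ := by
  have hblock : W - A.toBlocks₁₂ = (dilation W - A).toBlocks₁₂ := by
    ext i j
    simp [dilation, Matrix.toBlocks₁₂]
  refine (norm_sub_colNormalize_le hW _).trans ?_
  rw [hblock]
  gcongr
  exact norm_toBlocks₁₂_le _

end ColNormalize

section Sign

lemma measurable_sgn : Measurable sgn :=
  Measurable.ite measurableSet_Ici measurable_const measurable_const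

lemma sgn_mul_self_eq_abs (a : ℝ) : sgn a * a = |a| := by
  unfold sgn
  split_ifs with h
  · rw [abs_of_nonneg h, one_mul]
  · rw [abs_of_neg (not_le.1 h), neg_one_mul]

lemma abs_sgn (a : ℝ) : |sgn a| = 1 := by
  unfold sgn; split_ifs <;> simp

lemma sgn_mul_of_pos {c : ℝ} (hc : 0 < c) (a : ℝ) : sgn (c * a) = sgn a := by
  simp [sgn, hc]

lemma sgn_sub_sgn_sq_le (a b : ℝ) : (sgn a - sgn b) ^ 2 ≤ 4 := by
  unfold sgn; split_ifs <;> norm_num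

lemma sgn_mul_add_of_two_mul_abs_lt {a b c : ℝ} (hc : 1 / 2 ≤ c) (hab : 2 * |b| < |a|) :
    sgn (c * a + b) = sgn a := by
  have hb₁ := neg_abs_le b
  have hb₂ := le_abs_self b
  unfold sgn
  rcases le_or_gt 0 a with ha | ha
  · rw [abs_of_nonneg ha] at hab
    rw [if_pos ha, if_pos (by nlinarith)]
  · rw [abs_of_neg ha] at hab
    rw [if_neg (not_le.2 ha), if_neg (not_le.2 (by nlinarith))]

end Sign

section GaussianReal

lemma integral_abs_gaussianReal : ∫ x, |x| ∂gaussianReal 0 1 = Real.sqrt (2 / Real.pi) := by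
  have hpdf (x : ℝ) : gaussianPDFReal 0 1 x • |x| =
      (Real.sqrt (2 * Real.pi))⁻¹ * (|x| ^ (1 : ℝ) * Real.exp (-(1 / 2) * |x| ^ (2 : ℝ))) := by
    simp only [gaussianPDFReal, sub_zero, NNReal.coe_one, mul_one, smul_eq_mul, Real.rpow_one,
      Real.rpow_two, sq_abs]
    ring_nf
  have hhalf : ((1 : ℝ) / 2) ^ (-((1 : ℝ) + 1) / 2) = 2 := by
    rw [show -((1 : ℝ) + 1) / 2 = -1 by norm_num, Real.rpow_neg_one]; norm_num
  have hpi : (0 : ℝ) < 2 * Real.pi := by positivity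
  rw [integral_gaussianReal_eq_integral_smul one_ne_zero]
  simp_rw [hpdf]
  rw [integral_comp_abs (f := fun y : ℝ => (Real.sqrt (2 * Real.pi))⁻¹ *
      (y ^ (1 : ℝ) * Real.exp (-(1 / 2) * y ^ (2 : ℝ)))), integral_const_mul,
    integral_rpow_mul_exp_neg_mul_rpow (by norm_num) (by norm_num) (by norm_num), hhalf,
    show ((1 : ℝ) + 1) / 2 = 1 by norm_num, Real.Gamma_one]
  symm
  rw [Real.sqrt_eq_iff_mul_self_eq (by positivity) (by positivity)]
  field_simp
  nlinarith [Real.sq_sqrt hpi.le]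

lemma gaussianPDF_zero_one_le (x : ℝ) : gaussianPDF 0 1 x ≤ ENNReal.ofReal (1 / 2) := by
  refine ENNReal.ofReal_le_ofReal ?_
  simp only [gaussianPDFReal, sub_zero, NNReal.coe_one, mul_one]
  have hsqrt : 2 ≤ Real.sqrt (2 * Real.pi) :=
    Real.le_sqrt_of_sq_le (by nlinarith [Real.pi_gt_three])
  have hexp : Real.exp (-x ^ 2 / 2) ≤ 1 := Real.exp_le_one_iff.2 (by nlinarith [sq_nonneg x])
  calc (Real.sqrt (2 * Real.pi))⁻¹ * Real.exp (-x ^ 2 / 2) ≤ 2⁻¹ * 1 := by gcongr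
    _ = 1 / 2 := by norm_num

lemma gaussianReal_abs_le (s : ℝ) : gaussianReal 0 1 {x | |x| ≤ s} ≤ ENNReal.ofReal s := by
  have hset : {x : ℝ | |x| ≤ s} = Set.Icc (-s) s := by ext x; simp [abs_le]
  rw [hset, gaussianReal_apply 0 one_ne_zero]
  calc ∫⁻ x in Set.Icc (-s) s, gaussianPDF 0 1 x
      ≤ ∫⁻ _ in Set.Icc (-s) s, ENNReal.ofReal (1 / 2) := lintegral_mono gaussianPDF_zero_one_le
    _ = ENNReal.ofReal s := by
        rw [setLIntegral_const, Real.volume_Icc, ← ENNReal.ofReal_mul (by norm_num)]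
        congr 1; ring

lemma setLIntegral_abs_le_comp_le {Ω β : Type*} [MeasurableSpace Ω] [MeasurableSpace β]
    {μ : Measure Ω} [IsFiniteMeasure μ] {X : Ω → ℝ} {Y : Ω → β} (hX : Measurable X)
    (hY : Measurable Y) (hXY : IndepFun X Y μ) (hlaw : μ.map X = gaussianReal 0 1)
    {s : β → ℝ} {G : β → ENNReal} (hs : Measurable s) (hG : Measurable G) :
    ∫⁻ ω in {ω | |X ω| ≤ s (Y ω)}, G (Y ω) ∂μ ≤ ∫⁻ ω, ENNReal.ofReal (s (Y ω)) * G (Y ω) ∂μ := by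
  have hmeas : MeasurableSet {p : ℝ × β | |p.1| ≤ s p.2} :=
    measurableSet_le (by fun_prop) (by fun_prop)
  set F : ℝ × β → ENNReal := {p : ℝ × β | |p.1| ≤ s p.2}.indicator fun p => G p.2
  have hFm : Measurable F := Measurable.indicator (by fun_prop) hmeas
  have hfib (y : β) : ∫⁻ x, F (x, y) ∂gaussianReal 0 1 ≤ ENNReal.ofReal (s y) * G y := by
    have : (fun x => F (x, y)) = {x : ℝ | |x| ≤ s y}.indicator fun _ => G y := rfl
    rw [this, lintegral_indicator (measurableSet_le (by fun_prop) (by fun_prop)),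
      setLIntegral_const, mul_comm]
    gcongr
    exact gaussianReal_abs_le _
  calc ∫⁻ ω in {ω | |X ω| ≤ s (Y ω)}, G (Y ω) ∂μ = ∫⁻ ω, F (X ω, Y ω) ∂μ :=
        (lintegral_indicator (hmeas.preimage (hX.prodMk hY)) _).symm
    _ = ∫⁻ p, F p ∂(gaussianReal 0 1).prod (μ.map Y) := by
        rw [← hlaw, ← (indepFun_iff_map_prod_eq_prod_map_map hX.aemeasurable hY.aemeasurable).1 hXY,
          lintegral_map hFm (hX.prodMk hY)]
    _ = ∫⁻ y, ∫⁻ x, F (x, y) ∂gaussianReal 0 1 ∂μ.map Y := lintegral_prod_symm _ hFm.aemeasurable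
    _ ≤ ∫⁻ y, ENNReal.ofReal (s y) * G y ∂μ.map Y := lintegral_mono hfib
    _ = ∫⁻ ω, ENNReal.ofReal (s (Y ω)) * G (Y ω) ∂μ := lintegral_map (by fun_prop) hY

/-- The third absolute moment of the standard Gaussian distribution. Only its finiteness matters:
the absolute constants of the theorem are expressed through it. -/
noncomputable def thirdMoment : ℝ := ∫ x, |x| ^ 3 ∂gaussianReal 0 1

lemma thirdMoment_nonneg : 0 ≤ thirdMoment := integral_nonneg fun _ => by positivity

end GaussianReal

section Rejection

variable {E : Type*} [NormedAddCommGroup E] [InnerProductSpace ℝ E]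

/-- The component of `x` orthogonal to `u`, for a unit vector `u`. -/
def rejection (u x : E) : E := x - inner ℝ u x • u

lemma inner_rejection (u v x : E) : inner ℝ v (rejection u x) = inner ℝ (rejection u v) x := by
  simp only [rejection, inner_sub_left, inner_sub_right, inner_smul_left, inner_smul_right,
    real_inner_comm u v, conj_trivial]
  ring

lemma inner_eq_add_inner_rejection (u v x : E) :
    inner ℝ v x = inner ℝ u v * inner ℝ u x + inner ℝ v (rejection u x) := by
  rw [rejection, inner_sub_right, inner_smul_right, real_inner_comm u v]
  ring

lemma norm_rejection_le {u : E} (hu : ‖u‖ = 1) (v : E) : ‖rejection u v‖ ≤ ‖v‖ := by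
  refine (sq_le_sq₀ (norm_nonneg _) (norm_nonneg _)).1 ?_
  rw [rejection, norm_sub_sq_real, inner_smul_right, norm_smul, hu, real_inner_comm u v,
    Real.norm_eq_abs, mul_one, sq_abs]
  nlinarith [sq_nonneg (inner ℝ u v)]

lemma rejection_sub_self {u : E} (hu : ‖u‖ = 1) (w : E) :
    rejection u (w - u) = rejection u w := by
  rw [rejection, rejection, inner_sub_right, real_inner_self_eq_norm_sq, hu, sub_smul]
  simp

lemma norm_mul_inner_inv_norm_smul (v x : E) : ‖v‖ * inner ℝ (‖v‖⁻¹ • v) x = inner ℝ v x := by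
  rcases eq_or_ne v 0 with rfl | hv
  · simp
  · rw [inner_smul_left, conj_trivial, mul_inv_cancel_left₀ (norm_ne_zero_iff.2 hv)]

lemma sgn_sub_sgn_sq_mul_le_of_abs_inner_le {u w a x : E} (hu : ‖u‖ = 1)
    (hx : |inner ℝ u x| ≤ 2 * |inner ℝ w (rejection u x)|) :
    (sgn (inner ℝ u x) - sgn (inner ℝ w x)) ^ 2 * inner ℝ a x ^ 2 ≤
      32 * ‖a‖ ^ 2 * inner ℝ w (rejection u x) ^ 2 + 8 * inner ℝ a (rejection u x) ^ 2 := by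
  have hux : inner ℝ u x ^ 2 ≤ 4 * inner ℝ w (rejection u x) ^ 2 := by
    have := pow_le_pow_left₀ (abs_nonneg _) hx 2
    rw [sq_abs, mul_pow, sq_abs] at this
    linarith
  have hua : inner ℝ u a ^ 2 ≤ ‖a‖ ^ 2 := by
    have := abs_real_inner_le_norm u a
    rw [hu, one_mul] at this
    exact sq_le_sq' (neg_le_of_abs_le this) (le_of_abs_le this)
  have hprod : inner ℝ u a ^ 2 * inner ℝ u x ^ 2 ≤
      ‖a‖ ^ 2 * (4 * inner ℝ w (rejection u x) ^ 2) := by gcongr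
  have hax : inner ℝ a x ^ 2 ≤
      2 * (inner ℝ u a ^ 2 * inner ℝ u x ^ 2) + 2 * inner ℝ a (rejection u x) ^ 2 := by
    rw [inner_eq_add_inner_rejection u a x]
    nlinarith [sq_nonneg (inner ℝ u a * inner ℝ u x - inner ℝ a (rejection u x))]
  nlinarith [mul_le_mul_of_nonneg_right (sgn_sub_sgn_sq_le (inner ℝ u x) (inner ℝ w x))
    (sq_nonneg (inner ℝ a x))]

lemma half_le_inner_of_norm_sub_lt {u w : E} (hu : ‖u‖ = 1) (hw : ‖w - u‖ < 1 / 2) :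
    1 / 2 ≤ inner ℝ u w := by
  have hinner : inner ℝ u w = 1 + inner ℝ u (w - u) := by
    rw [inner_sub_right, real_inner_self_eq_norm_sq, hu]; ring
  have hcs := neg_le_of_abs_le (abs_real_inner_le_norm u (w - u))
  rw [hu, one_mul] at hcs
  linarith

lemma sgn_inner_eq_of_two_mul_abs_lt {u w x : E} (hu : ‖u‖ = 1) (hw : ‖w - u‖ < 1 / 2)
    (hx : 2 * |inner ℝ w (rejection u x)| < |inner ℝ u x|) :
    sgn (inner ℝ w x) = sgn (inner ℝ u x) := by
  rw [inner_eq_add_inner_rejection u w x,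
    sgn_mul_add_of_two_mul_abs_lt (half_le_inner_of_norm_sub_lt hu hw) hx]

lemma measurable_rejection [MeasurableSpace E] [BorelSpace E] [SecondCountableTopology E] (u : E) :
    Measurable (rejection u) := by
  unfold rejection; fun_prop

end Rejection

section StdGaussian

variable {E : Type*} [NormedAddCommGroup E] [InnerProductSpace ℝ E] [FiniteDimensional ℝ E]
  [MeasurableSpace E] [BorelSpace E]

lemma hasGaussianLaw_inner (v : E) :
    HasGaussianLaw (fun x : E => inner ℝ v x) (stdGaussian E) :=
  IsGaussian.hasGaussianLaw_id.map_fun (innerSL ℝ v)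

lemma integral_inner_stdGaussian (v : E) : ∫ x, inner ℝ v x ∂stdGaussian E = 0 :=
  integral_strongDual_stdGaussian (innerSL ℝ v)

lemma map_inner_stdGaussian (v : E) : (stdGaussian E).map (fun x => inner ℝ v x) =
    (gaussianReal 0 1).map (fun x => ‖v‖ * x) := by
  have hvar : Var[fun x : E => inner ℝ v x; stdGaussian E] = ‖v‖ ^ 2 := by
    have := variance_dual_stdGaussian (innerSL ℝ v)
    rwa [innerSL_apply_norm] at this
  rw [(hasGaussianLaw_inner v).map_eq_gaussianReal, integral_inner_stdGaussian,
    gaussianReal_map_const_mul, mul_zero, mul_one, hvar]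
  congr 1
  ext
  simp

lemma integral_comp_inner_stdGaussian (v : E) {f : ℝ → ℝ} (hf : Measurable f) :
    ∫ x, f (inner ℝ v x) ∂stdGaussian E = ∫ x, f (‖v‖ * x) ∂gaussianReal 0 1 := by
  rw [← integral_map (φ := fun x : E => inner ℝ v x) (by fun_prop) hf.aestronglyMeasurable,
    map_inner_stdGaussian, integral_map (by fun_prop) hf.aestronglyMeasurable]

lemma covariance_inner_stdGaussian (a b : E) :
    cov[fun x => inner ℝ a x, fun x => inner ℝ b x; stdGaussian E] = inner ℝ a b := by
  rw [← covarianceBilin_apply_eq_cov IsGaussian.memLp_two_id, covarianceBilin_stdGaussian]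
  rfl

lemma indepFun_inner_rejection {u : E} (hu : ‖u‖ = 1) :
    IndepFun (fun x : E => inner ℝ u x) (rejection u) (stdGaussian E) := by
  refine HasGaussianLaw.indepFun_of_covariance_inner ?_ fun r y => ?_
  · exact IsGaussian.hasGaussianLaw_id.map_fun ((innerSL ℝ u).prod
      (ContinuousLinearMap.id ℝ E - (innerSL ℝ u).smulRight u))
  · have hr : (fun x : E => inner ℝ r (inner ℝ u x)) = fun x => inner ℝ (r • u) x := by
      ext x
      rw [inner_smul_left, conj_trivial, Real.inner_apply]
    simp_rw [hr, inner_rejection]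
    rw [covariance_inner_stdGaussian, inner_smul_left, rejection, inner_sub_right,
      inner_smul_right, real_inner_self_eq_norm_sq, hu]
    simp

lemma map_inner_stdGaussian_of_norm_eq_one {u : E} (hu : ‖u‖ = 1) :
    (stdGaussian E).map (fun x => inner ℝ u x) = gaussianReal 0 1 := by
  rw [map_inner_stdGaussian, hu]
  simp

lemma integrable_abs_inner_pow (v : E) (n : ℕ) :
    Integrable (fun x : E => |inner ℝ v x| ^ n) (stdGaussian E) := by
  have := (hasGaussianLaw_inner v).memLp (p := n) (by simp)
  simpa using this.integrable_norm_pow'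

lemma integrable_inner_sq (v : E) : Integrable (fun x : E => inner ℝ v x ^ 2) (stdGaussian E) := by
  simpa using integrable_abs_inner_pow v 2

lemma integral_inner_sq (a : E) : ∫ x, inner ℝ a x ^ 2 ∂stdGaussian E = ‖a‖ ^ 2 := by
  have h := covariance_inner_stdGaussian a a
  rw [covariance_eq_sub (hasGaussianLaw_inner a).memLp_two (hasGaussianLaw_inner a).memLp_two,
    integral_inner_stdGaussian, real_inner_self_eq_norm_sq] at h
  simpa [sq] using h

lemma measurable_sgn_inner (w : E) : Measurable fun x : E => sgn (inner ℝ w x) :=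
  measurable_sgn.comp (by fun_prop)

lemma integrable_sgn_inner_mul_inner (w a : E) :
    Integrable (fun x : E => sgn (inner ℝ w x) * inner ℝ a x) (stdGaussian E) := by
  refine (hasGaussianLaw_inner a).integrable.bdd_mul (c := 1)
    (measurable_sgn_inner w).aestronglyMeasurable (Filter.Eventually.of_forall fun x => ?_)
  rw [Real.norm_eq_abs, abs_sgn]

lemma integral_sgn_inner_mul_inner {w : E} (hw : ‖w‖ = 1) (a : E) :
    ∫ x, sgn (inner ℝ w x) * inner ℝ a x ∂stdGaussian E =
      Real.sqrt (2 / Real.pi) * inner ℝ w a := by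
  have hdec (x : E) : sgn (inner ℝ w x) * inner ℝ a x =
      inner ℝ w a * |inner ℝ w x| + sgn (inner ℝ w x) * inner ℝ (rejection w a) x := by
    rw [← sgn_mul_self_eq_abs, inner_eq_add_inner_rejection w a x, inner_rejection]
    ring
  have habs : Integrable (fun x : E => |inner ℝ w x|) (stdGaussian E) := by
    simpa using integrable_abs_inner_pow w 1
  have hzero : ∫ x, sgn (inner ℝ w x) * inner ℝ (rejection w a) x ∂stdGaussian E = 0 := by
    have hind : IndepFun (fun x : E => sgn (inner ℝ w x)) (fun x => inner ℝ (rejection w a) x)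
        (stdGaussian E) := by
      simp_rw [← inner_rejection]
      exact (indepFun_inner_rejection hw).comp (φ := sgn) (ψ := fun y => inner ℝ a y)
        measurable_sgn (by fun_prop)
    rw [hind.integral_fun_mul_eq_mul_integral (measurable_sgn_inner w).aestronglyMeasurable
      (by fun_prop), integral_inner_stdGaussian, mul_zero]
  simp_rw [hdec]
  rw [integral_add (habs.const_mul _) (integrable_sgn_inner_mul_inner _ _), integral_const_mul,
    hzero, add_zero, integral_comp_inner_stdGaussian w measurable_abs, hw]
  simp_rw [one_mul]
  rw [integral_abs_gaussianReal, mul_comm]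

lemma integral_abs_inner_cube (v : E) :
    ∫ x, |inner ℝ v x| ^ 3 ∂stdGaussian E = ‖v‖ ^ 3 * thirdMoment := by
  rw [integral_comp_inner_stdGaussian v (f := fun y => |y| ^ 3) (by fun_prop), thirdMoment,
    ← integral_const_mul]
  simp_rw [abs_mul, mul_pow, abs_norm]

lemma mul_sq_le_cube_add_cube {s t : ℝ} (hs : 0 ≤ s) (ht : 0 ≤ t) :
    s * t ^ 2 ≤ s ^ 3 + t ^ 3 := by
  rcases le_total s t with h | h
  · nlinarith [mul_le_mul_of_nonneg_right h (sq_nonneg t), pow_nonneg hs 3]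
  · nlinarith [mul_le_mul_of_nonneg_left (pow_le_pow_left₀ ht h 2) hs, pow_nonneg ht 3]

lemma integrable_abs_inner_mul_inner_sq (z a : E) :
    Integrable (fun x : E => |inner ℝ z x| * inner ℝ a x ^ 2) (stdGaussian E) := by
  refine ((integrable_abs_inner_pow z 3).add (integrable_abs_inner_pow a 3)).mono' (by fun_prop)
    (Filter.Eventually.of_forall fun x => ?_)
  rw [Real.norm_of_nonneg (by positivity), ← sq_abs (inner ℝ a x)]
  exact mul_sq_le_cube_add_cube (abs_nonneg _) (abs_nonneg _)

lemma integral_abs_inner_mul_inner_sq_le (z a : E) :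
    ∫ x, |inner ℝ z x| * inner ℝ a x ^ 2 ∂stdGaussian E ≤ 2 * thirdMoment * ‖z‖ * ‖a‖ ^ 2 := by
  set z₁ := ‖z‖⁻¹ • z
  set a₁ := ‖a‖⁻¹ • a
  have hunit (v : E) : ‖‖v‖⁻¹ • v‖ ^ 3 ≤ 1 := by
    refine pow_le_one₀ (norm_nonneg _) ?_
    rw [norm_smul, norm_inv, norm_norm]
    exact inv_mul_le_one
  have hpt (x : E) : |inner ℝ z x| * inner ℝ a x ^ 2 ≤
      ‖z‖ * ‖a‖ ^ 2 * (|inner ℝ z₁ x| ^ 3 + |inner ℝ a₁ x| ^ 3) := by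
    rw [← norm_mul_inner_inv_norm_smul z, ← norm_mul_inner_inv_norm_smul a, abs_mul, mul_pow,
      abs_norm, mul_mul_mul_comm, ← sq_abs (inner ℝ (‖a‖⁻¹ • a) x)]
    gcongr
    exact mul_sq_le_cube_add_cube (abs_nonneg _) (abs_nonneg _)
  have hcube := (integrable_abs_inner_pow z₁ 3).add (integrable_abs_inner_pow a₁ 3)
  calc ∫ x, |inner ℝ z x| * inner ℝ a x ^ 2 ∂stdGaussian E
      ≤ ∫ x, ‖z‖ * ‖a‖ ^ 2 * (|inner ℝ z₁ x| ^ 3 + |inner ℝ a₁ x| ^ 3) ∂stdGaussian E :=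
        integral_mono (integrable_abs_inner_mul_inner_sq z a) (hcube.const_mul _) hpt
    _ = ‖z‖ * ‖a‖ ^ 2 * (‖z₁‖ ^ 3 * thirdMoment + ‖a₁‖ ^ 3 * thirdMoment) := by
        rw [integral_const_mul,
          integral_add (integrable_abs_inner_pow z₁ 3) (integrable_abs_inner_pow a₁ 3),
          integral_abs_inner_cube, integral_abs_inner_cube]
    _ ≤ ‖z‖ * ‖a‖ ^ 2 * (1 * thirdMoment + 1 * thirdMoment) := by
        have := thirdMoment_nonneg
        gcongr
        exacts [hunit z, hunit a]
    _ = 2 * thirdMoment * ‖z‖ * ‖a‖ ^ 2 := by ring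

lemma integrable_sgn_sub_sgn_sq_mul (u w a : E) :
    Integrable (fun x : E => (sgn (inner ℝ u x) - sgn (inner ℝ w x)) ^ 2 * inner ℝ a x ^ 2)
      (stdGaussian E) := by
  refine (integrable_inner_sq a).bdd_mul (c := 4)
    (((measurable_sgn_inner u).sub (measurable_sgn_inner w)).pow_const 2).aestronglyMeasurable
    (Filter.Eventually.of_forall fun x => ?_)
  rw [Real.norm_eq_abs, abs_of_nonneg (sq_nonneg _)]
  exact sgn_sub_sgn_sq_le _ _

-- If the signs of `⟪u, x⟫` and `⟪w, x⟫` differ, then `|⟪u, x⟫| ≤ 2 |⟪w, y⟫|`, where `y` is the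
-- component of `x` orthogonal to `u`. As `y` is independent of `⟪u, x⟫`, which has a bounded
-- density, integrating out `⟪u, x⟫` gains a factor `|⟪w, y⟫| ≲ ‖w - u‖`.
lemma integral_sgn_sub_sgn_sq_mul_le_of_norm_sub_lt {u w : E} (hu : ‖u‖ = 1)
    (hw : ‖w - u‖ < 1 / 2) (a : E) :
    ∫ x, (sgn (inner ℝ u x) - sgn (inner ℝ w x)) ^ 2 * inner ℝ a x ^ 2 ∂stdGaussian E ≤
      ∫ x, 64 * ‖a‖ ^ 2 * (|inner ℝ (rejection u w) x| * inner ℝ (rejection u w) x ^ 2) +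
        16 * (|inner ℝ (rejection u w) x| * inner ℝ (rejection u a) x ^ 2) ∂stdGaussian E := by
  have hrej := measurable_rejection u
  set S : Set E := {x | |inner ℝ u x| ≤ 2 * |inner ℝ w (rejection u x)|}
  have hSm : MeasurableSet S := measurableSet_le (by fun_prop) (by fun_prop)
  set G : E → ℝ := fun y => 32 * ‖a‖ ^ 2 * inner ℝ w y ^ 2 + 8 * inner ℝ a y ^ 2 with hG
  have hpt (x : E) :
      ENNReal.ofReal ((sgn (inner ℝ u x) - sgn (inner ℝ w x)) ^ 2 * inner ℝ a x ^ 2) ≤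
        S.indicator (fun x => ENNReal.ofReal (G (rejection u x))) x := by
    by_cases hx : x ∈ S
    · rw [Set.indicator_of_mem hx]
      exact ENNReal.ofReal_le_ofReal (sgn_sub_sgn_sq_mul_le_of_abs_inner_le hu hx)
    · rw [sgn_inner_eq_of_two_mul_abs_lt hu hw (not_le.1 hx)]
      simp
  have hint : Integrable (fun x =>
      64 * ‖a‖ ^ 2 * (|inner ℝ (rejection u w) x| * inner ℝ (rejection u w) x ^ 2) +
        16 * (|inner ℝ (rejection u w) x| * inner ℝ (rejection u a) x ^ 2)) (stdGaussian E) :=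
    ((integrable_abs_inner_mul_inner_sq _ _).const_mul _).add
      ((integrable_abs_inner_mul_inner_sq _ _).const_mul _)
  rw [← ENNReal.ofReal_le_ofReal_iff (integral_nonneg fun x => by positivity),
    ofReal_integral_eq_lintegral_ofReal (integrable_sgn_sub_sgn_sq_mul u w a)
      (Filter.Eventually.of_forall fun x => by positivity),
    ofReal_integral_eq_lintegral_ofReal hint (Filter.Eventually.of_forall fun x => by positivity)]
  calc _ ≤ ∫⁻ x in S, ENNReal.ofReal (G (rejection u x)) ∂stdGaussian E :=
        (lintegral_mono hpt).trans_eq (lintegral_indicator hSm _)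
    _ ≤ ∫⁻ x, ENNReal.ofReal (2 * |inner ℝ w (rejection u x)|) *
          ENNReal.ofReal (G (rejection u x)) ∂stdGaussian E :=
        setLIntegral_abs_le_comp_le (by fun_prop) hrej (indepFun_inner_rejection hu)
          (map_inner_stdGaussian_of_norm_eq_one hu) (s := fun y => 2 * |inner ℝ w y|)
          (G := fun y => ENNReal.ofReal (G y)) (by fun_prop) (by fun_prop)
    _ = _ := by
        congr 1 with x
        rw [← ENNReal.ofReal_mul (by positivity), hG]
        simp only [inner_rejection]
        congr 1
        ring

/-- The absolute constant in the second moment bound for sign mismatches. -/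
noncomputable def mismatchConst : ℝ := 8 + 64 * thirdMoment

lemma mismatchConst_pos : 0 < mismatchConst := by
  have := thirdMoment_nonneg
  unfold mismatchConst; linarith

lemma integral_sgn_sub_sgn_sq_mul_le {u : E} (hu : ‖u‖ = 1) (w a : E) :
    ∫ x, (sgn (inner ℝ u x) - sgn (inner ℝ w x)) ^ 2 * inner ℝ a x ^ 2 ∂stdGaussian E ≤
      mismatchConst * ‖w - u‖ * ‖a‖ ^ 2 := by
  have hM := thirdMoment_nonneg
  rcases le_or_gt (1 / 2) ‖w - u‖ with hw | hw
  · calc _ ≤ ∫ x, 4 * inner ℝ a x ^ 2 ∂stdGaussian E :=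
          integral_mono (integrable_sgn_sub_sgn_sq_mul u w a) ((integrable_inner_sq a).const_mul 4)
            fun x => mul_le_mul_of_nonneg_right (sgn_sub_sgn_sq_le _ _) (sq_nonneg _)
      _ = 4 * ‖a‖ ^ 2 := by rw [integral_const_mul, integral_inner_sq]
      _ ≤ mismatchConst * ‖w - u‖ * ‖a‖ ^ 2 := by
        gcongr
        unfold mismatchConst
        nlinarith
  · set z := rejection u w
    have hz : ‖z‖ ≤ ‖w - u‖ := by
      have := norm_rejection_le hu (w - u)
      rwa [rejection_sub_self hu] at this
    have hz2 : ‖z‖ * ‖z‖ ^ 2 ≤ ‖w - u‖ * (1 / 2) ^ 2 := by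
      gcongr; exact hz.trans hw.le
    have hza : ‖z‖ * ‖rejection u a‖ ^ 2 ≤ ‖w - u‖ * ‖a‖ ^ 2 := by
      gcongr; exact norm_rejection_le hu a
    refine (integral_sgn_sub_sgn_sq_mul_le_of_norm_sub_lt hu hw a).trans ?_
    rw [integral_add ((integrable_abs_inner_mul_inner_sq _ _).const_mul _)
      ((integrable_abs_inner_mul_inner_sq _ _).const_mul _), integral_const_mul, integral_const_mul]
    calc _ ≤ 64 * ‖a‖ ^ 2 * (2 * thirdMoment * ‖z‖ * ‖z‖ ^ 2) +
          16 * (2 * thirdMoment * ‖z‖ * ‖rejection u a‖ ^ 2) := by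
          gcongr <;> exact integral_abs_inner_mul_inner_sq_le _ _
      _ = 128 * ‖a‖ ^ 2 * thirdMoment * (‖z‖ * ‖z‖ ^ 2) +
          32 * thirdMoment * (‖z‖ * ‖rejection u a‖ ^ 2) := by ring
      _ ≤ 128 * ‖a‖ ^ 2 * thirdMoment * (‖w - u‖ * (1 / 2) ^ 2) +
          32 * thirdMoment * (‖w - u‖ * ‖a‖ ^ 2) := by gcongr
      _ = 64 * thirdMoment * ‖w - u‖ * ‖a‖ ^ 2 := by ring
      _ ≤ mismatchConst * ‖w - u‖ * ‖a‖ ^ 2 := by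
        gcongr
        unfold mismatchConst
        linarith

end StdGaussian

section InstanceLaw

variable {d₁ d₂ : ℕ}

/-- The standard Gaussian measure on `Fin d → ℝ`. -/
noncomputable abbrev gaussianPi (d : ℕ) : Measure (Fin d → ℝ) :=
  Measure.pi fun _ : Fin d => gaussianReal 0 1

lemma inner_toLp_eq_dotProduct {d : ℕ} (v x : Fin d → ℝ) :
    inner ℝ (WithLp.toLp 2 v) (WithLp.toLp 2 x) = x ⬝ᵥ v := by
  simp [EuclideanSpace.inner_toLp_toLp]

lemma norm_toLp_eq_sqrt {d : ℕ} (v : Fin d → ℝ) :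
    ‖WithLp.toLp 2 v‖ = Real.sqrt (v ⬝ᵥ v) := by
  rw [EuclideanSpace.norm_eq]
  simp [dotProduct, sq]

lemma integral_gaussianPi_comp {d : ℕ} {f : EuclideanSpace ℝ (Fin d) → ℝ} (hf : Measurable f) :
    ∫ x, f (WithLp.toLp 2 x) ∂gaussianPi d = ∫ x, f x ∂stdGaussian (EuclideanSpace ℝ (Fin d)) := by
  rw [← map_pi_eq_stdGaussian, integral_map (by fun_prop) hf.aestronglyMeasurable]

lemma integrable_gaussianPi_comp {d : ℕ} {f : EuclideanSpace ℝ (Fin d) → ℝ}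
    (hf : Integrable f (stdGaussian (EuclideanSpace ℝ (Fin d)))) :
    Integrable (fun x => f (WithLp.toLp 2 x)) (gaussianPi d) := by
  rw [← map_pi_eq_stdGaussian] at hf
  exact hf.comp_measurable (by fun_prop)

lemma dotProduct_self_nonneg {ι : Type*} [Fintype ι] (v : ι → ℝ) : 0 ≤ v ⬝ᵥ v :=
  Finset.sum_nonneg fun i _ => mul_self_nonneg (v i)

lemma integral_sgn_dotProduct_mul_dotProduct {d : ℕ} {w : Fin d → ℝ} (hw : w ⬝ᵥ w = 1 ∨ w = 0)
    (a : Fin d → ℝ) :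
    ∫ x, sgn (x ⬝ᵥ w) * (x ⬝ᵥ a) ∂gaussianPi d = Real.sqrt (2 / Real.pi) * (w ⬝ᵥ a) := by
  have hpi := integral_gaussianPi_comp (d := d)
    (f := fun x => sgn (inner ℝ (WithLp.toLp 2 w) x) * inner ℝ (WithLp.toLp 2 a) x)
    ((measurable_sgn_inner _).mul (by fun_prop))
  simp only [inner_toLp_eq_dotProduct] at hpi
  rw [hpi]
  rcases hw with hw | rfl
  · rw [integral_sgn_inner_mul_inner (by rw [norm_toLp_eq_sqrt, hw, Real.sqrt_one]),
      inner_toLp_eq_dotProduct, dotProduct_comm]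
  · simpa [sgn] using integral_inner_stdGaussian (WithLp.toLp 2 a)

lemma integrable_sgn_dotProduct_mul_dotProduct {d : ℕ} (w a : Fin d → ℝ) :
    Integrable (fun x => sgn (x ⬝ᵥ w) * (x ⬝ᵥ a)) (gaussianPi d) := by
  simpa only [inner_toLp_eq_dotProduct] using integrable_gaussianPi_comp
    (integrable_sgn_inner_mul_inner (WithLp.toLp 2 w) (WithLp.toLp 2 a))

lemma integrable_sgn_sub_sgn_sq_mul_dotProduct_sq {d : ℕ} (u w a : Fin d → ℝ) :
    Integrable (fun x => (sgn (x ⬝ᵥ u) - sgn (x ⬝ᵥ w)) ^ 2 * (x ⬝ᵥ a) ^ 2) (gaussianPi d) := by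
  simpa only [inner_toLp_eq_dotProduct] using integrable_gaussianPi_comp
    (integrable_sgn_sub_sgn_sq_mul (WithLp.toLp 2 u) (WithLp.toLp 2 w) (WithLp.toLp 2 a))

lemma integral_sgn_sub_sgn_sq_mul_dotProduct_sq_le {d : ℕ} {u : Fin d → ℝ} (hu : u ⬝ᵥ u = 1)
    (w a : Fin d → ℝ) :
    ∫ x, (sgn (x ⬝ᵥ u) - sgn (x ⬝ᵥ w)) ^ 2 * (x ⬝ᵥ a) ^ 2 ∂gaussianPi d ≤
      mismatchConst * Real.sqrt ((w - u) ⬝ᵥ (w - u)) * (a ⬝ᵥ a) := by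
  have hpi := integral_gaussianPi_comp (d := d)
    (f := fun x => (sgn (inner ℝ (WithLp.toLp 2 u) x) - sgn (inner ℝ (WithLp.toLp 2 w) x)) ^ 2 *
      inner ℝ (WithLp.toLp 2 a) x ^ 2)
    ((((measurable_sgn_inner _).sub (measurable_sgn_inner _)).pow_const 2).mul (by fun_prop))
  have hle := integral_sgn_sub_sgn_sq_mul_le (u := WithLp.toLp 2 u)
    (by rw [norm_toLp_eq_sqrt, hu, Real.sqrt_one]) (WithLp.toLp 2 w) (WithLp.toLp 2 a)
  rw [← WithLp.toLp_sub, norm_toLp_eq_sqrt, norm_toLp_eq_sqrt,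
    Real.sq_sqrt (dotProduct_self_nonneg a)] at hle
  simp only [inner_toLp_eq_dotProduct] at hpi
  exact hpi.trans_le hle

lemma instanceLaw_eq_sum (d₁ d₂ : ℕ) : instanceLaw d₁ d₂ =
    ∑ j : Fin d₂, (d₂ : ENNReal)⁻¹ • (gaussianPi d₁).map (fun x => (x, j)) := by
  ext s hs
  have hu : (uniformOn (Set.univ : Set (Fin d₂))) = (d₂ : ENNReal)⁻¹ • Measure.count := by
    simp [uniformOn, ProbabilityTheory.cond, Measure.count_univ]
  have : SFinite ((d₂ : ENNReal)⁻¹ • (Measure.count : Measure (Fin d₂))) := by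
    rw [← hu, uniformOn]; infer_instance
  rw [instanceLaw, hu, Measure.prod_apply_symm hs, lintegral_smul_measure, lintegral_count,
    tsum_fintype, Measure.finsetSum_apply, smul_eq_mul, Finset.mul_sum]
  refine Finset.sum_congr rfl fun j _ => ?_
  rw [Measure.smul_apply, smul_eq_mul, Measure.map_apply (by fun_prop) hs]

lemma integrable_instanceLaw {f : (Fin d₁ → ℝ) × Fin d₂ → ℝ} (hd : 0 < d₂)
    (hf : Measurable f) (h : ∀ j, Integrable (fun x => f (x, j)) (gaussianPi d₁)) :
    Integrable f (instanceLaw d₁ d₂) := by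
  rw [instanceLaw_eq_sum, integrable_finsetSum_measure]
  intro j _
  refine Integrable.smul_measure ?_ (by simp [hd.ne'])
  rw [integrable_map_measure hf.aestronglyMeasurable (by fun_prop)]
  exact h j

lemma integral_instanceLaw {f : (Fin d₁ → ℝ) × Fin d₂ → ℝ} (hd : 0 < d₂)
    (hf : Measurable f) (h : ∀ j, Integrable (fun x => f (x, j)) (gaussianPi d₁)) :
    ∫ z, f z ∂instanceLaw d₁ d₂ = (d₂ : ℝ)⁻¹ * ∑ j, ∫ x, f (x, j) ∂gaussianPi d₁ := by
  rw [instanceLaw_eq_sum, integral_finsetSum_measure, Finset.mul_sum]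
  · refine Finset.sum_congr rfl fun j _ => ?_
    rw [integral_smul_measure, integral_map (by fun_prop) hf.aestronglyMeasurable]
    simp
  · intro j _
    refine Integrable.smul_measure ?_ (by simp [hd.ne'])
    rw [integrable_map_measure hf.aestronglyMeasurable (by fun_prop)]
    exact h j

end InstanceLaw

section Summand

variable {m d₁ d₂ : ℕ}

/-- The bilinear form `(a, c) ↦ aᵀ H c` evaluated on the contribution of a single instance `z` to
the correction `H`, when the labels come from `Ws` and the current estimate is `W`. -/
noncomputable def summand (Ws W : Matrix (Fin d₁) (Fin d₂) ℝ) (a : Fin d₁ → ℝ) (c : Fin d₂ → ℝ)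
    (z : (Fin d₁ → ℝ) × Fin d₂) : ℝ :=
  d₂ / Real.sqrt (2 / Real.pi) * c z.2 *
    ((sgn (z.1 ⬝ᵥ Ws.col z.2) - sgn (z.1 ⬝ᵥ W.col z.2)) * (z.1 ⬝ᵥ a))

lemma measurable_summand (Ws W : Matrix (Fin d₁) (Fin d₂) ℝ) (a : Fin d₁ → ℝ)
    (c : Fin d₂ → ℝ) : Measurable (summand Ws W a c) := by
  refine measurable_from_prod_countable_left fun j => ?_
  have hdot (v : Fin d₁ → ℝ) : Measurable fun x : Fin d₁ → ℝ => x ⬝ᵥ v := by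
    unfold dotProduct; fun_prop
  exact (((measurable_sgn.comp (hdot (Ws.col j))).sub (measurable_sgn.comp (hdot (W.col j)))).mul
    (hdot a)).const_mul (d₂ / Real.sqrt (2 / Real.pi) * c j)

lemma integrable_summand_apply (Ws W : Matrix (Fin d₁) (Fin d₂) ℝ) (a : Fin d₁ → ℝ)
    (c : Fin d₂ → ℝ) (j : Fin d₂) :
    Integrable (fun x => summand Ws W a c (x, j)) (gaussianPi d₁) := by
  simp only [summand, sub_mul]
  exact ((integrable_sgn_dotProduct_mul_dotProduct _ _).sub
    (integrable_sgn_dotProduct_mul_dotProduct _ _)).const_mul _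

lemma integrable_summand_apply_sq (Ws W : Matrix (Fin d₁) (Fin d₂) ℝ) (a : Fin d₁ → ℝ)
    (c : Fin d₂ → ℝ) (j : Fin d₂) :
    Integrable (fun x => summand Ws W a c (x, j) ^ 2) (gaussianPi d₁) := by
  simp only [summand, mul_pow _ _ 2]
  exact (integrable_sgn_sub_sgn_sq_mul_dotProduct_sq _ _ _).const_mul _

lemma integrable_summand_sq (hd : 0 < d₂) (Ws W : Matrix (Fin d₁) (Fin d₂) ℝ)
    (a : Fin d₁ → ℝ) (c : Fin d₂ → ℝ) :
    Integrable (fun z => summand Ws W a c z ^ 2) (instanceLaw d₁ d₂) :=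
  integrable_instanceLaw hd ((measurable_summand Ws W a c).pow_const 2)
    (integrable_summand_apply_sq Ws W a c)

lemma integral_summand {Ws W : Matrix (Fin d₁) (Fin d₂) ℝ} (hd : 0 < d₂)
    (hWs : ∀ j, Ws.col j ⬝ᵥ Ws.col j = 1) (hW : ∀ j, W.col j ⬝ᵥ W.col j = 1 ∨ W.col j = 0)
    (a : Fin d₁ → ℝ) (c : Fin d₂ → ℝ) :
    ∫ z, summand Ws W a c z ∂instanceLaw d₁ d₂ = a ⬝ᵥ (Ws - W) *ᵥ c := by
  have hπ : Real.sqrt (2 / Real.pi) ≠ 0 := (Real.sqrt_pos.2 (by positivity)).ne'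
  have hd' : (d₂ : ℝ) ≠ 0 := by exact_mod_cast hd.ne'
  have hcol (j : Fin d₂) : ∫ x, summand Ws W a c (x, j) ∂gaussianPi d₁ =
      d₂ * (c j * ((Ws - W).col j ⬝ᵥ a)) := by
    simp only [summand, sub_mul]
    rw [integral_const_mul, integral_sub (integrable_sgn_dotProduct_mul_dotProduct _ _)
      (integrable_sgn_dotProduct_mul_dotProduct _ _),
      integral_sgn_dotProduct_mul_dotProduct (Or.inl (hWs j)),
      integral_sgn_dotProduct_mul_dotProduct (hW j), ← mul_sub, ← sub_dotProduct,
      show (Ws - W).col j = Ws.col j - W.col j from rfl]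
    field_simp
  rw [integral_instanceLaw hd (measurable_summand Ws W a c) (integrable_summand_apply Ws W a c)]
  simp only [hcol]
  rw [← Finset.mul_sum, inv_mul_cancel_left₀ hd', Matrix.dotProduct_mulVec, dotProduct]
  refine Finset.sum_congr rfl fun j _ => ?_
  rw [mul_comm (c j), dotProduct_comm]
  rfl

/-- The constant in the second moment bound of the noise. -/
noncomputable def noiseConst : ℝ := mismatchConst * (Real.pi / 2)

lemma noiseConst_pos : 0 < noiseConst := mul_pos mismatchConst_pos (by positivity)

lemma integral_summand_sq_le {Ws W : Matrix (Fin d₁) (Fin d₂) ℝ} (hd : 0 < d₂)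
    (hWs : ∀ j, Ws.col j ⬝ᵥ Ws.col j = 1) {e : ℝ}
    (he : ∀ j, Real.sqrt ((W.col j - Ws.col j) ⬝ᵥ (W.col j - Ws.col j)) ≤ e)
    (a : Fin d₁ → ℝ) (c : Fin d₂ → ℝ) :
    ∫ z, summand Ws W a c z ^ 2 ∂instanceLaw d₁ d₂ ≤
      noiseConst * d₂ * e * (a ⬝ᵥ a) * (c ⬝ᵥ c) := by
  have hd' : (d₂ : ℝ) ≠ 0 := by exact_mod_cast hd.ne'
  have haa := dotProduct_self_nonneg a
  have hmis := mismatchConst_pos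
  have hcol (j : Fin d₂) : ∫ x, summand Ws W a c (x, j) ^ 2 ∂gaussianPi d₁ ≤
      (d₂ ^ 2 / (2 / Real.pi) * (mismatchConst * e * (a ⬝ᵥ a))) * (c j * c j) := by
    simp only [summand, mul_pow _ _ 2]
    rw [integral_const_mul, div_pow, Real.sq_sqrt (by positivity)]
    calc _ ≤ (d₂ : ℝ) ^ 2 / (2 / Real.pi) * c j ^ 2 * (mismatchConst * e * (a ⬝ᵥ a)) := by
          gcongr
          refine (integral_sgn_sub_sgn_sq_mul_dotProduct_sq_le (hWs j) (W.col j) a).trans ?_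
          gcongr
          exact he j
      _ = _ := by ring
  rw [integral_instanceLaw hd ((measurable_summand Ws W a c).pow_const 2)
    (integrable_summand_apply_sq Ws W a c)]
  calc (d₂ : ℝ)⁻¹ * ∑ j, ∫ x, summand Ws W a c (x, j) ^ 2 ∂gaussianPi d₁
      ≤ (d₂ : ℝ)⁻¹ * ∑ j, (d₂ ^ 2 / (2 / Real.pi) * (mismatchConst * e * (a ⬝ᵥ a))) *
          (c j * c j) := by
        gcongr with j
        exact hcol j
    _ = noiseConst * d₂ * e * (a ⬝ᵥ a) * (c ⬝ᵥ c) := by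
        rw [← Finset.mul_sum, noiseConst]
        simp only [dotProduct]
        field_simp

lemma labels_eq_sgn_dotProduct_col (hd : 0 < d₂) (b : Batch m d₁ d₂)
    (W : Matrix (Fin d₁) (Fin d₂) ℝ) (i : Fin m) :
    labels b W i = sgn ((b i).1 ⬝ᵥ W.col (b i).2) := by
  have hcol : W *ᵥ oneHot (b i).2 = Real.sqrt d₂ • W.col (b i).2 := by
    rw [oneHot, Matrix.mulVec_single, op_smul_eq_smul]
  rw [labels, sensing, hcol, dotProduct_smul, smul_eq_mul,
    sgn_mul_of_pos (Real.sqrt_pos.2 (by exact_mod_cast hd))]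

lemma dotProduct_vecMulVec_oneHot_mulVec (x a : Fin d₁ → ℝ) (j : Fin d₂) (c : Fin d₂ → ℝ) :
    a ⬝ᵥ Matrix.vecMulVec x (oneHot j) *ᵥ c = (x ⬝ᵥ a) * (Real.sqrt d₂ * c j) := by
  rw [Matrix.vecMulVec_mulVec, oneHot, single_dotProduct, dotProduct_smul, dotProduct_comm a]
  rfl

lemma dotProduct_correction_mulVec (hd : 0 < d₂) (b : Batch m d₁ d₂)
    (Ws W : Matrix (Fin d₁) (Fin d₂) ℝ) (a : Fin d₁ → ℝ) (c : Fin d₂ → ℝ) :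
    a ⬝ᵥ correction b (labels b Ws) W *ᵥ c = (m : ℝ)⁻¹ * ∑ i, summand Ws W a c (b i) := by
  have hsq : Real.sqrt d₂ * Real.sqrt d₂ = d₂ := Real.mul_self_sqrt (by positivity)
  rw [correction, sensingAdj, Matrix.smul_mulVec, dotProduct_smul, Matrix.sum_mulVec,
    dotProduct_sum, Finset.smul_sum, Finset.mul_sum]
  refine Finset.sum_congr rfl fun i _ => ?_
  rw [Matrix.smul_mulVec, dotProduct_smul, dotProduct_vecMulVec_oneHot_mulVec, Pi.sub_apply,
    labels_eq_sgn_dotProduct_col hd, labels_eq_sgn_dotProduct_col hd, summand,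
    smul_eq_mul, smul_eq_mul, ← hsq, Real.sqrt_mul_self (Real.sqrt_nonneg _)]
  ring

end Summand

section Noise

variable {m d₁ d₂ : ℕ}

/-- The noise `H - (W* - W)`: the deviation of the correction from the step it estimates. -/
noncomputable def noise (Ws W : Matrix (Fin d₁) (Fin d₂) ℝ) (b : Batch m d₁ d₂) :
    Matrix (Fin d₁) (Fin d₂) ℝ :=
  correction b (labels b Ws) W - (Ws - W)

lemma dilation_correction_add (Ws W : Matrix (Fin d₁) (Fin d₂) ℝ) (b : Batch m d₁ d₂) :
    dilation (correction b (labels b Ws) W) + dilation W =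
      dilation Ws + dilation (noise Ws W b) := by
  rw [← dilation_add, ← dilation_add, noise]
  congr 1
  abel

lemma dilation_correction_zero (Ws : Matrix (Fin d₁) (Fin d₂) ℝ) (b : Batch m d₁ d₂) :
    dilation (correction b (labels b Ws) 0) = dilation Ws + dilation (noise Ws 0 b) := by
  rw [← dilation_correction_add]
  simp [dilation]

variable {Ω ι : Type*} [MeasurableSpace Ω] {P : Measure Ω}

/-- A family of independent instances with law `instanceLaw`. -/
structure IsInstanceSample (P : Measure Ω) (Y : ι → Ω → (Fin d₁ → ℝ) × Fin d₂) : Prop where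
  measurable : ∀ i, Measurable (Y i)
  indep : iIndepFun Y P
  map_eq : ∀ i, P.map (Y i) = instanceLaw d₁ d₂

lemma IsInstanceSample.precomp {κ : Type*} {Y : ι → Ω → (Fin d₁ → ℝ) × Fin d₂}
    (hY : IsInstanceSample P Y) {g : κ → ι} (hg : g.Injective) :
    IsInstanceSample P fun i => Y (g i) :=
  ⟨fun _ => hY.measurable _, hY.indep.precomp hg, fun _ => hY.map_eq _⟩

section Summand

variable {Y : ι → Ω → (Fin d₁ → ℝ) × Fin d₂} {Ws W : Matrix (Fin d₁) (Fin d₂) ℝ} {e : ℝ}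
  (hY : IsInstanceSample P Y) (hd : 0 < d₂)
include hY hd

lemma IsInstanceSample.memLp_summand (Ws W : Matrix (Fin d₁) (Fin d₂) ℝ) (a : Fin d₁ → ℝ)
    (c : Fin d₂ → ℝ) (i : ι) : MemLp (fun ω => summand Ws W a c (Y i ω)) 2 P := by
  have hmeas := (measurable_summand Ws W a c).comp (hY.measurable i)
  have hsq := integrable_summand_sq hd Ws W a c
  rw [← hY.map_eq i] at hsq
  exact (memLp_two_iff_integrable_sq hmeas.aestronglyMeasurable).2
    (hsq.comp_measurable (hY.measurable i))

lemma IsInstanceSample.integral_summand (hWs : ∀ j, Ws.col j ⬝ᵥ Ws.col j = 1)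
    (hW : ∀ j, W.col j ⬝ᵥ W.col j = 1 ∨ W.col j = 0) (a : Fin d₁ → ℝ) (c : Fin d₂ → ℝ) (i : ι) :
    ∫ ω, summand Ws W a c (Y i ω) ∂P = a ⬝ᵥ (Ws - W) *ᵥ c := by
  rw [← OneBit.integral_summand hd hWs hW, ← hY.map_eq i,
    integral_map (hY.measurable i).aemeasurable (measurable_summand Ws W a c).aestronglyMeasurable]

lemma IsInstanceSample.variance_summand_le [IsProbabilityMeasure P]
    (hWs : ∀ j, Ws.col j ⬝ᵥ Ws.col j = 1)
    (he : ∀ j, Real.sqrt ((W.col j - Ws.col j) ⬝ᵥ (W.col j - Ws.col j)) ≤ e)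
    (a : Fin d₁ → ℝ) (c : Fin d₂ → ℝ) (i : ι) :
    Var[fun ω => summand Ws W a c (Y i ω); P] ≤ noiseConst * d₂ * e * (a ⬝ᵥ a) * (c ⬝ᵥ c) := by
  refine (variance_le_expectation_sq
    (hY.memLp_summand hd Ws W a c i).aestronglyMeasurable).trans ?_
  refine le_trans (le_of_eq ?_) (integral_summand_sq_le hd hWs he a c)
  rw [← hY.map_eq i, integral_map (hY.measurable i).aemeasurable
    ((measurable_summand Ws W a c).pow_const 2).aestronglyMeasurable]
  rfl

end Summand

section Batch

variable {Y : Fin m → Ω → (Fin d₁ → ℝ) × Fin d₂} {Ws W : Matrix (Fin d₁) (Fin d₂) ℝ} {e : ℝ}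
  (hY : IsInstanceSample P Y) (hd : 0 < d₂) (hm : 0 < m)
  (hWs : ∀ j, Ws.col j ⬝ᵥ Ws.col j = 1)
  (hW : ∀ j, W.col j ⬝ᵥ W.col j = 1 ∨ W.col j = 0)
include hY hd hm hWs hW

lemma IsInstanceSample.dotProduct_noise_mulVec (a : Fin d₁ → ℝ) (c : Fin d₂ → ℝ) (ω : Ω) :
    a ⬝ᵥ noise Ws W (fun i => Y i ω) *ᵥ c =
      (m : ℝ)⁻¹ * (∑ i, summand Ws W a c (Y i ω) - ∫ ω, ∑ i, summand Ws W a c (Y i ω) ∂P) := by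
  have := hY.indep.isProbabilityMeasure
  have hmean : ∫ ω, ∑ i, summand Ws W a c (Y i ω) ∂P = m * (a ⬝ᵥ (Ws - W) *ᵥ c) := by
    rw [integral_finsetSum _ fun i _ =>
      (hY.memLp_summand hd Ws W a c i).integrable one_le_two]
    simp [hY.integral_summand hd hWs hW]
  rw [noise, Matrix.sub_mulVec, dotProduct_sub, dotProduct_correction_mulVec hd, hmean, mul_sub,
    inv_mul_cancel_left₀ (by exact_mod_cast hm.ne')]

lemma IsInstanceSample.integrable_dotProduct_noise_mulVec_sq (a : Fin d₁ → ℝ) (c : Fin d₂ → ℝ) :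
    Integrable (fun ω => (a ⬝ᵥ noise Ws W (fun i => Y i ω) *ᵥ c) ^ 2) P := by
  have := hY.indep.isProbabilityMeasure
  simp only [hY.dotProduct_noise_mulVec hd hm hWs hW, mul_pow]
  exact (((memLp_finsetSum _ fun i _ => hY.memLp_summand hd Ws W a c i).sub
    (memLp_const _)).integrable_sq).const_mul _

lemma IsInstanceSample.integral_dotProduct_noise_mulVec_sq_le
    (he : ∀ j, Real.sqrt ((W.col j - Ws.col j) ⬝ᵥ (W.col j - Ws.col j)) ≤ e)
    (a : Fin d₁ → ℝ) (c : Fin d₂ → ℝ) :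
    ∫ ω, (a ⬝ᵥ noise Ws W (fun i => Y i ω) *ᵥ c) ^ 2 ∂P ≤
      noiseConst * (d₂ / m) * e * (a ⬝ᵥ a) * (c ⬝ᵥ c) := by
  have := hY.indep.isProbabilityMeasure
  have hm' : (m : ℝ) ≠ 0 := by exact_mod_cast hm.ne'
  have hmeas := measurable_summand Ws W a c
  have hL2 := hY.memLp_summand hd Ws W a c
  have hvar : Var[fun ω => ∑ i, summand Ws W a c (Y i ω); P] ≤
      m * (noiseConst * d₂ * e * (a ⬝ᵥ a) * (c ⬝ᵥ c)) := by
    rw [← Finset.sum_fn, IndepFun.variance_sum (fun i _ => hL2 i)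
      fun i _ j _ hij => (hY.indep.indepFun hij).comp hmeas hmeas]
    exact (Finset.sum_le_sum fun i _ => hY.variance_summand_le hd hWs he a c i).trans_eq (by simp)
  simp only [hY.dotProduct_noise_mulVec hd hm hWs hW, mul_pow]
  rw [integral_const_mul,
    ← variance_eq_integral (memLp_finsetSum _ fun i _ => hL2 i).aemeasurable]
  calc ((m : ℝ)⁻¹) ^ 2 * Var[fun ω => ∑ i, summand Ws W a c (Y i ω); P]
      ≤ ((m : ℝ)⁻¹) ^ 2 * (m * (noiseConst * d₂ * e * (a ⬝ᵥ a) * (c ⬝ᵥ c))) := by gcongr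
    _ = noiseConst * (d₂ / m) * e * (a ⬝ᵥ a) * (c ⬝ᵥ c) := by field_simp

omit hY hd hm hWs hW in
lemma norm_dilation_mul_sq {r : Type*} [Fintype r] (N : Matrix (Fin d₁) (Fin d₂) ℝ)
    (X : Matrix (Fin d₁ ⊕ Fin d₂) r ℝ) : ‖dilation N * X‖ ^ 2 =
    (∑ i, ∑ q, ((Pi.single i 1 : Fin d₁ → ℝ) ⬝ᵥ N *ᵥ fun j => X (Sum.inr j) q) ^ 2) +
      ∑ j, ∑ q, ((fun i => X (Sum.inl i) q) ⬝ᵥ N *ᵥ (Pi.single j 1)) ^ 2 := by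
  rw [frobenius_norm_sq, Fintype.sum_sum_type]
  congr 1
  · refine Finset.sum_congr rfl fun i _ => Finset.sum_congr rfl fun q _ => ?_
    rw [single_dotProduct, one_mul]
    simp [dilation, Matrix.mul_apply, Matrix.mulVec, dotProduct]
  · refine Finset.sum_congr rfl fun i _ => Finset.sum_congr rfl fun q _ => ?_
    simp [dilation, Matrix.mul_apply, dotProduct, mul_comm]

lemma IsInstanceSample.integrable_norm_dilation_noise_mul_sq {r : Type*} [Fintype r]
    (X : Matrix (Fin d₁ ⊕ Fin d₂) r ℝ) :
    Integrable (fun ω => ‖dilation (noise Ws W fun i => Y i ω) * X‖ ^ 2) P := by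
  have hint := hY.integrable_dotProduct_noise_mulVec_sq hd hm hWs hW
  simp only [norm_dilation_mul_sq]
  exact (integrable_finsetSum _ fun i _ => integrable_finsetSum _ fun q _ => hint _ _).add
    (integrable_finsetSum _ fun j _ => integrable_finsetSum _ fun q _ => hint _ _)

/-- Each entry of `𝒟(N) X` is a bilinear form in `N`; there are `d₁` rows coming from `N` and
`d₂ ≤ d₁` rows coming from `Nᵀ`. -/
lemma IsInstanceSample.integral_norm_dilation_noise_mul_sq_le
    (he : ∀ j, Real.sqrt ((W.col j - Ws.col j) ⬝ᵥ (W.col j - Ws.col j)) ≤ e)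
    (hdd : d₂ ≤ d₁) {r : Type*} [Fintype r] (X : Matrix (Fin d₁ ⊕ Fin d₂) r ℝ) :
    ∫ ω, ‖dilation (noise Ws W fun i => Y i ω) * X‖ ^ 2 ∂P ≤
      noiseConst * (d₁ * d₂ / m) * e * ‖X‖ ^ 2 := by
  have hint := hY.integrable_dotProduct_noise_mulVec_sq hd hm hWs hW
  have hle := hY.integral_dotProduct_noise_mulVec_sq_le hd hm hWs hW he
  have hc := noiseConst_pos.le
  have he0 : 0 ≤ e := (Real.sqrt_nonneg _).trans (he ⟨0, hd⟩)
  simp only [norm_dilation_mul_sq]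
  rw [integral_add (integrable_finsetSum _ fun i _ => integrable_finsetSum _ fun q _ => hint _ _)
      (integrable_finsetSum _ fun j _ => integrable_finsetSum _ fun q _ => hint _ _),
    integral_finsetSum _ fun i _ => integrable_finsetSum _ fun q _ => hint _ _,
    integral_finsetSum _ fun j _ => integrable_finsetSum _ fun q _ => hint _ _]
  simp only [integral_finsetSum _ fun _ _ => hint _ _]
  calc _ ≤ (∑ _i : Fin d₁, ∑ q, noiseConst * (d₂ / m) * e * ∑ j, X (Sum.inr j) q ^ 2) +
        ∑ _j : Fin d₂, ∑ q, noiseConst * (d₂ / m) * e * ∑ i, X (Sum.inl i) q ^ 2 := by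
        refine add_le_add (Finset.sum_le_sum fun i _ => Finset.sum_le_sum fun q _ => ?_)
          (Finset.sum_le_sum fun j _ => Finset.sum_le_sum fun q _ => ?_) <;>
        · refine (hle _ _).trans_eq ?_
          rw [single_dotProduct, Pi.single_eq_same, mul_one, mul_one]
          simp only [dotProduct, ← sq]
    _ = noiseConst * (d₂ / m) * e *
        (d₁ * (∑ j, ∑ q, X (Sum.inr j) q ^ 2) + d₂ * ∑ i, ∑ q, X (Sum.inl i) q ^ 2) := by
        simp only [Finset.sum_const, ← Finset.mul_sum, Finset.card_univ, Fintype.card_fin,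
          nsmul_eq_mul]
        rw [Finset.sum_comm, Finset.sum_comm (γ := Fin d₁)]
        ring
    _ ≤ noiseConst * (d₂ / m) * e *
        (d₁ * (∑ j, ∑ q, X (Sum.inr j) q ^ 2) + d₁ * ∑ i, ∑ q, X (Sum.inl i) q ^ 2) := by
        gcongr
    _ = noiseConst * (d₁ * d₂ / m) * e * ‖X‖ ^ 2 := by
        rw [frobenius_norm_sq, Fintype.sum_sum_type]
        ring

omit hY hd hm hWs hW in
lemma norm_dilation_mul_fromRows_zero_one (N : Matrix (Fin d₁) (Fin d₂) ℝ) :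
    ‖dilation N * (Matrix.fromRows 0 1 : Matrix (Fin d₁ ⊕ Fin d₂) (Fin d₂) ℝ)‖ = ‖N‖ := by
  rw [← sq_eq_sq₀ (norm_nonneg _) (norm_nonneg _), dilation, Matrix.fromBlocks_mul_fromRows,
    frobenius_norm_sq, frobenius_norm_sq, Fintype.sum_sum_type]
  simp

lemma IsInstanceSample.integrable_norm_noise_sq :
    Integrable (fun ω => ‖noise Ws W fun i => Y i ω‖ ^ 2) P := by
  have hint := hY.integrable_norm_dilation_noise_mul_sq hd hm hWs hW
    (Matrix.fromRows 0 1 : Matrix (Fin d₁ ⊕ Fin d₂) (Fin d₂) ℝ)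
  simpa only [norm_dilation_mul_fromRows_zero_one] using hint

lemma IsInstanceSample.integral_norm_noise_sq_le
    (he : ∀ j, Real.sqrt ((W.col j - Ws.col j) ⬝ᵥ (W.col j - Ws.col j)) ≤ e) (hdd : d₂ ≤ d₁) :
    ∫ ω, ‖noise Ws W fun i => Y i ω‖ ^ 2 ∂P ≤ noiseConst * (d₁ * d₂ / m) * e * d₂ := by
  have hle := hY.integral_norm_dilation_noise_mul_sq_le hd hm hWs hW he hdd
    (Matrix.fromRows 0 1 : Matrix (Fin d₁ ⊕ Fin d₂) (Fin d₂) ℝ)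
  have hnorm : ‖(Matrix.fromRows 0 1 : Matrix (Fin d₁ ⊕ Fin d₂) (Fin d₂) ℝ)‖ ^ 2 = d₂ := by
    rw [frobenius_norm_sq, Fintype.sum_sum_type]
    simp [Matrix.one_apply]
  simpa only [norm_dilation_mul_fromRows_zero_one, hnorm] using hle

end Batch

end Noise

section State

variable {m d₁ d₂ : ℕ}

/-- A state of the algorithm: the current estimate and the projection onto the span of the columns
of the current factor `U`. Unlike `U`, the projection does not depend on the choice of singular
vectors and of QR factors, so that the states are functions of the observed batches. -/
abbrev State (d₁ d₂ : ℕ) : Type :=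
  Matrix (Fin d₁) (Fin d₂) ℝ × Matrix (Fin d₁ ⊕ Fin d₂) (Fin d₁ ⊕ Fin d₂) ℝ

/-- The matrix `M = 𝒟(H) + 𝒟(W)` of one iteration. -/
noncomputable def iterMatrix (Ws W : Matrix (Fin d₁) (Fin d₂) ℝ) (b : Batch m d₁ d₂) :
    Matrix (Fin d₁ ⊕ Fin d₂) (Fin d₁ ⊕ Fin d₂) ℝ :=
  dilation (correction b (labels b Ws) W) + dilation W

/-- The projection onto the span of the next factor `U`. The column space of `M U` is recovered
from `M U Uᵀ` by a spectral cut-off at `τ`. -/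
noncomputable def nextProj (Ws : Matrix (Fin d₁) (Fin d₂) ℝ) (τ : ℝ) (S : State d₁ d₂)
    (b : Batch m d₁ d₂) : Matrix (Fin d₁ ⊕ Fin d₂) (Fin d₁ ⊕ Fin d₂) ℝ :=
  leftSingularProj τ (iterMatrix Ws S.1 b * S.2)

/-- One iteration of the algorithm on the level of states. -/
noncomputable def nextState (Ws : Matrix (Fin d₁) (Fin d₂) ℝ) (τ : ℝ) (S : State d₁ d₂)
    (b : Batch m d₁ d₂) : State d₁ d₂ :=
  (colNormalize (nextProj Ws τ S b * iterMatrix Ws S.1 b).toBlocks₁₂, nextProj Ws τ S b)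

/-- The sequence of states of the algorithm. -/
noncomputable def stateSeq (Ws : Matrix (Fin d₁) (Fin d₂) ℝ) (τ : ℝ) (bs : ℕ → Batch m d₁ d₂) :
    ℕ → State d₁ d₂
  | 0 => (0, leftSingularProj τ (dilation (correction (bs 0) (labels (bs 0) Ws) 0)))
  | t + 1 => nextState Ws τ (stateSeq Ws τ bs t) (bs t)

lemma stateSeq_col_unit_or_zero (Ws : Matrix (Fin d₁) (Fin d₂) ℝ) (τ : ℝ)
    (bs : ℕ → Batch m d₁ d₂) (t : ℕ) (j : Fin d₂) :
    (stateSeq Ws τ bs t).1.col j ⬝ᵥ (stateSeq Ws τ bs t).1.col j = 1 ∨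
      (stateSeq Ws τ bs t).1.col j = 0 := by
  cases t with
  | zero => exact Or.inr rfl
  | succ t =>
    refine (sum_colNormalize_sq_eq_one_or_eq_zero _ j).imp (fun hone => ?_)
      fun hzero => funext hzero
    exact (Finset.sum_congr rfl fun i _ => (sq _).symm).trans hone

variable {k T : ℕ} {Ws : Matrix (Fin d₁) (Fin d₂) ℝ}
  {Q : Matrix (Fin d₁ ⊕ Fin d₂) (Fin d₁ ⊕ Fin d₂) ℝ} {σ : ℝ}

/-- The factors `U, V` of a run represent the state `S`, and the column space of `U` is close to
the range of the projection `Q`. -/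
structure Tracks (Q : Matrix (Fin d₁ ⊕ Fin d₂) (Fin d₁ ⊕ Fin d₂) ℝ) (S : State d₁ d₂)
    (U V : Matrix (Fin d₁ ⊕ Fin d₂) (Fin (2 * k)) ℝ) : Prop where
  transpose_mul_self : Uᵀ * U = 1
  estimate_eq : estimate U V = S.1
  mul_transpose_eq : U * Uᵀ = S.2
  norm_one_sub_mul_le : ‖(1 - S.2) * Q‖ ≤ 1 / 2

lemma Tracks.isStarProjection {S : State d₁ d₂} {U V : Matrix (Fin d₁ ⊕ Fin d₂) (Fin (2 * k)) ℝ}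
    (hS : Tracks Q S U V) : IsStarProjection S.2 :=
  hS.mul_transpose_eq ▸ isStarProjection_mul_transpose hS.transpose_mul_self

lemma Tracks.norm_sq_eq {S : State d₁ d₂} {U V : Matrix (Fin d₁ ⊕ Fin d₂) (Fin (2 * k)) ℝ}
    (hS : Tracks Q S U V) : ‖S.2‖ ^ 2 = (2 * k : ℕ) := by
  rw [norm_sq_eq_trace_of_isStarProjection hS.isStarProjection, ← hS.mul_transpose_eq,
    trace_mul_transpose_of_isometry hS.transpose_mul_self]

lemma one_sub_mul_eq_zero_of_isQRFactor {M : Matrix (Fin d₁ ⊕ Fin d₂) (Fin d₁ ⊕ Fin d₂) ℝ}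
    {U U' : Matrix (Fin d₁ ⊕ Fin d₂) (Fin (2 * k)) ℝ} (hU' : IsQRFactor (M * U) U') :
    (1 - U' * U'ᵀ) * (M * (U * Uᵀ)) = 0 := by
  obtain ⟨hUU', R, -, hR⟩ := hU'
  have hcancel : (1 - U' * U'ᵀ) * U' = 0 := by
    rw [Matrix.sub_mul, Matrix.one_mul, Matrix.mul_assoc, hUU', Matrix.mul_one, sub_self]
  rw [← Matrix.mul_assoc M, hR, ← Matrix.mul_assoc, ← Matrix.mul_assoc, hcancel, Matrix.zero_mul,
    Matrix.zero_mul]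

section Step

variable {S : State d₁ d₂} {b : Batch m d₁ d₂}
  {U V U' : Matrix (Fin d₁ ⊕ Fin d₂) (Fin (2 * k)) ℝ}
  (h : IsRangeProj (dilation Ws) Q σ) (htr : Q.trace = (2 * k : ℕ)) (hS : Tracks Q S U V)
  (hgood : ‖dilation (noise Ws S.1 b)‖ ≤ σ / 8)
  (hU' : IsQRFactor (iterMatrix Ws S.1 b * U) U')
include h htr hS hgood hU'

lemma Tracks.nextProj_eq : nextProj Ws (σ / 4) S b = U' * U'ᵀ := by
  have hclose := hS.norm_one_sub_mul_le
  rw [iterMatrix, dilation_correction_add] at hU'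
  rw [← hS.mul_transpose_eq] at hclose
  rw [nextProj, iterMatrix, dilation_correction_add, ← hS.mul_transpose_eq]
  exact h.leftSingularProj_step htr hS.transpose_mul_self hclose hgood hU'

lemma Tracks.next : Tracks Q (nextState Ws (σ / 4) S b) U' (iterMatrix Ws S.1 b * U') := by
  have hnext := hS.nextProj_eq h htr hgood hU'
  have hsymm : (iterMatrix Ws S.1 b)ᵀ = iterMatrix Ws S.1 b := by
    rw [iterMatrix, Matrix.transpose_add, dilation_transpose, dilation_transpose]
  refine ⟨hU'.1, ?_, hnext.symm, ?_⟩
  · rw [estimate, nextState, hnext, Matrix.transpose_mul, hsymm, Matrix.mul_assoc]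
  · have hzero := one_sub_mul_eq_zero_of_isQRFactor hU'
    rw [iterMatrix, dilation_correction_add, hS.mul_transpose_eq] at hzero
    rw [nextState, hnext]
    exact h.norm_one_sub_mul_proj_le_half hS.isStarProjection
      (isStarProjection_mul_transpose hU'.1) hzero hS.norm_one_sub_mul_le hgood

lemma Tracks.norm_sub_nextState_le (hWs : ∀ j, ∑ i, Ws i j ^ 2 = 1) :
    ‖Ws - (nextState Ws (σ / 4) S b).1‖ ≤
      2 * (2 * ‖dilation (noise Ws S.1 b) * S.2‖ + ‖dilation (noise Ws S.1 b) * Q‖) := by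
  have hzero := one_sub_mul_eq_zero_of_isQRFactor hU'
  rw [iterMatrix, dilation_correction_add, hS.mul_transpose_eq] at hzero
  have htr' : (U' * U'ᵀ).trace = Q.trace := by rw [trace_mul_transpose_of_isometry hU'.1, htr]
  rw [nextState, hS.nextProj_eq h htr hgood hU']
  refine (norm_sub_colNormalize_toBlocks₁₂_le hWs _).trans ?_
  rw [iterMatrix, dilation_correction_add]
  gcongr
  exact h.norm_sub_projection_mul_le hS.isStarProjection (isStarProjection_mul_transpose hU'.1)
    htr' (dilation_transpose _) hzero hS.norm_one_sub_mul_le hgood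

end Step

section Run

variable {bs : ℕ → Batch m d₁ d₂} {U V : ℕ → Matrix (Fin d₁ ⊕ Fin d₂) (Fin (2 * k)) ℝ}
  (h : IsRangeProj (dilation Ws) Q σ) (htr : Q.trace = (2 * k : ℕ)) (hk : 1 ≤ k)
include h htr hk

lemma tracks_init {b : Batch m d₁ d₂} {U : Matrix (Fin d₁ ⊕ Fin d₂) (Fin (2 * k)) ℝ}
    (hU : IsTopLeftSingular (dilation (correction b (labels b Ws) 0)) U)
    (hgood : ‖dilation (noise Ws 0 b)‖ ≤ σ / 8) :
    Tracks Q ((0, leftSingularProj (σ / 4) (dilation (correction b (labels b Ws) 0))) :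
      State d₁ d₂) U 0 := by
  rw [dilation_correction_zero] at hU ⊢
  have hinit := h.leftSingularProj_init (by omega) htr (dilation_transpose _) hU hgood
  refine ⟨hU.transpose_mul_self, estimate_zero_right _, hinit.symm, ?_⟩
  rw [hinit]
  exact (h.norm_one_sub_mul_proj_le_quarter (by omega) htr hU hgood).trans (by norm_num)

variable (hrun : IsRun k T bs (fun t => labels (bs t) Ws) U V)
  (hgood : ∀ t < T, ‖dilation (noise Ws (stateSeq Ws (σ / 4) bs t).1 (bs t))‖ ≤ σ / 8)
include hrun hgood

lemma tracks_of_isRun (hT : 0 < T) : ∀ t ≤ T, Tracks Q (stateSeq Ws (σ / 4) bs t) (U t) (V t) := by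
  intro t
  induction t with
  | zero =>
    intro _
    rw [hrun.init_V]
    exact tracks_init h htr hk hrun.init_U (hgood 0 hT)
  | succ t ih =>
    intro ht
    have hS := ih (by omega)
    have hstep := hrun.step_U t (by omega)
    rw [hS.estimate_eq] at hstep
    rw [hrun.step_V t (by omega), hS.estimate_eq]
    exact hS.next h htr (hgood t (by omega)) hstep

lemma specNorm_sub_estimate_succ_le (hWs : ∀ j, ∑ i, Ws i j ^ 2 = 1) {t : ℕ} (ht : t < T) :
    specNorm (Ws - estimate (U (t + 1)) (V (t + 1))) ≤
      2 * (2 * ‖dilation (noise Ws (stateSeq Ws (σ / 4) bs t).1 (bs t)) *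
          (stateSeq Ws (σ / 4) bs t).2‖ +
        ‖dilation (noise Ws (stateSeq Ws (σ / 4) bs t).1 (bs t)) * Q‖) := by
  have hT : 0 < T := by omega
  have hS := tracks_of_isRun h htr hk hrun hgood hT t ht.le
  have hstep := hrun.step_U t ht
  rw [hS.estimate_eq] at hstep
  rw [(tracks_of_isRun h htr hk hrun hgood hT (t + 1) ht).estimate_eq]
  exact (specNorm_le_frobenius_norm _).trans
    (hS.norm_sub_nextState_le h htr (hgood t ht) hstep hWs)

end Run

end State

section Measurability

section Matrix

variable {m n : Type*}

instance : MeasurableSpace (Matrix m n ℝ) :=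
  inferInstanceAs (MeasurableSpace (m → n → ℝ))

instance [Countable m] [Countable n] : BorelSpace (Matrix m n ℝ) :=
  inferInstanceAs (BorelSpace (m → n → ℝ))

instance [Countable m] [Countable n] : SecondCountableTopology (Matrix m n ℝ) :=
  inferInstanceAs (SecondCountableTopology (m → n → ℝ))

lemma measurable_matrix_iff {Ω : Type*} [MeasurableSpace Ω] {A : Ω → Matrix m n ℝ} :
    Measurable A ↔ ∀ i j, Measurable fun ω => A ω i j :=
  measurable_pi_iff.trans (forall_congr' fun _ => measurable_pi_iff)

instance [Fintype n] [DecidableEq n] : MeasurableInv (Matrix n n ℝ) where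
  measurable_inv := by
    have hdet : Measurable fun A : Matrix n n ℝ => A.det := continuous_id.matrix_det.measurable
    have hadj : Measurable fun A : Matrix n n ℝ => A.adjugate :=
      continuous_id.matrix_adjugate.measurable
    refine measurable_matrix_iff.2 fun i j => ?_
    simp only [Matrix.inv_def, Ring.inverse_eq_inv', Matrix.smul_apply, smul_eq_mul]
    exact hdet.inv.mul (measurable_matrix_iff.1 hadj i j)

lemma measurable_leftSingularProj [Fintype n] [DecidableEq n] {τ : ℝ} (hτ : 0 < τ) :
    Measurable fun A : Matrix n n ℝ => leftSingularProj τ A := by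
  refine measurable_of_tendsto_metrizable (fun p => ?_)
    (tendsto_pi_nhds.2 fun A => tendsto_leftSingularProj hτ A)
  have hA : Measurable fun A : Matrix n n ℝ => A * Aᵀ :=
    (continuous_id.matrix_mul continuous_id.matrix_transpose).measurable
  exact (hA.pow_const p).mul (measurable_const.add (hA.pow_const p)).inv

lemma measurable_frobenius_norm [Fintype m] [Fintype n] :
    Measurable fun A : Matrix m n ℝ => ‖A‖ := by
  simp only [frobenius_norm_eq_sqrt]
  fun_prop

end Matrix

variable {m d₁ d₂ : ℕ}

lemma measurable_dilation : Measurable (dilation : Matrix (Fin d₁) (Fin d₂) ℝ → _) := by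
  exact (continuous_const.matrix_fromBlocks continuous_id continuous_id.matrix_transpose
    continuous_const).measurable

lemma measurable_specNorm : Measurable (specNorm : Matrix (Fin d₁) (Fin d₂) ℝ → ℝ) := by
  have h : Continuous fun M : Matrix (Fin d₁) (Fin d₂) ℝ => specNorm M :=
    continuous_norm.comp (LinearMap.continuous_of_finiteDimensional
      ((LinearMap.toContinuousLinearMap (𝕜 := ℝ) (E := EuclideanSpace ℝ (Fin d₂))
        (F' := EuclideanSpace ℝ (Fin d₁))).toLinearMap.comp
        (Matrix.toEuclideanLin (𝕜 := ℝ) (m := Fin d₁) (n := Fin d₂)).toLinearMap))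
  exact h.measurable

lemma measurable_colNormalize :
    Measurable (colNormalize : Matrix (Fin d₁) (Fin d₂) ℝ → _) := by
  refine measurable_matrix_iff.2 fun i j => ?_
  simp only [colNormalize, Matrix.of_apply]
  fun_prop

variable {Ω : Type*} {_ : MeasurableSpace Ω} {b : Ω → Batch m d₁ d₂}
  {W : Ω → Matrix (Fin d₁) (Fin d₂) ℝ} {S : Ω → State d₁ d₂}

lemma measurable_oneHot_apply (j : Fin d₂) : Measurable fun l : Fin d₂ => oneHot l j :=
  Measurable.of_discrete

lemma measurable_labels (hb : Measurable b) (hW : Measurable W) :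
    Measurable fun ω => labels (b ω) (W ω) := by
  refine measurable_pi_lambda _ fun i => measurable_sgn.comp ?_
  simp only [sensing, dotProduct, Matrix.mulVec]
  have hbi : Measurable fun ω => b ω i := (measurable_pi_apply i).comp hb
  exact Finset.measurable_sum _ fun l _ => ((measurable_pi_apply l).comp hbi.fst).mul <|
    Finset.measurable_sum _ fun j _ =>
      (measurable_matrix_iff.1 hW l j).mul ((measurable_oneHot_apply j).comp hbi.snd)

lemma measurable_correction (Ws : Matrix (Fin d₁) (Fin d₂) ℝ) (hb : Measurable b)
    (hW : Measurable W) : Measurable fun ω => correction (b ω) (labels (b ω) Ws) (W ω) := by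
  refine measurable_matrix_iff.2 fun l j => ?_
  simp only [correction, sensingAdj, Matrix.smul_apply, Matrix.sum_apply, smul_eq_mul,
    Matrix.vecMulVec_apply, Pi.sub_apply]
  refine (Finset.measurable_sum _ fun i _ => ?_).const_mul _
  have hbi : Measurable fun ω => b ω i := (measurable_pi_apply i).comp hb
  have hlabel : ∀ {W' : Ω → Matrix (Fin d₁) (Fin d₂) ℝ}, Measurable W' →
      Measurable fun ω => labels (b ω) (W' ω) i := fun hW' =>
    (measurable_pi_apply i).comp (measurable_labels hb hW')
  exact ((hlabel measurable_const).sub (hlabel hW)).mul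
    (((measurable_pi_apply l).comp hbi.fst).mul ((measurable_oneHot_apply j).comp hbi.snd))

lemma measurable_noise (Ws : Matrix (Fin d₁) (Fin d₂) ℝ) (hb : Measurable b)
    (hW : Measurable W) : Measurable fun ω => noise Ws (W ω) (b ω) :=
  (measurable_correction Ws hb hW).sub (measurable_const.sub hW)

lemma measurable_nextState (Ws : Matrix (Fin d₁) (Fin d₂) ℝ) {τ : ℝ} (hτ : 0 < τ)
    (hS : Measurable S) (hb : Measurable b) :
    Measurable fun ω => nextState Ws τ (S ω) (b ω) := by
  have hM : Measurable fun ω => iterMatrix Ws (S ω).1 (b ω) :=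
    (measurable_dilation.comp (measurable_correction Ws hb hS.fst)).add
      (measurable_dilation.comp hS.fst)
  have hP : Measurable fun ω => nextProj Ws τ (S ω) (b ω) :=
    (measurable_leftSingularProj hτ).comp (hM.mul hS.snd)
  refine Measurable.prodMk (measurable_colNormalize.comp (measurable_matrix_iff.2 fun i j => ?_)) hP
  exact measurable_matrix_iff.1 (hP.mul hM) (Sum.inl i) (Sum.inr j)

lemma measurable_stateSeq (Ws : Matrix (Fin d₁) (Fin d₂) ℝ) {τ : ℝ} (hτ : 0 < τ)
    {bs : Ω → ℕ → Batch m d₁ d₂} {t : ℕ} (ht : 1 ≤ t)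
    (hb : ∀ s < t, Measurable fun ω => bs ω s) :
    Measurable fun ω => stateSeq Ws τ (bs ω) t := by
  induction t, ht using Nat.le_induction with
  | base =>
    have hb₀ := hb 0 one_pos
    exact measurable_nextState Ws hτ (measurable_const.prodMk ((measurable_leftSingularProj hτ).comp
      (measurable_dilation.comp (measurable_correction Ws hb₀ measurable_const)))) hb₀
  | succ t _ ih =>
    exact measurable_nextState Ws hτ (ih fun s hs => hb s (hs.trans t.lt_succ_self))
      (hb t t.lt_succ_self)

end Measurability

section Recursion

variable {T : ℕ} {δ nrm : ℝ} {err : ℕ → ℝ}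

/-- The fixed point of `x ↦ δ √x` is `δ ^ 2`, and the map halves the logarithm of `x / δ ^ 2`. -/
lemma le_of_sqrt_recursion (hδ : 0 < δ) {s : ℕ} (hs : 0 ≤ err s)
    (hstep : ∀ t, s ≤ t → t < T → err (t + 1) ≤ δ * √(err t)) {n : ℕ} (hn : s + n ≤ T) :
    err (s + n) ≤ δ ^ 2 * (err s / δ ^ 2) ^ ((1 / 2 : ℝ) ^ n) := by
  have hx : 0 ≤ err s / δ ^ 2 := by positivity
  induction n with
  | zero => simp [mul_div_cancel₀, hδ.ne']
  | succ n ih =>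
    calc err (s + n + 1)
        ≤ δ * √(δ ^ 2 * (err s / δ ^ 2) ^ ((1 / 2 : ℝ) ^ n)) :=
          (hstep _ (by omega) (by omega)).trans (by gcongr; exact ih (by omega))
      _ = δ ^ 2 * ((err s / δ ^ 2) ^ ((1 / 2 : ℝ) ^ n)) ^ (1 / 2 : ℝ) := by
          rw [Real.sqrt_mul (sq_nonneg δ), Real.sqrt_sq hδ.le, ← Real.sqrt_eq_rpow]
          ring
      _ = δ ^ 2 * (err s / δ ^ 2) ^ ((1 / 2 : ℝ) ^ (n + 1)) := by
          rw [← Real.rpow_mul hx, pow_succ (1 / 2 : ℝ)]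

lemma exists_first_le_one (T : ℕ) (err : ℕ → ℝ) :
    ∃ t₀, 0 < t₀ ∧ (∀ s, 0 < s → s < t₀ → s ≤ T → 1 < err s) ∧ (t₀ ≤ T → err t₀ ≤ 1) := by
  classical
  have hex : ∃ s, 0 < s ∧ (s ≤ T → err s ≤ 1) := ⟨T + 1, by omega, fun h => by omega⟩
  refine ⟨Nat.find hex, (Nat.find_spec hex).1, fun s hs hlt _ => ?_, (Nat.find_spec hex).2⟩
  by_contra! hle
  exact Nat.find_min hex hlt ⟨hs, fun _ => hle⟩

lemma first_phase_le (hδ : 0 ≤ δ) (h1 : err 1 ≤ nrm)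
    (hstep : ∀ t, 1 ≤ t → t < T → err (t + 1) ≤ δ * √(err t)) {t : ℕ} (ht : t < T)
    (hlarge : ∀ s, 0 < s → s ≤ t → 1 < err s) : err (t + 1) ≤ δ ^ t * nrm := by
  induction t with
  | zero => simpa using h1
  | succ t ih =>
    have hgt : 1 < err (t + 1) := hlarge _ (by omega) le_rfl
    have hsqrt : √(err (t + 1)) ≤ err (t + 1) := by
      rw [Real.sqrt_le_left (by linarith)]
      nlinarith
    calc err (t + 1 + 1) ≤ δ * √(err (t + 1)) := hstep _ (by omega) ht
      _ ≤ δ * (δ ^ t * nrm) := by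
          gcongr
          exact hsqrt.trans (ih (by omega) fun s hs hst => hlarge s hs (by omega))
      _ = δ ^ (t + 1) * nrm := by ring

lemma second_phase_le (hδ : 0 < δ) {t₀ t : ℕ} (h0 : 0 ≤ err t₀)
    (hstep : ∀ t, t₀ ≤ t → t < T → err (t + 1) ≤ δ * √(err t)) (ht : t < T) (ht₀ : t₀ ≤ t) :
    err (t + 1) ≤
      δ ^ (2 - (2 : ℝ) ^ ((t₀ : ℝ) - t)) * err t₀ ^ ((2 : ℝ) ^ ((t₀ : ℝ) - 1 - t)) := by
  obtain ⟨n, rfl⟩ := Nat.exists_eq_add_of_le ht₀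
  have hexp : (2 : ℝ) ^ ((t₀ : ℝ) - 1 - (t₀ + n : ℕ)) = (1 / 2) ^ (n + 1) := by
    rw [show (t₀ : ℝ) - 1 - (t₀ + n : ℕ) = -((n + 1 : ℕ) : ℝ) by push_cast; ring,
      Real.rpow_neg zero_le_two, Real.rpow_natCast, one_div, inv_pow]
  have hexp' : (2 : ℝ) ^ ((t₀ : ℝ) - (t₀ + n : ℕ)) = 2 * (1 / 2) ^ (n + 1) := by
    rw [← hexp, show (t₀ : ℝ) - (t₀ + n : ℕ) = 1 + ((t₀ : ℝ) - 1 - (t₀ + n : ℕ)) by ring,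
      Real.rpow_add two_pos, Real.rpow_one]
  calc err (t₀ + n + 1) ≤ δ ^ 2 * (err t₀ / δ ^ 2) ^ ((1 / 2 : ℝ) ^ (n + 1)) :=
        le_of_sqrt_recursion hδ h0 hstep (n := n + 1) (by omega)
    _ = δ ^ (2 - 2 * (1 / 2 : ℝ) ^ (n + 1)) * err t₀ ^ ((1 / 2 : ℝ) ^ (n + 1)) := by
        rw [Real.div_rpow h0 (sq_nonneg δ), ← Real.rpow_natCast δ 2, ← Real.rpow_mul hδ.le,
          Real.rpow_sub hδ]
        push_cast
        ring
    _ = _ := by rw [hexp, hexp']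

lemma twoPhase_of_recursion (hδ : 0 < δ) (herr : ∀ t, 0 ≤ err t) (h1 : 0 < T → err 1 ≤ nrm)
    (hstep : ∀ t, 1 ≤ t → t < T → err (t + 1) ≤ δ * √(err t)) : TwoPhase T δ nrm err := by
  obtain ⟨t₀, hpos, hlarge, hsmall⟩ := exists_first_le_one T err
  exact ⟨t₀, hpos, hlarge, hsmall,
    fun t ht htt₀ => first_phase_le hδ.le (h1 (by omega)) hstep ht
      fun s hs hst => hlarge s hs (by omega) (by omega),
    fun t ht ht₀ => second_phase_le hδ (herr t₀) (fun t ht => hstep t (by omega)) ht ht₀⟩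

section FinalError

variable {d : ℕ} {ε : ℝ} (hd : 1 ≤ d) (hε : 0 < ε) (hε1 : ε ≤ 1)
  (hT : Real.logb 2 d + Real.logb 2 (1 + Real.logb 2 (1 / ε)) + 3 ≤ T)
include hd hε hε1 hT

lemma mul_one_add_logb_le_two_pow : 8 * d * (1 + Real.logb 2 (1 / ε)) ≤ 2 ^ T := by
  have hd0 : (0 : ℝ) < d := by exact_mod_cast hd
  have hlog : 0 ≤ Real.logb 2 (1 / ε) := Real.logb_nonneg one_lt_two (one_le_one_div hε hε1)
  have h := Real.rpow_le_rpow_of_exponent_le one_le_two hT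
  rw [Real.rpow_add two_pos, Real.rpow_add two_pos, Real.rpow_logb two_pos (by norm_num) hd0,
    Real.rpow_logb two_pos (by norm_num) (by linarith), Real.rpow_natCast,
    show (2 : ℝ) ^ (3 : ℝ) = 8 by norm_num] at h
  linarith

lemma pos_of_logb_add_le : 0 < T := by
  have hd' : (1 : ℝ) ≤ d := by exact_mod_cast hd
  have hlog : 0 ≤ Real.logb 2 (1 / ε) := Real.logb_nonneg one_lt_two (one_le_one_div hε hε1)
  have hlogd : 0 ≤ Real.logb 2 d := Real.logb_nonneg one_lt_two hd'
  have hloglog : 0 ≤ Real.logb 2 (1 + Real.logb 2 (1 / ε)) :=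
    Real.logb_nonneg one_lt_two (by linarith)
  exact_mod_cast (by linarith : (0 : ℝ) < T)

lemma div_div_four_le_two_rpow : d / (ε / 4) ≤ 2 ^ ((2 : ℝ) ^ T) := by
  have hd' : (1 : ℝ) ≤ d := by exact_mod_cast hd
  have hlog : 0 ≤ Real.logb 2 (1 / ε) := Real.logb_nonneg one_lt_two (one_le_one_div hε hε1)
  have hdpow : (d : ℝ) ≤ 2 ^ (d : ℝ) := by
    rw [Real.rpow_natCast]
    exact_mod_cast (Nat.lt_two_pow_self (n := d)).le
  have hlogpow : (2 : ℝ) ^ Real.logb 2 (1 / ε) = 1 / ε :=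
    Real.rpow_logb two_pos (by norm_num) (by positivity)
  calc d / (ε / 4) = d * (2 ^ (2 : ℝ) * (1 / ε)) := by
        norm_num
        field_simp
    _ ≤ 2 ^ (d : ℝ) * (2 ^ (2 : ℝ) * (1 / ε)) := by gcongr
    _ = 2 ^ (d + (2 + Real.logb 2 (1 / ε))) := by
        rw [Real.rpow_add two_pos, Real.rpow_add two_pos 2, hlogpow]
    _ ≤ 2 ^ ((2 : ℝ) ^ T) := by
        refine Real.rpow_le_rpow_of_exponent_le one_le_two
          (le_trans ?_ (mul_one_add_logb_le_two_pow hd hε hε1 hT))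
        nlinarith [mul_le_mul_of_nonneg_right hd' hlog]

lemma final_error_le (h0 : 0 ≤ err 1) (h1 : err 1 ≤ d)
    (hstep : ∀ t, 1 ≤ t → t < T → err (t + 1) ≤ √ε / 2 * √(err t)) : err T ≤ ε := by
  obtain ⟨n, rfl⟩ : ∃ n, T = 1 + n :=
    Nat.exists_eq_add_of_le (pos_of_logb_add_le hd hε hε1 hT)
  have hfix : (√ε / 2) ^ 2 = ε / 4 := by
    rw [div_pow, Real.sq_sqrt hε.le]
    norm_num
  have hpow : (2 : ℝ) ^ (1 + n) * (1 / 2) ^ n = 2 := by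
    rw [pow_add, mul_assoc, ← mul_pow]
    norm_num
  have hrate := le_of_sqrt_recursion (by positivity) h0 hstep le_rfl
  rw [hfix] at hrate
  calc err (1 + n) ≤ ε / 4 * (err 1 / (ε / 4)) ^ ((1 / 2 : ℝ) ^ n) := hrate
    _ ≤ ε / 4 * (2 ^ ((2 : ℝ) ^ (1 + n))) ^ ((1 / 2 : ℝ) ^ n) := by
        gcongr
        exact (by gcongr : _ ≤ d / (ε / 4)).trans (div_div_four_le_two_rpow hd hε hε1 hT)
    _ = ε := by
        rw [← Real.rpow_mul zero_le_two, hpow]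
        norm_num

end FinalError

end Recursion

section Tail

variable {Ω : Type*} {mΩ : MeasurableSpace Ω} {P : Measure Ω}

lemma measure_mem_le_of_indepFun [IsProbabilityMeasure P] {S B : Type*} [MeasurableSpace S]
    [MeasurableSpace B] {X : Ω → S} {Y : Ω → B} (hX : Measurable X) (hY : Measurable Y)
    (h : IndepFun X Y P) {bad : Set (S × B)} (hbad : MeasurableSet bad) {θ : ENNReal}
    (hθ : ∀ ω, P {ω' | (X ω, Y ω') ∈ bad} ≤ θ) : P {ω | (X ω, Y ω) ∈ bad} ≤ θ := by
  have := Measure.isProbabilityMeasure_map (μ := P) hY.aemeasurable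
  calc P {ω | (X ω, Y ω) ∈ bad} = P.map (fun ω => (X ω, Y ω)) bad :=
        (Measure.map_apply (hX.prodMk hY) hbad).symm
    _ = ∫⁻ ω, P {ω' | (X ω, Y ω') ∈ bad} ∂P := by
        rw [(indepFun_iff_map_prod_eq_prod_map_map hX.aemeasurable hY.aemeasurable).1 h,
          Measure.prod_apply hbad, lintegral_map (measurable_measure_prodMk_left hbad) hX]
        exact lintegral_congr fun ω => Measure.map_apply hY (measurable_prodMk_left hbad)
    _ ≤ ∫⁻ _, θ ∂P := lintegral_mono hθ
    _ = θ := by simp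

lemma measure_lt_le_of_integral_le [IsFiniteMeasure P] {X : Ω → ℝ} (hX : Integrable X P)
    (h0 : ∀ ω, 0 ≤ X ω) {a θ : ℝ} (ha : 0 ≤ a) (h : ∫ ω, X ω ∂P ≤ θ * a) :
    P {ω | a < X ω} ≤ ENNReal.ofReal θ := by
  rcases ha.eq_or_lt with rfl | ha
  · have hz : ∫ ω, X ω ∂P = 0 := le_antisymm (by simpa using h) (integral_nonneg h0)
    have hae := (integral_eq_zero_iff_of_nonneg h0 hX).1 hz
    refine (measure_mono_null (fun ω hω => ?_) (ae_iff.1 hae)).trans_le zero_le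
    exact (show 0 < X ω from hω).ne'
  · have hmarkov := mul_meas_ge_le_integral_of_nonneg (Filter.Eventually.of_forall h0) hX a
    rw [← ofReal_measureReal]
    refine ENNReal.ofReal_le_ofReal ?_
    calc P.real {ω | a < X ω} ≤ P.real {ω | a ≤ X ω} :=
          measureReal_mono fun ω hω => le_of_lt (show a < X ω from hω)
      _ ≤ θ := le_of_mul_le_mul_left (hmarkov.trans (h.trans_eq (mul_comm _ _))) ha

variable {m d₁ d₂ : ℕ} {Z : ℕ × Fin m → Ω → (Fin d₁ → ℝ) × Fin d₂}

lemma measurable_stream {t : ℕ} (hZ : ∀ i, Measurable (Z (t, i))) :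
    Measurable fun ω => stream Z ω t :=
  measurable_pi_lambda _ hZ

lemma indepFun_stateSeq_stream (hZ : ∀ q, Measurable (Z q)) (hind : iIndepFun Z P)
    (Ws : Matrix (Fin d₁) (Fin d₂) ℝ) {τ : ℝ} (hτ : 0 < τ) {t : ℕ} (ht : 1 ≤ t) :
    IndepFun (fun ω => stateSeq Ws τ (stream Z ω) t) (fun ω => stream Z ω t) P := by
  have hdisj : Disjoint {q : ℕ × Fin m | q.1 < t} {q | q.1 = t} :=
    Set.disjoint_left.2 fun _ hlt heq => hlt.ne heq
  have hmeas {s : Set (ℕ × Fin m)} {q : ℕ × Fin m} (hq : q ∈ s) :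
      Measurable[⨆ q ∈ s, MeasurableSpace.comap (Z q) inferInstance] (Z q) :=
    (comap_measurable (Z q)).mono
      (le_biSup (fun q => MeasurableSpace.comap (Z q) inferInstance) hq) le_rfl
  rw [IndepFun_iff_Indep]
  refine indep_of_indep_of_le_left (indep_of_indep_of_le_right
    (indep_iSup_of_disjoint (fun q => (hZ q).comap_le) hind hdisj) ?_) ?_
  · exact (measurable_stream fun i => hmeas rfl).comap_le
  · exact (measurable_stateSeq Ws hτ ht fun s hs => measurable_stream fun i => hmeas hs).comap_le

end Tail

section GoodEvent

variable {m d₁ d₂ k T : ℕ} {Ws : Matrix (Fin d₁) (Fin d₂) ℝ}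
  {Q : Matrix (Fin d₁ ⊕ Fin d₂) (Fin d₁ ⊕ Fin d₂) ℝ} {σ c δ θ : ℝ}

/-- The pairs of a state and a batch for which the noise violates one of the bounds needed for
one step of the iteration: `𝒟(N)` must be small, and on the two projections `S.2` and `Q` it must
be small relative to the current error. -/
def badSet (Ws : Matrix (Fin d₁) (Fin d₂) ℝ) (Q : Matrix (Fin d₁ ⊕ Fin d₂) (Fin d₁ ⊕ Fin d₂) ℝ)
    (σ c : ℝ) : Set (State d₁ d₂ × Batch m d₁ d₂) :=
  {p | (σ / 8) ^ 2 < ‖dilation (noise Ws p.1.1 p.2)‖ ^ 2} ∪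
    ({p | c * specNorm (Ws - p.1.1) * ‖p.1.2‖ ^ 2 <
        ‖dilation (noise Ws p.1.1 p.2) * p.1.2‖ ^ 2} ∪
      {p | c * specNorm (Ws - p.1.1) * ‖Q‖ ^ 2 < ‖dilation (noise Ws p.1.1 p.2) * Q‖ ^ 2})

lemma measurableSet_badSet (Ws : Matrix (Fin d₁) (Fin d₂) ℝ)
    (Q : Matrix (Fin d₁ ⊕ Fin d₂) (Fin d₁ ⊕ Fin d₂) ℝ) (σ c : ℝ) :
    MeasurableSet (badSet Ws Q σ c : Set (State d₁ d₂ × Batch m d₁ d₂)) := by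
  have hN : Measurable fun p : State d₁ d₂ × Batch m d₁ d₂ => dilation (noise Ws p.1.1 p.2) :=
    measurable_dilation.comp (measurable_noise Ws measurable_snd measurable_fst.fst)
  have hP : Measurable fun p : State d₁ d₂ × Batch m d₁ d₂ => p.1.2 := measurable_fst.snd
  have herr : Measurable fun p : State d₁ d₂ × Batch m d₁ d₂ => c * specNorm (Ws - p.1.1) :=
    (measurable_specNorm.comp (measurable_const.sub measurable_fst.fst)).const_mul c
  have hnorm {A : State d₁ d₂ × Batch m d₁ d₂ → Matrix (Fin d₁ ⊕ Fin d₂) (Fin d₁ ⊕ Fin d₂) ℝ}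
      (hA : Measurable A) : Measurable fun p => ‖A p‖ ^ 2 :=
    (measurable_frobenius_norm.comp hA).pow_const 2
  exact (measurableSet_lt measurable_const (hnorm hN)).union
    ((measurableSet_lt (herr.mul (hnorm hP)) (hnorm (hN.mul hP))).union
      (measurableSet_lt (herr.mul measurable_const) (hnorm (hN.mul measurable_const))))

lemma sqrt_dotProduct_col_sub_le_specNorm (Ws W : Matrix (Fin d₁) (Fin d₂) ℝ) (j : Fin d₂) :
    √((W.col j - Ws.col j) ⬝ᵥ (W.col j - Ws.col j)) ≤ specNorm (Ws - W) := by
  refine le_trans (le_of_eq ?_) (sqrt_sum_col_sq_le_specNorm (Ws - W) j)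
  congr 1
  refine Finset.sum_congr rfl fun i _ => ?_
  simp only [Pi.sub_apply, Matrix.col_apply, Matrix.sub_apply]
  ring

lemma sqrt_dotProduct_sub_le_two {ι : Type*} [Fintype ι] {u v : ι → ℝ} (hv : v ⬝ᵥ v = 1)
    (hu : u ⬝ᵥ u = 1 ∨ u = 0) : √((u - v) ⬝ᵥ (u - v)) ≤ 2 := by
  have hu' : u ⬝ᵥ u ≤ 1 := hu.elim le_of_eq fun h => by simp [h]
  have hparallelogram :
      (u - v) ⬝ᵥ (u - v) = 2 * (u ⬝ᵥ u) + 2 * (v ⬝ᵥ v) - (u + v) ⬝ᵥ (u + v) := by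
    simp only [sub_dotProduct, dotProduct_sub, add_dotProduct, dotProduct_add]
    ring
  rw [Real.sqrt_le_left zero_le_two]
  linarith [dotProduct_self_nonneg (u + v)]

section Probability

variable {Ω : Type*} [MeasurableSpace Ω] {P : Measure Ω}

section Batch

variable {Y : Fin m → Ω → (Fin d₁ → ℝ) × Fin d₂} {W : Matrix (Fin d₁) (Fin d₂) ℝ}
  (hY : IsInstanceSample P Y) (hd : 0 < d₂) (hdd : d₂ ≤ d₁) (hm : 0 < m)
  (hWs : ∀ j, Ws.col j ⬝ᵥ Ws.col j = 1) (hW : ∀ j, W.col j ⬝ᵥ W.col j = 1 ∨ W.col j = 0)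
include hY hd hdd hm hWs hW

lemma IsInstanceSample.measure_lt_norm_dilation_noise_le
    (hσ : noiseConst * (d₁ * d₂ / m) * (4 * d₂) ≤ θ * (σ / 8) ^ 2) :
    P {ω | (σ / 8) ^ 2 < ‖dilation (noise Ws W fun i => Y i ω)‖ ^ 2} ≤ ENNReal.ofReal θ := by
  have := hY.indep.isProbabilityMeasure
  simp only [norm_dilation_sq]
  refine measure_lt_le_of_integral_le ((hY.integrable_norm_noise_sq hd hm hWs hW).const_mul 2)
    (fun ω => by positivity) (sq_nonneg _) ?_
  rw [integral_const_mul]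
  have hle := hY.integral_norm_noise_sq_le hd hm hWs hW
    (fun j => sqrt_dotProduct_sub_le_two (hWs j) (hW j)) hdd
  linarith

lemma IsInstanceSample.measure_lt_norm_dilation_noise_mul_le (hc : 0 ≤ c)
    (hcm : noiseConst * (d₁ * d₂ / m) ≤ θ * c) {r : Type*} [Fintype r]
    (X : Matrix (Fin d₁ ⊕ Fin d₂) r ℝ) :
    P {ω | c * specNorm (Ws - W) * ‖X‖ ^ 2 < ‖dilation (noise Ws W fun i => Y i ω) * X‖ ^ 2} ≤
      ENNReal.ofReal θ := by
  have := hY.indep.isProbabilityMeasure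
  have herr := specNorm_nonneg (Ws - W)
  refine measure_lt_le_of_integral_le (hY.integrable_norm_dilation_noise_mul_sq hd hm hWs hW X)
    (fun ω => sq_nonneg _) (by positivity) ?_
  calc _ ≤ noiseConst * (d₁ * d₂ / m) * specNorm (Ws - W) * ‖X‖ ^ 2 :=
        hY.integral_norm_dilation_noise_mul_sq_le hd hm hWs hW
          (sqrt_dotProduct_col_sub_le_specNorm Ws W) hdd X
    _ ≤ θ * c * specNorm (Ws - W) * ‖X‖ ^ 2 := by gcongr
    _ = θ * (c * specNorm (Ws - W) * ‖X‖ ^ 2) := by ring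

lemma IsInstanceSample.measure_mem_badSet_le (hθ : 0 ≤ θ) (hc : 0 ≤ c)
    (hσ : noiseConst * (d₁ * d₂ / m) * (4 * d₂) ≤ θ * (σ / 8) ^ 2)
    (hcm : noiseConst * (d₁ * d₂ / m) ≤ θ * c)
    (Q A : Matrix (Fin d₁ ⊕ Fin d₂) (Fin d₁ ⊕ Fin d₂) ℝ) :
    P {ω | ((W, A), fun i => Y i ω) ∈ badSet Ws Q σ c} ≤ ENNReal.ofReal (3 * θ) := by
  have hmul := hY.measure_lt_norm_dilation_noise_mul_le (r := Fin d₁ ⊕ Fin d₂) hd hdd hm hWs hW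
    hc hcm
  calc _ ≤ ENNReal.ofReal θ + (ENNReal.ofReal θ + ENNReal.ofReal θ) :=
        (measure_union_le _ _).trans (add_le_add
          (hY.measure_lt_norm_dilation_noise_le hd hdd hm hWs hW hσ)
          ((measure_union_le _ _).trans (add_le_add (hmul A) (hmul Q))))
    _ = ENNReal.ofReal (3 * θ) := by
        rw [← ENNReal.ofReal_add hθ hθ, ← ENNReal.ofReal_add hθ (by positivity)]
        ring_nf

end Batch

/-- The state that is paired with batch `t`. At time `0` the projection is left out: it is computed
from batch `0` itself, and hence not independent of it. -/
noncomputable def pairedState (Ws : Matrix (Fin d₁) (Fin d₂) ℝ) (τ : ℝ)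
    (bs : ℕ → Batch m d₁ d₂) (t : ℕ) : State d₁ d₂ :=
  if t = 0 then (0, 0) else stateSeq Ws τ bs t

omit [MeasurableSpace Ω] in
lemma pairedState_fst (Ws : Matrix (Fin d₁) (Fin d₂) ℝ) (τ : ℝ) (bs : ℕ → Batch m d₁ d₂) (t : ℕ) :
    (pairedState Ws τ bs t).1 = (stateSeq Ws τ bs t).1 := by
  cases t <;> rfl

lemma measure_pairedState_mem_badSet_le {Z : ℕ × Fin m → Ω → (Fin d₁ → ℝ) × Fin d₂}
    (hZ : IsInstanceSample P Z) (hd : 0 < d₂) (hdd : d₂ ≤ d₁) (hm : 0 < m)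
    (hWs : ∀ j, Ws.col j ⬝ᵥ Ws.col j = 1) (hθ : 0 ≤ θ) (hc : 0 ≤ c)
    (hσ : noiseConst * (d₁ * d₂ / m) * (4 * d₂) ≤ θ * (σ / 8) ^ 2)
    (hcm : noiseConst * (d₁ * d₂ / m) ≤ θ * c) {τ : ℝ} (hτ : 0 < τ)
    (Q : Matrix (Fin d₁ ⊕ Fin d₂) (Fin d₁ ⊕ Fin d₂) ℝ) (t : ℕ) :
    P {ω | (pairedState Ws τ (stream Z ω) t, stream Z ω t) ∈ badSet Ws Q σ c} ≤
      ENNReal.ofReal (3 * θ) := by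
  have := hZ.indep.isProbabilityMeasure
  have hbatch := hZ.precomp (g := fun i : Fin m => (t, i)) fun _ _ hij => (Prod.mk.inj hij).2
  rcases t with - | t
  · exact hbatch.measure_mem_badSet_le hd hdd hm hWs (fun _ => Or.inr rfl) hθ hc hσ hcm Q 0
  · exact measure_mem_le_of_indepFun
      (measurable_stateSeq Ws hτ t.succ_pos fun _ _ => measurable_stream fun _ => hZ.measurable _)
      (measurable_stream fun _ => hZ.measurable _)
      (indepFun_stateSeq_stream hZ.measurable hZ.indep Ws hτ t.succ_pos)
      (measurableSet_badSet Ws Q σ c) fun ω =>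
        hbatch.measure_mem_badSet_le hd hdd hm hWs
          (stateSeq_col_unit_or_zero Ws τ (stream Z ω) (t + 1)) hθ hc hσ hcm Q _

end Probability

section Recursion

lemma norm_dilation_noise_le_of_notMem_badSet (hσ : 0 ≤ σ) {S : State d₁ d₂} {b : Batch m d₁ d₂}
    (h : (S, b) ∉ badSet Ws Q σ c) : ‖dilation (noise Ws S.1 b)‖ ≤ σ / 8 := by
  simp only [badSet, Set.mem_union, Set.mem_ofPred_eq, not_or, not_lt] at h
  exact le_of_sq_le_sq h.1 (by positivity)

lemma norm_dilation_noise_mul_le_of_notMem_badSet (hδ : 0 ≤ δ) (hk : 1 ≤ k) {S : State d₁ d₂}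
    {b : Batch m d₁ d₂} (h : (S, b) ∉ badSet Ws Q σ (δ ^ 2 / (72 * k)))
    (hS : ‖S.2‖ ^ 2 = (2 * k : ℕ)) (hQ : ‖Q‖ ^ 2 = (2 * k : ℕ)) :
    ‖dilation (noise Ws S.1 b) * S.2‖ ≤ δ / 6 * √(specNorm (Ws - S.1)) ∧
      ‖dilation (noise Ws S.1 b) * Q‖ ≤ δ / 6 * √(specNorm (Ws - S.1)) := by
  have hsq : δ ^ 2 / (72 * k) * specNorm (Ws - S.1) * (2 * k : ℕ) =
      (δ / 6 * √(specNorm (Ws - S.1))) ^ 2 := by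
    rw [mul_pow, Real.sq_sqrt (specNorm_nonneg _)]
    push_cast
    field_simp
    ring
  simp only [badSet, Set.mem_union, Set.mem_ofPred_eq, not_or, not_lt, hS, hQ, hsq] at h
  exact ⟨le_of_sq_le_sq h.2.1 (by positivity), le_of_sq_le_sq h.2.2 (by positivity)⟩

variable {bs : ℕ → Batch m d₁ d₂} {U V : ℕ → Matrix (Fin d₁ ⊕ Fin d₂) (Fin (2 * k)) ℝ}
  (h : IsRangeProj (dilation Ws) Q σ) (htr : Q.trace = (2 * k : ℕ)) (hk : 1 ≤ k)
  (hrun : IsRun k T bs (fun t => labels (bs t) Ws) U V)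
  (hWs : ∀ j, ∑ i, Ws i j ^ 2 = 1)
include h htr hk hrun hWs

lemma specNorm_sub_estimate_one_le (hT : 0 < T) (hσ : σ ≤ specNorm Ws)
    (hgood : ∀ t < T, ‖dilation (noise Ws (stateSeq Ws (σ / 4) bs t).1 (bs t))‖ ≤ σ / 8) :
    specNorm (Ws - estimate (U 1) (V 1)) ≤ specNorm Ws := by
  have hS := tracks_of_isRun h htr hk hrun hgood hT 0 hT.le
  set N := dilation (noise Ws (stateSeq Ws (σ / 4) bs 0).1 (bs 0))
  calc _ ≤ 2 * (2 * ‖N * (stateSeq Ws (σ / 4) bs 0).2‖ + ‖N * Q‖) :=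
        specNorm_sub_estimate_succ_le h htr hk hrun hgood hWs hT
    _ ≤ 2 * (2 * ‖N‖ + ‖N‖) := by
        gcongr
        · exact norm_mul_projection_le hS.isStarProjection N
        · exact norm_mul_projection_le h.isStarProjection N
    _ ≤ specNorm Ws := by linarith [hgood 0 hT, h.gap_pos]

lemma error_recursion (hσ : σ ≤ specNorm Ws) (hδ : 0 ≤ δ)
    (hgood : ∀ t < T,
      (pairedState Ws (σ / 4) bs t, bs t) ∉ badSet Ws Q σ (δ ^ 2 / (72 * k))) :
    (0 < T → specNorm (Ws - estimate (U 1) (V 1)) ≤ specNorm Ws) ∧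
      ∀ t, 1 ≤ t → t < T → specNorm (Ws - estimate (U (t + 1)) (V (t + 1))) ≤
        δ * √(specNorm (Ws - estimate (U t) (V t))) := by
  have hsmall : ∀ t < T, ‖dilation (noise Ws (stateSeq Ws (σ / 4) bs t).1 (bs t))‖ ≤ σ / 8 :=
    fun t ht => pairedState_fst Ws (σ / 4) bs t ▸
      norm_dilation_noise_le_of_notMem_badSet h.gap_pos.le (hgood t ht)
  refine ⟨fun hT => specNorm_sub_estimate_one_le h htr hk hrun hWs hT hσ hsmall,
    fun t ht1 ht => ?_⟩
  have hS := tracks_of_isRun h htr hk hrun hsmall (by omega) t ht.le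
  have hgood := hgood t ht
  rw [pairedState, if_neg (by omega)] at hgood
  obtain ⟨hP, hQ⟩ := norm_dilation_noise_mul_le_of_notMem_badSet hδ hk hgood hS.norm_sq_eq
    ((norm_sq_eq_trace_of_isStarProjection h.isStarProjection).trans htr)
  rw [hS.estimate_eq]
  linarith [specNorm_sub_estimate_succ_le h htr hk hrun hsmall hWs ht]

end Recursion

end GoodEvent

section SampleSize

variable {m d₁ d₂ k T : ℕ} {W : Matrix (Fin d₁) (Fin d₂) ℝ} {η δ : ℝ}

lemma norm_sq_of_unit_col (hWs : ∀ j, ∑ i, W i j ^ 2 = 1) : ‖W‖ ^ 2 = d₂ := by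
  rw [frobenius_norm_sq, Finset.sum_comm]
  simp [hWs]

lemma specNorm_le_of_unit_col (hWs : ∀ j, ∑ i, W i j ^ 2 = 1) : specNorm W ≤ d₂ := by
  have hd : (d₂ : ℝ) ≤ d₂ ^ 2 := by exact_mod_cast Nat.le_self_pow two_ne_zero d₂
  refine (specNorm_le_frobenius_norm W).trans (le_of_sq_le_sq ?_ (by positivity))
  rwa [norm_sq_of_unit_col hWs]

section Rank

variable (hk : 1 ≤ k) (hW : W.rank = k)
include hk hW

lemma width_pos_of_rank_eq : 0 < d₂ := hk.trans (hW.ge.trans W.rank_le_width)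

lemma one_le_singVal_div : 1 ≤ singVal W 1 / singVal W k :=
  (one_le_div (singVal_pos hk hW.ge)).2 (singVal_antitone W hk)

lemma sampleScale_pos : 0 < sampleScale k W := by
  have hd₁ : 0 < d₁ := hk.trans (hW.ge.trans W.rank_le_height)
  have hd₂ := width_pos_of_rank_eq hk hW
  have hκ := one_le_singVal_div hk hW
  unfold sampleScale
  positivity

lemma le_sampleScale :
    720 * (singVal W 1 / singVal W k) ^ 2 * (d₁ * d₂) * k ≤ sampleScale k W := by
  have hκ := one_le_singVal_div hk hW
  have hkpow : (k : ℝ) ≤ (k : ℝ) ^ (3 / 2 : ℝ) :=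
    Real.self_le_rpow_of_one_le (by exact_mod_cast hk) (by norm_num)
  have hsq : 720 * (singVal W 1 / singVal W k) ^ 2 ≤
      (12 * √5 * (singVal W 1 / singVal W k) + 4) ^ 2 := by
    calc 720 * (singVal W 1 / singVal W k) ^ 2
        = (12 * √5 * (singVal W 1 / singVal W k)) ^ 2 := by
          rw [mul_pow, mul_pow, Real.sq_sqrt (by norm_num)]
          norm_num
      _ ≤ _ := by gcongr; linarith
  rw [sampleScale, mul_assoc _ (d₁ : ℝ) (d₂ : ℝ)]
  gcongr

lemma width_le_rank_mul_singVal_sq (hWs : ∀ j, ∑ i, W i j ^ 2 = 1) :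
    (d₂ : ℝ) ≤ k * ((singVal W 1 / singVal W k) ^ 2 * singVal W k ^ 2) := by
  have hσ := singVal_pos hk hW.ge
  rw [div_pow, div_mul_cancel₀ _ (by positivity), ← norm_sq_of_unit_col hWs, ← hW]
  exact norm_sq_le_rank_mul_singVal_sq W

variable (hη : 0 < η) (hT : 0 < T) (hδ : 0 < δ)
  (hm : 2 * noiseConst / η * T * sampleScale k W / δ ^ 2 ≤ m)
include hη hT hδ hm

lemma batch_size_pos : 0 < m := by
  have hscale := sampleScale_pos hk hW
  have hc := noiseConst_pos
  exact_mod_cast (by positivity : 0 < 2 * noiseConst / η * T * sampleScale k W / δ ^ 2).trans_le hm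

lemma noiseLevel_mul_le : noiseConst * (d₁ * d₂ / m) *
    (1440 * T * (singVal W 1 / singVal W k) ^ 2 * k) ≤ η * δ ^ 2 := by
  have hmpos : (0 : ℝ) < m := by exact_mod_cast batch_size_pos hk hW hη hT hδ hm
  have hc := noiseConst_pos
  have hm' : 2 * noiseConst * T * sampleScale k W ≤ m * (η * δ ^ 2) := by
    rw [div_mul_eq_mul_div, div_mul_eq_mul_div, div_div, div_le_iff₀ (by positivity)] at hm
    exact hm
  calc _ = 2 * noiseConst * T * (720 * (singVal W 1 / singVal W k) ^ 2 * (d₁ * d₂) * k) / m := by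
        ring
    _ ≤ 2 * noiseConst * T * sampleScale k W / m := by
        gcongr
        exact le_sampleScale hk hW
    _ ≤ η * δ ^ 2 := (div_le_iff₀' hmpos).2 hm'

lemma noiseLevel_le_of_batch_size : noiseConst * (d₁ * d₂ / m) ≤
    η / (3 * T) * (δ ^ 2 / (72 * k)) := by
  have hκ : 1 ≤ (singVal W 1 / singVal W k) ^ 2 := one_le_pow₀ (one_le_singVal_div hk hW)
  have hc := noiseConst_pos
  rw [div_mul_div_comm, le_div_iff₀ (by positivity)]
  calc _ = noiseConst * (d₁ * d₂ / m) * (216 * T * 1 * k) := by ring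
    _ ≤ noiseConst * (d₁ * d₂ / m) * (1440 * T * (singVal W 1 / singVal W k) ^ 2 * k) := by
        gcongr
        norm_num
    _ ≤ η * δ ^ 2 := noiseLevel_mul_le hk hW hη hT hδ hm

lemma noiseLevel_mul_width_le_of_batch_size (hWs : ∀ j, ∑ i, W i j ^ 2 = 1) (hδ1 : δ ≤ 1) :
    noiseConst * (d₁ * d₂ / m) * (4 * d₂) ≤ η / (3 * T) * (singVal W k / 8) ^ 2 := by
  have hc := noiseConst_pos
  rw [div_mul_eq_mul_div, le_div_iff₀ (by positivity)]
  calc noiseConst * (d₁ * d₂ / m) * (4 * d₂) * (3 * T)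
      ≤ noiseConst * (d₁ * d₂ / m) *
          (4 * (k * ((singVal W 1 / singVal W k) ^ 2 * singVal W k ^ 2))) * (3 * T) := by
        gcongr
        exact width_le_rank_mul_singVal_sq hk hW hWs
    _ = noiseConst * (d₁ * d₂ / m) * (768 * T * (singVal W 1 / singVal W k) ^ 2 * k) *
          (singVal W k / 8) ^ 2 := by ring
    _ ≤ noiseConst * (d₁ * d₂ / m) * (1440 * T * (singVal W 1 / singVal W k) ^ 2 * k) *
          (singVal W k / 8) ^ 2 := by
        gcongr
        norm_num
    _ ≤ η * δ ^ 2 * (singVal W k / 8) ^ 2 := by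
        exact mul_le_mul_of_nonneg_right (noiseLevel_mul_le hk hW hη hT hδ hm) (by positivity)
    _ ≤ η * (singVal W k / 8) ^ 2 := by
        gcongr
        exact mul_le_of_le_one_right hη.le (pow_le_one₀ hδ.le hδ1)

end Rank

end SampleSize

section HighProbability

variable {m d₁ d₂ k T : ℕ} {W : Matrix (Fin d₁) (Fin d₂) ℝ} {η δ ε : ℝ} {Ω : Type*}
  [MeasurableSpace Ω] {P : Measure Ω} {Z : ℕ × Fin m → Ω → (Fin d₁ → ℝ) × Fin d₂}
  (hZ : IsInstanceSample P Z) (hk : 1 ≤ k) (hd : d₂ ≤ d₁) (hW : W.rank = k)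
  (hWs : ∀ j, ∑ i, W i j ^ 2 = 1) (hη : 0 < η)
include hZ hk hd hW hWs hη

lemma measure_not_error_recursion_le (hT : 0 < T) (hδ : 0 < δ) (hδ1 : δ ≤ 1)
    (hm : 2 * noiseConst / η * T * sampleScale k W / δ ^ 2 ≤ m) :
    P {ω | ¬ ∀ U V : ℕ → Matrix (Fin d₁ ⊕ Fin d₂) (Fin (2 * k)) ℝ,
      IsRun k T (stream Z ω) (fun t => labels (stream Z ω t) W) U V →
      (0 < T → specNorm (W - estimate (U 1) (V 1)) ≤ specNorm W) ∧
        ∀ t, 1 ≤ t → t < T → specNorm (W - estimate (U (t + 1)) (V (t + 1))) ≤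
          δ * √(specNorm (W - estimate (U t) (V t)))} ≤ ENNReal.ofReal η := by
  obtain ⟨Q, hQ, htr⟩ := exists_isRangeProj_dilation W hk hW
  have hcol (j : Fin d₂) : W.col j ⬝ᵥ W.col j = 1 := by
    rw [← hWs j]
    exact Finset.sum_congr rfl fun i _ => (sq (W i j)).symm
  set bad : ℕ → Set Ω := fun t => {ω | (pairedState W (singVal W k / 4) (stream Z ω) t,
    stream Z ω t) ∈ badSet W Q (singVal W k) (δ ^ 2 / (72 * k))}
  have hbad (t : ℕ) : P (bad t) ≤ ENNReal.ofReal (3 * (η / (3 * T))) :=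
    measure_pairedState_mem_badSet_le hZ (width_pos_of_rank_eq hk hW) hd
      (batch_size_pos hk hW hη hT hδ hm) hcol (by positivity) (by positivity)
      (noiseLevel_mul_width_le_of_batch_size hk hW hη hT hδ hm hWs hδ1)
      (noiseLevel_le_of_batch_size hk hW hη hT hδ hm) (div_pos hQ.gap_pos four_pos) Q t
  calc _ ≤ P (⋃ t ∈ Finset.range T, bad t) := by
        refine measure_mono fun ω hω => ?_
        by_contra hgood
        simp only [Set.mem_iUnion, Finset.mem_range, not_exists] at hgood
        exact hω fun U V hrun => error_recursion hQ htr hk hrun hWs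
          (singVal_le_specNorm hk (hW.ge.trans W.rank_le_width)) hδ.le hgood
    _ ≤ ∑ t ∈ Finset.range T, P (bad t) := measure_biUnion_finset_le _ _
    _ ≤ ∑ _t ∈ Finset.range T, ENNReal.ofReal (3 * (η / (3 * T))) :=
        Finset.sum_le_sum fun t _ => hbad t
    _ = ENNReal.ofReal η := by
        rw [Finset.sum_const, Finset.card_range, ← ENNReal.ofReal_nsmul, nsmul_eq_mul]
        congr 1
        field_simp

lemma measure_not_twoPhase_le (hδ : 0 < δ) (hδ1 : δ ≤ 1)
    (hm : 2 * noiseConst / η * T * sampleScale k W / δ ^ 2 ≤ m) :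
    P {ω | ¬ ∀ U V : ℕ → Matrix (Fin d₁ ⊕ Fin d₂) (Fin (2 * k)) ℝ,
      IsRun k T (stream Z ω) (fun t => labels (stream Z ω t) W) U V →
      TwoPhase T δ (specNorm W) fun t => specNorm (W - estimate (U t) (V t))} ≤
        ENNReal.ofReal η := by
  rcases T.eq_zero_or_pos with rfl | hT
  · refine (measure_mono_null (t := ∅) ?_ measure_empty).trans_le zero_le
    refine fun ω hω => hω fun U V _ => ?_
    exact twoPhase_of_recursion hδ (fun _ => specNorm_nonneg _) (fun h => absurd h (lt_irrefl 0))
      fun t _ h => absurd h t.not_lt_zero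
  · refine (measure_mono ?_).trans
      (measure_not_error_recursion_le hZ hk hd hW hWs hη hT hδ hδ1 hm)
    refine fun ω hω h => hω fun U V hrun => ?_
    obtain ⟨hfirst, hstep⟩ := h U V hrun
    exact twoPhase_of_recursion hδ (fun _ => specNorm_nonneg _) hfirst hstep

lemma measure_not_final_error_le (hε : 0 < ε) (hε1 : ε ≤ 1)
    (hm : 8 * noiseConst / η * T * sampleScale k W / ε ≤ m)
    (hT : Real.logb 2 d₂ + Real.logb 2 (1 + Real.logb 2 (1 / ε)) + 3 ≤ T) :
    P {ω | ¬ ∀ U V : ℕ → Matrix (Fin d₁ ⊕ Fin d₂) (Fin (2 * k)) ℝ,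
      IsRun k T (stream Z ω) (fun t => labels (stream Z ω t) W) U V →
      specNorm (W - estimate (U T) (V T)) ≤ ε} ≤ ENNReal.ofReal η := by
  have hd₂ := width_pos_of_rank_eq hk hW
  have hTpos := pos_of_logb_add_le hd₂ hε hε1 hT
  have hm' : 2 * noiseConst / η * T * sampleScale k W / (√ε / 2) ^ 2 ≤ m := by
    refine le_of_eq_of_le ?_ hm
    rw [div_pow, Real.sq_sqrt hε.le]
    ring
  refine (measure_mono ?_).trans
    (measure_not_error_recursion_le hZ hk hd hW hWs hη hTpos (by positivity)
      (by linarith [Real.sqrt_le_one.2 hε1]) hm')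
  refine fun ω hω h => hω fun U V hrun => ?_
  obtain ⟨hfirst, hstep⟩ := h U V hrun
  exact final_error_le (err := fun t => specNorm (W - estimate (U t) (V t))) hd₂ hε hε1 hT
    (specNorm_nonneg _) ((hfirst hTpos).trans (specNorm_le_of_unit_col hWs)) hstep

end HighProbability

end OneBit

theorem theorem1 :
    ∃ p : ℕ, ∀ η : ℝ, 0 < η → η < 1 → ∃ C : ℝ, 0 < C ∧
      ∀ (d₁ d₂ k T m : ℕ), 1 ≤ k → d₂ < d₁ →
      ∀ W : Matrix (Fin d₁) (Fin d₂) ℝ, W.rank = k → (∀ j, ∑ i, W i j ^ 2 = 1) →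
      ∀ (Ω : Type*) [MeasurableSpace Ω] (P : Measure Ω) [IsProbabilityMeasure P]
        (Z : ℕ × Fin m → Ω → (Fin d₁ → ℝ) × Fin d₂),
        (∀ q, Measurable (Z q)) → iIndepFun Z P →
        (∀ q, P.map (Z q) = OneBit.instanceLaw d₁ d₂) →
        (∀ δ : ℝ, 0 < δ → δ ≤ 1 →
          C * (T : ℝ) ^ p * OneBit.sampleScale k W / δ ^ 2 ≤ m →
          P {ω | ¬ ∀ U V : ℕ → Matrix (Fin d₁ ⊕ Fin d₂) (Fin (2 * k)) ℝ,
              OneBit.IsRun k T (OneBit.stream Z ω)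
                (fun t => OneBit.labels (OneBit.stream Z ω t) W) U V →
              OneBit.TwoPhase T δ (OneBit.specNorm W)
                (fun t => OneBit.specNorm (W - OneBit.estimate (U t) (V t)))}
            ≤ ENNReal.ofReal η) ∧
        (∀ ε : ℝ, 0 < ε → ε ≤ 1 →
          C * (T : ℝ) ^ p * OneBit.sampleScale k W / ε ≤ m →
          Real.logb 2 d₂ + Real.logb 2 (1 + Real.logb 2 (1 / ε)) + 3 ≤ T →
          P {ω | ¬ ∀ U V : ℕ → Matrix (Fin d₁ ⊕ Fin d₂) (Fin (2 * k)) ℝ,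
              OneBit.IsRun k T (OneBit.stream Z ω)
                (fun t => OneBit.labels (OneBit.stream Z ω t) W) U V →
              OneBit.specNorm (W - OneBit.estimate (U T) (V T)) ≤ ε}
            ≤ ENNReal.ofReal η) := by
  refine ⟨1, fun η hη _ => ⟨8 * OneBit.noiseConst / η,
    div_pos (mul_pos (by norm_num) OneBit.noiseConst_pos) hη, ?_⟩⟩
  intro d₁ d₂ k T m hk hd W hW hWs Ω _ P _ Z hmeas hind hlaw
  have hZ : OneBit.IsInstanceSample P Z := ⟨hmeas, hind, hlaw⟩
  simp only [pow_one]
  refine ⟨fun δ hδ hδ1 hm => ?_, fun ε hε hε1 hm hT => ?_⟩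
  · have hm' : 2 * OneBit.noiseConst / η * T * OneBit.sampleScale k W / δ ^ 2 ≤ m := by
      have hc := OneBit.noiseConst_pos
      have hscale := OneBit.sampleScale_pos hk hW
      refine le_trans ?_ hm
      gcongr
      norm_num
    exact OneBit.measure_not_twoPhase_le hZ hk hd.le hW hWs hη hδ hδ1 hm'
  · exact OneBit.measure_not_final_error_le hZ hk hd.le hW hWs hη hε hε1 hm hT
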